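/- Let $m\ge 1$, let $D\subset\mathbb{C}^m$ be an open set, and let $X$ be a compact complex manifold of dimension $n$. Let $\eta$ be a smooth closed positive $(1,1)$-form on $X$, i.e. a positive real $(1,1)$-form which near every point of $X$ can be written $\eta=i\partial\bar\partial\psi$ with $\psi$ a smooth real function (a local potential of $\eta$); for example, the curvature form of a positively curved Hermitian holomorphic line bundle on $X$. A function $u$ on $D\times X$ is called $\eta$-subharmonic on graphs if, for every holomorphic map $f$ from an open subset of $D$ to $X$ and every local potential $\psi$ of $\eta$, the function $z\mapsto\psi(f(z))+u(z,f(z))$ is subharmonic where it is defined. Let $u:D\times X\to\mathbb{R}$ be bounded, upper semicontinuous and $\eta$-subharmonic on graphs, and let $D'$ be a relatively compact open subset of $D$. Then there exist positive numbers $\varepsilon_j\searrow 0$ and functions $u_j\in C^\infty(D'\times X)$ decreasing pointwise to $u$ on $D'\times X$ such that, for every $j$, every holomorphic map $f$ from an open subset of $D'$ to $X$, and every local potential $\psi$ of $\eta$, $$\Delta\bigl(\psi(f(z))+u_j(z,f(z))\bigr)\ \ge\ \varepsilon_j\,\Delta\bigl(\psi(f(z))\bigr)$$ at every point $z$ of the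 domain of $f$ such that $f(z)$ lies in the domain of $\psi$. Here $\Delta$ is the Euclidean Laplacian on $\mathbb{C}^m$. -/

import Mathlib

open Set Filter Topology MeasureTheory
open scoped Manifold ContDiff

noncomputable section

/-- Complex Euclidean space `ℂ^d`, with its Hermitian norm. -/
abbrev CSpace (d : ℕ) : Type := EuclideanSpace ℂ (Fin d)

/-- A real-valued function `φ` is subharmonic on the set `W ⊆ ℂ^m` (used for open `W`): it is upper
semicontinuous, and its value at the centre of each closed ball contained in `W` is at most its
(Lebesgue) mean over that ball. Finite-valued subharmonic functions are integrable on such balls;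
this is recorded so that the mean is a genuine one. -/
structure IsSubharmonicOn {m : ℕ} (φ : CSpace m → ℝ) (W : Set (CSpace m)) : Prop where
  usc : UpperSemicontinuousOn φ W
  integrable : ∀ a : CSpace m, ∀ r : ℝ, 0 < r → Metric.closedBall a r ⊆ W →
    IntegrableOn φ (Metric.closedBall a r) volume
  submean : ∀ a : CSpace m, ∀ r : ℝ, 0 < r → Metric.closedBall a r ⊆ W →
    φ a ≤ ⨍ z in Metric.closedBall a r, φ z

section Manifold

variable {n : ℕ} {X : Type*} [TopologicalSpace X] [ChartedSpace (CSpace n) X]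

/-- The complex structure `v ↦ i v` on the real tangent space of a complex manifold. Mathlib's
tangent space at `x` is the model space, read in the preferred chart at `x`. -/
def tangentJ {x : X} (v : TangentSpace 𝓘(ℝ, CSpace n) x) : TangentSpace 𝓘(ℝ, CSpace n) x :=
  (Complex.I • (show CSpace n from v) : CSpace n)

/-- The real Hessian of `ψ` at `x` in the preferred chart at `x`. -/
def chartHessian (ψ : X → ℝ) (x : X) (v w : TangentSpace 𝓘(ℝ, CSpace n) x) : ℝ :=
  fderiv ℝ (fderiv ℝ (ψ ∘ (chartAt (CSpace n) x).symm)) (chartAt (CSpace n) x x) v w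

/-- The real `(1,1)`-form `i ∂∂̄ψ = i ∑ ψ_{j k̄} dz_j ∧ dz̄_k` at `x`, evaluated on two real tangent
vectors: in terms of the real Hessian `H` of `ψ` in holomorphic coordinates,
`(i ∂∂̄ψ)(v, w) = (H(iv, w) - H(v, iw)) / 2`. Its value does not depend on the holomorphic chart. -/
def iDDbar (ψ : X → ℝ) (x : X) (v w : TangentSpace 𝓘(ℝ, CSpace n) x) : ℝ :=
  (chartHessian ψ x (tangentJ v) w - chartHessian ψ x v (tangentJ w)) / 2

/-- `ψ` is a (smooth) local potential on the open set `U` of the real two-form `η`: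
`η = i ∂∂̄ψ` on `U`. -/
structure IsLocalPotential
    (η : ∀ x : X, TangentSpace 𝓘(ℝ, CSpace n) x →L[ℝ] TangentSpace 𝓘(ℝ, CSpace n) x →L[ℝ] ℝ)
    (U : Set X) (ψ : X → ℝ) : Prop where
  isOpen : IsOpen U
  smooth : ContMDiffOn 𝓘(ℝ, CSpace n) 𝓘(ℝ, ℝ) ∞ ψ U
  eq_iDDbar : ∀ x ∈ U, ∀ v w : TangentSpace 𝓘(ℝ, CSpace n) x, η x v w = iDDbar ψ x v w

/-- `η` is a Kähler form (smooth closed positive `(1,1)`-form): near each point it is `i ∂∂̄ψ` for a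
smooth real `ψ`, and `η(v, iv) > 0` for each nonzero real tangent vector `v`. The curvature form of
a positively curved Hermitian holomorphic line bundle is of this kind, the local potentials being
its local weights `-log g(s, s)`. -/
structure IsKahlerForm
    (η : ∀ x : X, TangentSpace 𝓘(ℝ, CSpace n) x →L[ℝ] TangentSpace 𝓘(ℝ, CSpace n) x →L[ℝ] ℝ) :
    Prop where
  exists_potential : ∀ x : X, ∃ U : Set X, ∃ ψ : X → ℝ, x ∈ U ∧ IsLocalPotential η U ψ
  pos : ∀ x : X, ∀ v : TangentSpace 𝓘(ℝ, CSpace n) x, v ≠ 0 → 0 < η x v (tangentJ v)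

/-- `u` on `D × X` is `η`-subharmonic on graphs: for each holomorphic map `f` from an open subset
`W` of `D` to `X` and each local potential `ψ` of `η` on an open set containing `f(W)`, the function
`z ↦ ψ(f(z)) + u(z, f(z))` is subharmonic on `W`. As `W` is arbitrary, this also covers maps whose
image is not contained in the domain of one potential, by restriction. -/
def IsSubharmonicOnGraphs {m : ℕ}
    (η : ∀ x : X, TangentSpace 𝓘(ℝ, CSpace n) x →L[ℝ] TangentSpace 𝓘(ℝ, CSpace n) x →L[ℝ] ℝ)
    (D : Set (CSpace m)) (u : CSpace m × X → ℝ) : Prop :=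
  ∀ (W : Set (CSpace m)) (f : CSpace m → X) (U : Set X) (ψ : X → ℝ),
    IsOpen W → W ⊆ D → MDifferentiableOn 𝓘(ℂ, CSpace m) 𝓘(ℂ, CSpace n) f W →
    IsLocalPotential η U ψ → MapsTo f W U →
    IsSubharmonicOn (fun z => ψ (f z) + u (z, f z)) W

end Manifold

end

/-! The sub-mean value inequality along graphs has to be turned into smoothness, in the base and in
the fibre, with an arbitrarily small loss of positivity. The loss is repaired at the end by the
positivity of `η`: if `Δ(ψ + V) ≥ -γ Δψ` along graphs and `γ ≤ 1/2`, then `Δ(ψ + (1 - 2γ) V) ≥ γ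
Δψ`. All local potentials have the same Laplacian along a given map
(`IsLocalPotential.laplacian_comp_eq`), so the potential can be changed freely.

Averaging `u` over small balls of the base gives a function `A ≥ u` whose local versions `ψ + A`
keep the inequality along graphs and are equicontinuous in the base variable. A disc in a fibre can
be swept out over an arbitrarily small base ball, so `ψ + A` has a sub-mean value property on fibre
discs (`GraphSubmean.discSubmean`). For bounded functions of this kind a Hadamard-type estimate
(`DiscSubmean.supBall_mul_le`) shows that the suprema over concentric balls of radii `ε` and `Lε`
differ by `O(1 / log(1/ε))`, uniformly.

This has two consequences. Coordinate changes distort small balls by a bounded factor, so the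
suprema of `A` over coordinate `ε`-balls hardly depend on the chart
(`CoordPatch.exists_sup_le_sup`). Moreover a Harnack-type inequality for the defect from the
supremum shows that convolution with a bump is close to that supremum
(`IsGraphPotential.exists_mollification`). Hence the mollifications of `ψ + A` in the various
charts, each minus its own `ψ`, almost agree on overlaps.

Each of them is raised by `γ` times a cut-off function and they are glued by a regularised maximum
(`exists_glue`). Near the edge of its patch a candidate lies well below another one and does not
influence the maximum, so the result is smooth. Convexity of the maximum preserves lower bounds for
Laplacians, and the cut-offs cost at most a multiple of `γ Δψ`, since their Levi forms are dominated
by `η`.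

The smoothing so obtained lies above `u - γ` and below `u + γ` at some nearby point
(`IsBoundedGraphSubharmonic.exists_smoothing`). Upper semicontinuity and compactness then allow each
smoothing to be chosen below the previous one, up to constants that decrease geometrically. -/

set_option linter.unusedSectionVars false

/-! ### Holomorphic maps of several variables are smooth -/

section Osgood

variable {E G : Type} [NormedAddCommGroup E] [NormedSpace ℂ E] [FiniteDimensional ℂ E]
  [NormedAddCommGroup G] [NormedSpace ℂ G] [FiniteDimensional ℂ G]

/-- Cauchy's estimate for the Fréchet derivative of a holomorphic map. -/
theorem norm_fderiv_le_of_differentiableOn_ball {f : E → G} {z₀ : E} {ρ C : ℝ} (hρ : 0 < ρ)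
    (hf : DifferentiableOn ℂ f (Metric.ball z₀ ρ)) (hC : ∀ z ∈ Metric.ball z₀ ρ, ‖f z‖ ≤ C)
    {z : E} (hz : z ∈ Metric.ball z₀ (ρ / 2)) : ‖fderiv ℂ f z‖ ≤ 4 * C / ρ := by
  have hC0 : 0 ≤ C := (norm_nonneg _).trans (hC z₀ (Metric.mem_ball_self hρ))
  refine ContinuousLinearMap.opNorm_le_bound _ (by positivity) fun w => ?_
  rcases eq_or_ne w 0 with rfl | hw
  · simp
  have hw' : 0 < ‖w‖ := norm_pos_iff.2 hw
  -- The disc `z + t • w`, `‖t‖ ≤ r`, moves at most `ρ / 4` away from `z`, so it stays in the ball,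
  -- and the one-variable bound `C / r` is the required multiple of `‖w‖`.
  set r : ℝ := ρ / 4 / ‖w‖ with hr
  have hr0 : 0 < r := by positivity
  have hmem : ∀ t : ℂ, t ∈ Metric.closedBall (0 : ℂ) r → z + t • w ∈ Metric.ball z₀ ρ := by
    intro t ht
    rw [mem_closedBall_zero_iff] at ht
    rw [mem_ball_iff_norm] at hz ⊢
    have h1 : ‖t • w‖ ≤ ρ / 4 := by
      rw [norm_smul]
      calc ‖t‖ * ‖w‖ ≤ r * ‖w‖ := by gcongr
        _ = ρ / 4 := by rw [hr]; field_simp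
    calc ‖z + t • w - z₀‖ = ‖(z - z₀) + t • w‖ := by congr 1; abel
      _ ≤ ‖z - z₀‖ + ‖t • w‖ := norm_add_le _ _
      _ < ρ := by linarith
  have hdat : ∀ t ∈ Metric.closedBall (0 : ℂ) r,
      HasDerivAt (fun t : ℂ => f (z + t • w)) (fderiv ℂ f (z + t • w) w) t := by
    intro t ht
    have h1 := (hf.differentiableAt (Metric.isOpen_ball.mem_nhds (hmem t ht))).hasFDerivAt
    have h2 : HasDerivAt (fun t : ℂ => z + t • w) w t := by
      simpa using ((hasDerivAt_id t).smul_const w).const_add z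
    exact h1.comp_hasDerivAt t h2
  have hd : DiffContOnCl ℂ (fun t : ℂ => f (z + t • w)) (Metric.ball 0 r) := by
    apply DifferentiableOn.diffContOnCl
    rw [closure_ball _ hr0.ne']
    exact fun t ht => (hdat t ht).differentiableAt.differentiableWithinAt
  have h0 := Complex.norm_deriv_le_of_forall_mem_sphere_norm_le hr0 hd
    (fun t ht => hC _ (hmem t (Metric.sphere_subset_closedBall ht)))
  rw [(hdat 0 (Metric.mem_closedBall_self hr0.le)).deriv] at h0
  simp only [zero_smul, add_zero] at h0
  calc ‖fderiv ℂ f z w‖ ≤ C / r := h0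
    _ = 4 * C / ρ * ‖w‖ := by rw [hr]; field_simp

/-- Directional derivatives of a holomorphic map are holomorphic. -/
theorem differentiableOn_fderiv_apply {f : E → G} {s : Set E} (hs : IsOpen s)
    (hf : DifferentiableOn ℂ f s) (v : E) : DifferentiableOn ℂ (fun z => fderiv ℂ f z v) s := by
  intro z₀ hz₀
  refine DifferentiableAt.differentiableWithinAt ?_
  rcases eq_or_ne v 0 with rfl | hv
  · simp
  have hv' : 0 < ‖v‖ := norm_pos_iff.2 hv
  obtain ⟨ρ, hρ, hball⟩ : ∃ ρ > 0, Metric.ball z₀ ρ ⊆ s ∩ {z | ‖f z‖ < ‖f z₀‖ + 1} := by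
    refine Metric.mem_nhds_iff.1 (inter_mem (hs.mem_nhds hz₀) ?_)
    have := (hf.continuousOn.continuousAt (hs.mem_nhds hz₀)).norm
    exact this.eventually (gt_mem_nhds (by linarith))
  set C := ‖f z₀‖ + 1
  have hfb : DifferentiableOn ℂ f (Metric.ball z₀ ρ) := hf.mono fun z hz => (hball hz).1
  have hCb : ∀ z ∈ Metric.ball z₀ ρ, ‖f z‖ ≤ C := fun z hz => (hball hz).2.le
  set r : ℝ := ρ / 4 / ‖v‖ with hr
  have hr0 : 0 < r := by positivity
  have hmem : ∀ z ∈ Metric.ball z₀ (ρ / 4), ∀ t : ℂ, t ∈ Metric.closedBall (0 : ℂ) r →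
      z + t • v ∈ Metric.ball z₀ (ρ / 2) := by
    intro z hz t ht
    rw [mem_closedBall_zero_iff] at ht
    rw [mem_ball_iff_norm] at hz ⊢
    have h1 : ‖t • v‖ ≤ ρ / 4 := by
      rw [norm_smul]
      calc ‖t‖ * ‖v‖ ≤ r * ‖v‖ := by gcongr
        _ = ρ / 4 := by rw [hr]; field_simp
    calc ‖z + t • v - z₀‖ = ‖(z - z₀) + t • v‖ := by congr 1; abel
      _ ≤ ‖z - z₀‖ + ‖t • v‖ := norm_add_le _ _
      _ < ρ / 2 := by linarith
  have hhalf : Metric.ball z₀ (ρ / 2) ⊆ Metric.ball z₀ ρ := Metric.ball_subset_ball (by linarith)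
  have hdiffAt : ∀ z ∈ Metric.ball z₀ (ρ / 2), DifferentiableAt ℂ f z := fun z hz =>
    hfb.differentiableAt (Metric.isOpen_ball.mem_nhds (hhalf hz))
  -- Cauchy's formula
  have hcauchy : ∀ z ∈ Metric.ball z₀ (ρ / 4), fderiv ℂ f z v =
      ((2 * Real.pi * Complex.I : ℂ)⁻¹ • ∮ t in C(0, r), ((t - 0) ^ 2)⁻¹ • f (z + t • v)) := by
    intro z hz
    have hdat : ∀ t ∈ Metric.closedBall (0 : ℂ) r,
        HasDerivAt (fun t : ℂ => f (z + t • v)) (fderiv ℂ f (z + t • v) v) t := by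
      intro t ht
      have h2 : HasDerivAt (fun t : ℂ => z + t • v) v t := by
        simpa using ((hasDerivAt_id t).smul_const v).const_add z
      exact (hdiffAt _ (hmem z hz t ht)).hasFDerivAt.comp_hasDerivAt t h2
    have hd : DiffContOnCl ℂ (fun t : ℂ => f (z + t • v)) (Metric.ball 0 r) := by
      apply DifferentiableOn.diffContOnCl
      rw [closure_ball _ hr0.ne']
      exact fun t ht => (hdat t ht).differentiableAt.differentiableWithinAt
    have h0 := (hdat 0 (Metric.mem_closedBall_self hr0.le)).deriv
    simp only [zero_smul, add_zero] at h0
    have hI := hd.deriv_eq_smul_circleIntegral hr0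
    simp only [one_div] at hI
    rw [← h0, hI, smul_smul, inv_mul_cancel₀ Complex.two_pi_I_ne_zero, one_smul]
  have hev : (fun z => fderiv ℂ f z v) =ᶠ[𝓝 z₀] fun z =>
      ((2 * Real.pi * Complex.I : ℂ)⁻¹ • ∮ t in C(0, r), ((t - 0) ^ 2)⁻¹ • f (z + t • v)) := by
    filter_upwards [Metric.ball_mem_nhds z₀ (show 0 < ρ / 4 by positivity)] with z hz
    exact hcauchy z hz
  refine DifferentiableAt.congr_of_eventuallyEq ?_ hev
  refine DifferentiableAt.const_smul ?_ _
  borelize E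
  borelize G
  have : ProperSpace E := FiniteDimensional.proper ℂ E
  have : ProperSpace G := FiniteDimensional.proper ℂ G
  have hcm : ∀ θ : ℝ, circleMap 0 r θ ∈ Metric.closedBall (0 : ℂ) r := fun θ =>
    circleMap_mem_closedBall _ hr0.le θ
  have hcont : ∀ z ∈ Metric.ball z₀ (ρ / 4), Continuous fun θ : ℝ =>
      deriv (circleMap 0 r) θ • ((circleMap 0 r θ - 0) ^ 2)⁻¹ • f (z + circleMap 0 r θ • v) := by
    intro z hz
    have hc1 : Continuous fun θ : ℝ => f (z + circleMap 0 r θ • v) := by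
      refine ContinuousOn.comp_continuous (s := Metric.ball z₀ ρ) hfb.continuousOn ?_ ?_
      · exact continuous_const.add ((continuous_circleMap 0 r).smul continuous_const)
      · exact fun θ => hhalf (hmem z hz _ (hcm θ))
    have hc2 : Continuous fun θ : ℝ => ((circleMap 0 r θ - 0) ^ 2)⁻¹ := by
      refine Continuous.inv₀ (by fun_prop) fun θ => ?_
      simpa using circleMap_ne_center (c := 0) (θ := θ) hr0.ne'
    have hc3 : Continuous (deriv (circleMap 0 r)) := by
      have : deriv (circleMap 0 r) = fun θ => circleMap 0 r θ * Complex.I := by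
        ext θ; simp
      rw [this]; fun_prop
    exact hc3.smul (hc2.smul hc1)
  -- Differentiation of Cauchy's formula under the integral sign. The dominating constant comes from
  -- Cauchy's estimate on the half ball, which contains all the points `z + t • v` involved.
  have key := intervalIntegral.hasFDerivAt_integral_of_dominated_of_fderiv_le (𝕜 := ℂ)
    (μ := volume) (a := 0) (b := 2 * Real.pi)
    (F := fun (z : E) (θ : ℝ) =>
      deriv (circleMap 0 r) θ • ((circleMap 0 r θ - 0) ^ 2)⁻¹ • f (z + circleMap 0 r θ • v))
    (F' := fun (z : E) (θ : ℝ) => deriv (circleMap 0 r) θ • ((circleMap 0 r θ - 0) ^ 2)⁻¹ •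
      fderiv ℂ f (z + circleMap 0 r θ • v))
    (bound := fun _ => r * (r ^ 2)⁻¹ * (4 * C / ρ))
    (x₀ := z₀) (s := Metric.ball z₀ (ρ / 4)) (Metric.ball_mem_nhds z₀ (by positivity))
    ?_ ?_ ?_ ?_ ?_ ?_
  · exact key.differentiableAt
  · filter_upwards [Metric.ball_mem_nhds z₀ (show 0 < ρ / 4 by positivity)] with z hz
    exact (hcont z hz).aestronglyMeasurable
  · exact (hcont z₀ (Metric.mem_ball_self (by positivity))).intervalIntegrable _ _
  -- Continuity of the derivative is a consequence of this theorem and cannot be used here;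
  -- measurability is enough.
  · have hm1 : Measurable fun θ : ℝ => fderiv ℂ f (z₀ + circleMap 0 r θ • v) :=
      (measurable_fderiv ℂ f).comp (by fun_prop)
    have hc2 : Measurable fun θ : ℝ => ((circleMap 0 r θ - 0) ^ 2)⁻¹ := by fun_prop
    have hc3 : Measurable (deriv (circleMap 0 r)) := measurable_deriv _
    exact (hc3.smul (hc2.smul hm1)).aestronglyMeasurable
  · refine Eventually.of_forall fun θ _ z hz => ?_
    rw [norm_smul, norm_smul, ← mul_assoc]
    have := norm_fderiv_le_of_differentiableOn_ball hρ hfb hCb (hmem z hz _ (hcm θ))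
    have h1 : ‖deriv (circleMap 0 r) θ‖ = r := by simp [abs_of_pos hr0]
    have h2 : ‖((circleMap 0 r θ - 0) ^ 2)⁻¹‖ = (r ^ 2)⁻¹ := by simp
    rw [h1, h2]
    gcongr
  · simp
  · refine Eventually.of_forall fun θ _ z hz => ?_
    have h1 := (hdiffAt _ (hmem z hz _ (hcm θ))).hasFDerivAt
    have h2 : HasFDerivAt (fun z : E => z + circleMap 0 r θ • v) (ContinuousLinearMap.id ℂ E) z :=
      (hasFDerivAt_id z).add_const _
    have h3 := h1.comp z h2
    rw [ContinuousLinearMap.comp_id] at h3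
    exact (h3.const_smul _).const_smul _

/-- Induction on the order: directional derivatives are again holomorphic, and in finite dimension
the derivative is as regular as all its evaluations at fixed vectors. -/
theorem contDiffOn_nat_of_differentiableOn_complex (k : ℕ) {f : E → G} {s : Set E}
    (hs : IsOpen s) (hf : DifferentiableOn ℂ f s) : ContDiffOn ℂ k f s := by
  induction k generalizing f with
  | zero => simpa using hf.continuousOn
  | succ k ih =>
    rw [show ((k + 1 : ℕ) : ℕ∞ω) = (k : ℕ∞ω) + 1 by push_cast; rfl,
      contDiffOn_succ_iff_fderiv_of_isOpen hs]
    refine ⟨hf, by simp, ?_⟩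
    rw [contDiffOn_clm_apply]
    exact fun v => ih (differentiableOn_fderiv_apply hs hf v)

/-- A map that is complex differentiable on an open set of a finite-dimensional space is smooth. -/
theorem contDiffOn_of_differentiableOn_complex {f : E → G} {s : Set E}
    (hs : IsOpen s) (hf : DifferentiableOn ℂ f s) : ContDiffOn ℂ ∞ f s :=
  contDiffOn_infty.2 fun k => contDiffOn_nat_of_differentiableOn_complex k hs hf

end Osgood

/-! ### Levi forms, and Laplacians along holomorphic maps -/

section Levi

variable {m n : ℕ}

/-- The Levi form of `Q` at `z` on the diagonal: the Hessian averaged over the action of `i`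
(up to a factor `2`). -/
noncomputable def leviForm (Q : CSpace n → ℝ) (z v : CSpace n) : ℝ :=
  fderiv ℝ (fderiv ℝ Q) z v v + fderiv ℝ (fderiv ℝ Q) z (Complex.I • v) (Complex.I • v)

theorem leviForm_congr {Q Q' : CSpace n → ℝ} {z : CSpace n} (h : Q =ᶠ[𝓝 z] Q') (v : CSpace n) :
    leviForm Q z v = leviForm Q' z v := by
  have h1 : fderiv ℝ Q =ᶠ[𝓝 z] fderiv ℝ Q' := h.fderiv
  simp only [leviForm, h1.fderiv_eq]

theorem fderiv_fderiv_apply {Q : CSpace n → ℝ} {z : CSpace n} (hQ : ContDiffAt ℝ 2 Q z)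
    (v w : CSpace n) :
    fderiv ℝ (fderiv ℝ Q) z v w = fderiv ℝ (fun y => fderiv ℝ Q y w) z v := by
  have h : DifferentiableAt ℝ (fderiv ℝ Q) z :=
    (hQ.fderiv_right (m := 1) (by norm_num)).differentiableAt (by norm_num)
  have := (h.hasFDerivAt.clm_apply (hasFDerivAt_const w z)).fderiv
  rw [this]
  simp

theorem contDiffOn_real_of_holomorphic {f : CSpace m → CSpace n} {s : Set (CSpace m)}
    (hs : IsOpen s) (hf : DifferentiableOn ℂ f s) : ContDiffOn ℝ ∞ f s :=
  (contDiffOn_of_differentiableOn_complex hs hf).restrict_scalars ℝ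

theorem contDiffAt_two_comp_holomorphic {P : CSpace n → ℝ} {f : CSpace m → CSpace n}
    {s : Set (CSpace m)} (hs : IsOpen s) (hf : DifferentiableOn ℂ f s) {z : CSpace m} (hz : z ∈ s)
    (hP : ContDiffAt ℝ 2 P (f z)) : ContDiffAt ℝ 2 (P ∘ f) z :=
  hP.comp z (((contDiffOn_real_of_holomorphic hs hf).contDiffAt (hs.mem_nhds hz)).of_le
    (WithTop.coe_le_coe.2 le_top))

/-- The second derivative of a composition with a holomorphic map. -/
theorem fderiv_fderiv_comp {P : CSpace n → ℝ} {f : CSpace m → CSpace n} {s : Set (CSpace m)}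
    (hs : IsOpen s) (hf : DifferentiableOn ℂ f s) {z : CSpace m} (hz : z ∈ s)
    (hP : ContDiffAt ℝ 2 P (f z)) (v w : CSpace m) :
    fderiv ℝ (fderiv ℝ (P ∘ f)) z v w =
      fderiv ℝ (fderiv ℝ P) (f z) (fderiv ℂ f z v) (fderiv ℂ f z w) +
        fderiv ℝ P (f z) (fderiv ℂ (fun y => fderiv ℂ f y w) z v) := by
  have hfz : DifferentiableAt ℂ f z := hf.differentiableAt (hs.mem_nhds hz)
  rw [fderiv_fderiv_apply (contDiffAt_two_comp_holomorphic hs hf hz hP)]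
  have hev : ∀ᶠ y in 𝓝 z, DifferentiableAt ℝ P (f y) ∧ y ∈ s := by
    refine Filter.Eventually.and ?_ (hs.mem_nhds hz)
    have h1 : ∀ᶠ x in 𝓝 (f z), ContDiffAt ℝ 2 P x := hP.eventually (by simp)
    exact (hfz.continuousAt.eventually h1).mono fun y hy => hy.differentiableAt (by norm_num)
  have heq : (fun y => fderiv ℝ (P ∘ f) y w) =ᶠ[𝓝 z]
      fun y => fderiv ℝ P (f y) (fderiv ℂ f y w) := by
    filter_upwards [hev] with y hy
    have h1 := (hf.differentiableAt (hs.mem_nhds hy.2)).hasFDerivAt.restrictScalars ℝ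
    have h2 := hy.1.hasFDerivAt.comp y h1
    rw [h2.fderiv]
    rfl
  rw [heq.fderiv_eq]
  have h1 : DifferentiableAt ℝ (fderiv ℝ P) (f z) :=
    (hP.fderiv_right (m := 1) (by norm_num)).differentiableAt (by norm_num)
  have h2 : HasFDerivAt (fun y => fderiv ℝ P (f y)) _ z :=
    h1.hasFDerivAt.comp z (hfz.hasFDerivAt.restrictScalars ℝ)
  have h3 : DifferentiableAt ℂ (fun y => fderiv ℂ f y w) z :=
    (differentiableOn_fderiv_apply hs hf w).differentiableAt (hs.mem_nhds hz)
  have h4 := h2.clm_apply (h3.hasFDerivAt.restrictScalars ℝ)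
  rw [h4.fderiv]
  simp [add_comm]

/-- The first-order term of the chain rule involves the second derivative of `f`, which is complex
bilinear: its values on `(v, v)` and `(iv, iv)` are opposite and cancel. -/
theorem leviForm_comp {P : CSpace n → ℝ} {f : CSpace m → CSpace n} {s : Set (CSpace m)}
    (hs : IsOpen s) (hf : DifferentiableOn ℂ f s) {z : CSpace m} (hz : z ∈ s)
    (hP : ContDiffAt ℝ 2 P (f z)) (v : CSpace m) :
    leviForm (P ∘ f) z v = leviForm P (f z) (fderiv ℂ f z v) := by
  have hlin : ∀ y, (fun y => fderiv ℂ f y (Complex.I • v)) y =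
      (Complex.I • fun y => fderiv ℂ f y v) y := fun y => by simp
  have h3 : DifferentiableAt ℂ (fun y => fderiv ℂ f y v) z :=
    (differentiableOn_fderiv_apply hs hf v).differentiableAt (hs.mem_nhds hz)
  rw [leviForm, leviForm, fderiv_fderiv_comp hs hf hz hP, fderiv_fderiv_comp hs hf hz hP,
    funext hlin, fderiv_const_smul h3]
  have : (Complex.I • fderiv ℂ (fun y => fderiv ℂ f y v) z) (Complex.I • v) =
      - fderiv ℂ (fun y => fderiv ℂ f y v) z v := by
    rw [smul_apply, map_smul, smul_smul, Complex.I_mul_I, neg_one_smul]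
  rw [this]
  simp only [map_smul, map_neg]
  ring

/-- Multiplication by `i` as a real isometry. -/
noncomputable def mulIIsometry (m : ℕ) : CSpace m ≃ₗᵢ[ℝ] CSpace m where
  toLinearEquiv := (LinearEquiv.smulOfNeZero ℂ (CSpace m) Complex.I Complex.I_ne_zero).restrictScalars ℝ
  norm_map' v := by simp [norm_smul]

theorem laplacian_eq_sum_fderiv {ι : Type*} [Fintype ι] (b : OrthonormalBasis ι ℝ (CSpace m))
    (g : CSpace m → ℝ) (z : CSpace m) :
    Laplacian.laplacian g z = ∑ i, fderiv ℝ (fderiv ℝ g) z (b i) (b i) := by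
  rw [InnerProductSpace.laplacian_eq_iteratedFDeriv_orthonormalBasis g b]
  simp [iteratedFDeriv_two_apply]

/-- The trace of the Hessian is the same in the bases `b` and `i b`; adding the two expressions
pairs the Hessian terms into Levi forms. -/
theorem laplacian_eq_sum_leviForm {ι : Type*} [Fintype ι] (b : OrthonormalBasis ι ℝ (CSpace m))
    (g : CSpace m → ℝ) (z : CSpace m) :
    Laplacian.laplacian g z = (∑ i, leviForm g z (b i)) / 2 := by
  have h1 := laplacian_eq_sum_fderiv b g z
  have h2 := laplacian_eq_sum_fderiv (b.map (mulIIsometry m)) g z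
  simp only [leviForm, Finset.sum_add_distrib]
  rw [← h1]
  have h3 : ∀ i, (b.map (mulIIsometry m)) i = Complex.I • b i := fun i => by
    simp [mulIIsometry]
  simp only [h3] at h2
  rw [← h2]
  ring

theorem laplacian_comp_eq_sum_leviForm {ι : Type*} [Fintype ι]
    (b : OrthonormalBasis ι ℝ (CSpace m)) {P : CSpace n → ℝ} {f : CSpace m → CSpace n}
    {s : Set (CSpace m)} (hs : IsOpen s) (hf : DifferentiableOn ℂ f s) {z : CSpace m} (hz : z ∈ s)
    (hP : ContDiffAt ℝ 2 P (f z)) :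
    Laplacian.laplacian (P ∘ f) z = (∑ i, leviForm P (f z) (fderiv ℂ f z (b i))) / 2 := by
  rw [laplacian_eq_sum_leviForm b]
  simp only [leviForm_comp hs hf hz hP]

theorem leviForm_smul (Q : CSpace n → ℝ) (z v : CSpace n) (t : ℝ) :
    leviForm Q z (t • v) = t ^ 2 * leviForm Q z v := by
  simp only [leviForm, smul_comm Complex.I t v, map_smul, smul_apply,
    smul_eq_mul]
  ring

theorem continuousOn_leviForm {P : CSpace n → ℝ} {O : Set (CSpace n)} (hO : IsOpen O)
    (hP : ContDiffOn ℝ ∞ P O) :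
    ContinuousOn (fun p : CSpace n × CSpace n => leviForm P p.1 p.2) (O ×ˢ univ) := by
  have h2 : ContinuousOn (fderiv ℝ (fderiv ℝ P)) O := by
    have h1 : ContDiffOn ℝ 1 (fderiv ℝ P) O :=
      hP.fderiv_of_isOpen hO (WithTop.coe_le_coe.2 le_top)
    exact h1.continuousOn_fderiv_of_isOpen hO (by norm_num)
  have h3 : ContinuousOn (fun p : CSpace n × CSpace n => fderiv ℝ (fderiv ℝ P) p.1)
      (O ×ˢ univ) := h2.comp continuousOn_fst fun p hp => hp.1
  have h4 : ContinuousOn (fun p : CSpace n × CSpace n => Complex.I • p.2) (O ×ˢ univ) :=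
    (continuous_snd.const_smul Complex.I).continuousOn
  have h5 : ContinuousOn (fun p : CSpace n × CSpace n => fderiv ℝ (fderiv ℝ P) p.1 p.2)
      (O ×ˢ univ) := h3.clm_apply continuousOn_snd
  have h6 : ContinuousOn (fun p : CSpace n × CSpace n =>
      fderiv ℝ (fderiv ℝ P) p.1 (Complex.I • p.2)) (O ×ˢ univ) := h3.clm_apply h4
  exact (h5.clm_apply continuousOn_snd).add (h6.clm_apply h4)

/-- On a compact set, a positive Levi form is bounded below by a multiple of the squared norm. -/
theorem exists_le_leviForm {P : CSpace n → ℝ} {O K : Set (CSpace n)} (hO : IsOpen O)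
    (hP : ContDiffOn ℝ ∞ P O) (hK : IsCompact K) (hKO : K ⊆ O)
    (hpos : ∀ b ∈ K, ∀ v, v ≠ 0 → 0 < leviForm P b v) :
    ∃ c > 0, ∀ b ∈ K, ∀ v, c * ‖v‖ ^ 2 ≤ leviForm P b v := by
  have hS : IsCompact (K ×ˢ Metric.sphere (0 : CSpace n) 1) := hK.prod (isCompact_sphere _ _)
  have hc' := (continuousOn_leviForm hO hP).mono
    (prod_mono hKO (subset_univ (Metric.sphere (0 : CSpace n) 1)))
  obtain ⟨c, hc, hcle⟩ : ∃ c > 0, ∀ p ∈ K ×ˢ Metric.sphere (0 : CSpace n) 1,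
      c ≤ leviForm P p.1 p.2 := by
    rcases (K ×ˢ Metric.sphere (0 : CSpace n) 1).eq_empty_or_nonempty with he | hne
    · exact ⟨1, one_pos, by simp [he]⟩
    · obtain ⟨p, hp, hmin⟩ := hS.exists_isMinOn hne hc'
      refine ⟨leviForm P p.1 p.2, hpos _ hp.1 _ ?_, fun q hq => hmin hq⟩
      exact ne_zero_of_mem_unit_sphere ⟨p.2, hp.2⟩
  refine ⟨c, hc, fun b hb v => ?_⟩
  rcases eq_or_ne v 0 with rfl | hv
  · simp [leviForm]
  have hv' : 0 < ‖v‖ := norm_pos_iff.2 hv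
  have h1 := hcle (b, ‖v‖⁻¹ • v) ⟨hb, by simp [norm_smul, hv'.ne']⟩
  simp only [leviForm_smul] at h1
  rw [inv_pow, ← div_eq_inv_mul, le_div_iff₀ (by positivity)] at h1
  exact h1

theorem exists_abs_leviForm_le {P : CSpace n → ℝ} {O K : Set (CSpace n)} (hO : IsOpen O)
    (hP : ContDiffOn ℝ ∞ P O) (hK : IsCompact K) (hKO : K ⊆ O) :
    ∃ c > 0, ∀ b ∈ K, ∀ v, |leviForm P b v| ≤ c * ‖v‖ ^ 2 := by
  have hS : IsCompact (K ×ˢ Metric.sphere (0 : CSpace n) 1) := hK.prod (isCompact_sphere _ _)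
  have hc' := ((continuousOn_leviForm hO hP).mono
    (prod_mono hKO (subset_univ (Metric.sphere (0 : CSpace n) 1)))).abs
  obtain ⟨C, hC⟩ := hS.bddAbove_image hc'
  refine ⟨max C 1, by positivity, fun b hb v => ?_⟩
  rcases eq_or_ne v 0 with rfl | hv
  · simp [leviForm]
  have hv' : 0 < ‖v‖ := norm_pos_iff.2 hv
  have h1 := hC (mem_image_of_mem _ (show (b, ‖v‖⁻¹ • v) ∈ K ×ˢ Metric.sphere (0 : CSpace n) 1 from
    ⟨hb, by simp [norm_smul, hv'.ne']⟩))
  simp only [leviForm_smul] at h1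
  rw [abs_mul, abs_of_pos (by positivity), inv_pow, ← div_eq_inv_mul,
    div_le_iff₀ (by positivity)] at h1
  exact h1.trans (by gcongr; exact le_max_left _ _)

end Levi

/-! ### Second moments of balls, and Laplacians of functions with the sub-mean value property -/

section MeanValue

variable {m : ℕ}

theorem setIntegral_closedBall_comp_isometry (L : CSpace m ≃ₗᵢ[ℝ] CSpace m) (r : ℝ)
    (q : CSpace m → ℝ) :
    ∫ h in Metric.closedBall 0 r, q (L h) = ∫ h in Metric.closedBall 0 r, q h := by
  have h1 := L.measurePreserving.setIntegral_preimage_emb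
    L.toHomeomorph.measurableEmbedding q (Metric.closedBall 0 r)
  rw [L.preimage_closedBall, map_zero] at h1
  exact h1

theorem integrableOn_closedBall_of_continuous {q : CSpace m → ℝ} (hq : Continuous q) (a : CSpace m)
    (r : ℝ) : IntegrableOn q (Metric.closedBall a r) :=
  hq.continuousOn.integrableOn_compact (isCompact_closedBall a r)

/-- Off-diagonal second moments of a centred ball vanish. -/
theorem setIntegral_inner_mul_inner {ι : Type*} [Fintype ι] [DecidableEq ι]
    (b : OrthonormalBasis ι ℝ (CSpace m)) (r : ℝ) {i j : ι} (hij : i ≠ j) :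
    ∫ h in Metric.closedBall (0 : CSpace m) r, inner ℝ (b i) h * inner ℝ (b j) h = 0 := by
  -- The reflection in the hyperplane orthogonal to `b i` preserves the ball and changes the sign of
  -- the integrand.
  have h1 := setIntegral_closedBall_comp_isometry (Submodule.reflection (Submodule.span ℝ {b i})ᗮ) r
    (fun h => inner ℝ (b i) h * inner ℝ (b j) h)
  have h2 : ∀ h, inner ℝ (b i) ((Submodule.span ℝ {b i})ᗮ.reflection h) *
      inner ℝ (b j) ((Submodule.span ℝ {b i})ᗮ.reflection h) =
      -(inner ℝ (b i) h * inner ℝ (b j) h) := by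
    intro h
    have hs : ∀ x y : CSpace m, inner ℝ x ((Submodule.span ℝ {b i})ᗮ.reflection y) =
        inner ℝ ((Submodule.span ℝ {b i})ᗮ.reflection x) y := by
      intro x y
      rw [← LinearIsometryEquiv.inner_map_map (Submodule.span ℝ {b i})ᗮ.reflection x,
        Submodule.reflection_reflection]
    rw [hs, hs, Submodule.reflection_orthogonalComplement_singleton_eq_neg,
      Submodule.reflection_mem_subspace_eq_self (x := b j), inner_neg_left]
    · ring
    · rw [Submodule.mem_orthogonal_singleton_iff_inner_right]
      exact b.orthonormal.2 hij
  simp only [h2, integral_neg] at h1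
  linarith

theorem setIntegral_inner_sq_eq {ι : Type*} [Fintype ι] [DecidableEq ι]
    (b : OrthonormalBasis ι ℝ (CSpace m)) (r : ℝ) (i j : ι) :
    ∫ h in Metric.closedBall (0 : CSpace m) r, inner ℝ (b i) h ^ 2 =
      ∫ h in Metric.closedBall (0 : CSpace m) r, inner ℝ (b j) h ^ 2 := by
  set L := b.equiv b (Equiv.swap i j)
  have h1 := setIntegral_closedBall_comp_isometry L r (fun h => inner ℝ (b j) h ^ 2)
  rw [← h1]
  congr 1
  ext h
  have h2 : b j = L (b i) := by simp [L]
  rw [h2, LinearIsometryEquiv.inner_map_map]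

/-- The mean of a quadratic form over a centred ball is proportional to its trace. -/
theorem exists_setIntegral_quadratic {ι : Type*} [Fintype ι] [Nonempty ι]
    (b : OrthonormalBasis ι ℝ (CSpace m)) {r : ℝ} (hr : 0 < r) :
    ∃ κ > 0, ∀ B : CSpace m →L[ℝ] CSpace m →L[ℝ] ℝ,
      ∫ h in Metric.closedBall (0 : CSpace m) r, B h h = κ * ∑ i, B (b i) (b i) := by
  classical
  obtain ⟨i₀⟩ := ‹Nonempty ι›
  refine ⟨∫ h in Metric.closedBall (0 : CSpace m) r, inner ℝ (b i₀) h ^ 2, ?_, fun B => ?_⟩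
  · rw [gt_iff_lt, setIntegral_pos_iff_support_of_nonneg_ae
      (f := fun h : CSpace m => inner ℝ (b i₀) h ^ 2) (Eventually.of_forall fun h => sq_nonneg _)
      (integrableOn_closedBall_of_continuous (by fun_prop) _ _)]
    have ho : IsOpen ({h : CSpace m | inner ℝ (b i₀) h ≠ (0 : ℝ)} ∩ Metric.ball 0 r) :=
      (isOpen_ne_fun (by fun_prop) continuous_const).inter Metric.isOpen_ball
    refine (ho.measure_pos volume ⟨(r / 2) • b i₀, ?_, ?_⟩).trans_le (measure_mono ?_)
    · simp [inner_smul_right, hr.ne']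
    · simp [norm_smul, abs_of_pos hr, hr]
    · exact fun h hh => ⟨by simpa using hh.1, Metric.ball_subset_closedBall hh.2⟩
  · have h1 : ∀ h, B h h =
        ∑ i, ∑ j, (inner ℝ (b i) h * inner ℝ (b j) h) * B (b i) (b j) := by
      intro h
      conv_lhs => rw [← b.sum_repr' h]
      simp only [map_sum, map_smul, sum_apply, smul_apply, smul_eq_mul, Finset.mul_sum]
      rw [Finset.sum_comm]
      refine Finset.sum_congr rfl fun i _ => Finset.sum_congr rfl fun j _ => by ring
    rw [show (fun h => B h h) = _ from funext h1]
    have hint : ∀ i j, IntegrableOn (fun h : CSpace m =>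
        (inner ℝ (b i) h * inner ℝ (b j) h) * B (b i) (b j)) (Metric.closedBall 0 r) :=
      fun i j => integrableOn_closedBall_of_continuous (by fun_prop) _ _
    rw [integral_finsetSum _ fun i _ => integrable_finsetSum _ fun j _ => hint i j, Finset.mul_sum]
    refine Finset.sum_congr rfl fun i _ => ?_
    rw [integral_finsetSum _ fun j _ => hint i j, Finset.sum_eq_single i]
    · rw [integral_mul_const]
      congr 1
      simp only [← sq]
      exact setIntegral_inner_sq_eq b r i i₀
    · intro j _ hj
      rw [integral_mul_const, setIntegral_inner_mul_inner b r hj.symm, zero_mul]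
    · simp

/-- Second-order Taylor expansion. -/
theorem exists_taylor_two_bound {g : CSpace m → ℝ} {a : CSpace m} (hg : ContDiffAt ℝ 2 g a)
    {ε : ℝ} (hε : 0 < ε) : ∃ r₀ > 0, ∀ h : CSpace m, ‖h‖ ≤ r₀ →
      |g (a + h) - g a - fderiv ℝ g a h - 2⁻¹ * fderiv ℝ (fderiv ℝ g) a h h| ≤ ε * ‖h‖ ^ 2 := by
  have hsymm : IsSymmSndFDerivAt ℝ g a := hg.isSymmSndFDerivAt (by simp)
  have h1 : HasFDerivAt (fderiv ℝ g) (fderiv ℝ (fderiv ℝ g) a) a :=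
    ((hg.fderiv_right (m := 1) (by norm_num)).differentiableAt (by norm_num)).hasFDerivAt
  have h2 := (h1.isLittleO.def hε)
  have h3 : ∀ᶠ x in 𝓝 a, DifferentiableAt ℝ g x :=
    (hg.eventually (by simp)).mono fun x hx => hx.differentiableAt (by norm_num)
  obtain ⟨r₁, hr₁, hball⟩ := Metric.eventually_nhds_iff_ball.1 (h2.and h3)
  refine ⟨r₁ / 2, by positivity, fun h hh => ?_⟩
  set B := fderiv ℝ (fderiv ℝ g) a
  -- By symmetry of `B`, the quadratic term has derivative `B y`. The derivative of the remainder is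
  -- then the first-order error of `fderiv ℝ g`, at most `ε * ‖h‖`, and the mean value inequality
  -- concludes.
  have hder : ∀ y ∈ Metric.closedBall (0 : CSpace m) ‖h‖,
      HasFDerivWithinAt (fun y => g (a + y) - g a - fderiv ℝ g a y - 2⁻¹ * B y y)
        (fderiv ℝ g (a + y) - fderiv ℝ g a - B y) (Metric.closedBall (0 : CSpace m) ‖h‖) y := by
    intro y hy
    have hy' : a + y ∈ Metric.ball a r₁ := by
      rw [mem_closedBall_zero_iff] at hy
      rw [mem_ball_iff_norm]; simp; linarith
    have e1 : HasFDerivAt (fun y => g (a + y)) (fderiv ℝ g (a + y)) y := by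
      have := (hball _ hy').2.hasFDerivAt.comp y ((hasFDerivAt_id y).const_add a)
      rwa [ContinuousLinearMap.comp_id] at this
    have e2 : HasFDerivAt (fun y => B y y) (B y + B.flip y) y := by
      have := B.hasFDerivAt.clm_apply (hasFDerivAt_id y) (x := y)
      simpa using this
    have e3 : B.flip y = B y := by
      ext w; exact (hsymm.eq y w).symm
    rw [e3] at e2
    have e4 := ((e1.sub_const (g a)).sub (fderiv ℝ g a).hasFDerivAt).sub (e2.const_mul 2⁻¹)
    refine (e4.congr_fderiv ?_).hasFDerivWithinAt
    ext w; simp; ring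
  have hb : ∀ y ∈ Metric.closedBall (0 : CSpace m) ‖h‖,
      ‖fderiv ℝ g (a + y) - fderiv ℝ g a - B y‖ ≤ ε * ‖h‖ := by
    intro y hy
    rw [mem_closedBall_zero_iff] at hy
    have hy' : a + y ∈ Metric.ball a r₁ := by
      rw [mem_ball_iff_norm]; simp; linarith
    have := (hball _ hy').1
    simp only [add_sub_cancel_left] at this
    exact this.trans (by gcongr)
  have := (convex_closedBall (0 : CSpace m) ‖h‖).norm_image_sub_le_of_norm_hasFDerivWithin_le
    hder hb (x := 0) (y := h) (by simp) (by simp)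
  simp only [add_zero, sub_self, map_zero, mul_zero, sub_zero, Real.norm_eq_abs] at this
  exact this.trans (by rw [sq, mul_assoc])

theorem setAverage_closedBall_eq_centered (g : CSpace m → ℝ) (a : CSpace m) (r : ℝ) :
    ⨍ z in Metric.closedBall a r, g z = ⨍ h in Metric.closedBall 0 r, g (a + h) := by
  have h1 := (measurePreserving_add_left volume a).setIntegral_preimage_emb
    (Homeomorph.addLeft a).measurableEmbedding g (Metric.closedBall a r)
  have h2 : (fun x => a + x) ⁻¹' Metric.closedBall a r = Metric.closedBall 0 r := by
    ext; simp
  rw [h2] at h1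
  rw [setAverage_eq, setAverage_eq, ← h1, measureReal_def, measureReal_def,
    Measure.addHaar_closedBall_center volume a]

/-- A `C^2` function with the sub-mean value property on small balls has nonnegative Laplacian. -/
theorem laplacian_nonneg_of_submean {g : CSpace m → ℝ} {a : CSpace m} (hg : ContDiffAt ℝ 2 g a)
    (hsub : ∀ᶠ r in 𝓝[>] (0 : ℝ), g a ≤ ⨍ z in Metric.closedBall a r, g z) :
    0 ≤ Laplacian.laplacian g a := by
  set b := stdOrthonormalBasis ℝ (CSpace m)
  rcases isEmpty_or_nonempty (Fin (Module.finrank ℝ (CSpace m))) with he | hne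
  · rw [laplacian_eq_sum_fderiv b]; simp
  obtain ⟨d, hd'⟩ : ∃ d : ℝ, d = (Module.finrank ℝ (CSpace m) : ℝ) := ⟨_, rfl⟩
  rw [laplacian_eq_sum_fderiv b]
  set B := fderiv ℝ (fderiv ℝ g) a
  refine le_of_forall_pos_le_add fun η hη => ?_
  have hd : 0 ≤ d := hd' ▸ Nat.cast_nonneg _
  -- Over the ball, the linear term integrates to zero, the Hessian term to `κ / 2` times the trace,
  -- and `‖h‖ ^ 2` to `κ * d`; this choice makes the Taylor error at most `κ * η / 2`.
  obtain ⟨r₀, hr₀, htay⟩ := exists_taylor_two_bound hg (ε := η / (2 * (d + 1))) (by positivity)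
  obtain ⟨r₂, hr₂, hcont⟩ : ∃ r₂ > 0, ContinuousOn g (Metric.closedBall a r₂) := by
    have h3 : ∀ᶠ x in 𝓝 a, ContinuousAt g x :=
      (hg.eventually (by simp)).mono fun x hx => hx.continuousAt
    obtain ⟨r, hr, h⟩ := Metric.eventually_nhds_iff_ball.1 h3
    exact ⟨r / 2, by positivity, fun x hx =>
      (h x (Metric.closedBall_subset_ball (by linarith) hx)).continuousWithinAt⟩
  obtain ⟨r, hrsub, hr, hr'⟩ := (hsub.and (Ioo_mem_nhdsGT (lt_min hr₀ hr₂))).exists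
  have hrr₀ : r ≤ r₀ := hr'.le.trans (min_le_left _ _)
  have hrr₂ : r ≤ r₂ := hr'.le.trans (min_le_right _ _)
  obtain ⟨κ, hκ, hquad⟩ := exists_setIntegral_quadratic b hr
  rw [setAverage_closedBall_eq_centered] at hrsub
  have hfin : volume (Metric.closedBall (0 : CSpace m) r) ≠ ⊤ := measure_closedBall_lt_top.ne
  have hvpos : 0 < volume.real (Metric.closedBall (0 : CSpace m) r) :=
    ENNReal.toReal_pos (Metric.measure_closedBall_pos _ _ hr).ne' hfin
  have hI : IntegrableOn (fun h => g (a + h)) (Metric.closedBall 0 r) := by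
    refine ContinuousOn.integrableOn_compact (isCompact_closedBall _ _) ?_
    refine hcont.comp (by fun_prop) fun h hh => ?_
    simp only [mem_closedBall_zero_iff] at hh
    simp [hh.trans hrr₂]
  have hIc : IntegrableOn (fun _ : CSpace m => g a) (Metric.closedBall 0 r) :=
    integrableOn_closedBall_of_continuous continuous_const _ _
  have hIl : IntegrableOn (fun h : CSpace m => fderiv ℝ g a h) (Metric.closedBall 0 r) :=
    integrableOn_closedBall_of_continuous (by fun_prop) _ _
  have hIB : IntegrableOn (fun h : CSpace m => 2⁻¹ * B h h) (Metric.closedBall 0 r) :=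
    integrableOn_closedBall_of_continuous (by fun_prop) _ _
  have hIn : IntegrableOn (fun h : CSpace m => η / (2 * (d + 1)) * ‖h‖ ^ 2)
      (Metric.closedBall 0 r) :=
    integrableOn_closedBall_of_continuous (by fun_prop) _ _
  have hlin : ∫ h in Metric.closedBall (0 : CSpace m) r, fderiv ℝ g a h = 0 := by
    have := setIntegral_closedBall_comp_isometry (LinearIsometryEquiv.neg ℝ) r
      (fun h => fderiv ℝ g a h)
    simp [integral_neg] at this
    linarith
  have hnorm : ∫ h in Metric.closedBall (0 : CSpace m) r, ‖h‖ ^ 2 = κ * d := by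
    have := hquad (innerSL ℝ)
    have hi : ∀ h : CSpace m, innerSL ℝ h h = ‖h‖ ^ 2 := fun h => real_inner_self_eq_norm_sq h
    rw [funext hi] at this
    simpa [hi, hd'] using this
  have h0 : 0 ≤ ∫ h in Metric.closedBall (0 : CSpace m) r, (g (a + h) - g a) := by
    rw [integral_sub hI hIc, sub_nonneg, setIntegral_const, smul_eq_mul]
    rw [setAverage_eq, smul_eq_mul, ← div_eq_inv_mul, le_div_iff₀ hvpos] at hrsub
    linarith
  have hIlB : IntegrableOn (fun h : CSpace m => fderiv ℝ g a h + 2⁻¹ * B h h)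
      (Metric.closedBall 0 r) := hIl.add hIB
  have h1 : ∫ h in Metric.closedBall (0 : CSpace m) r, (g (a + h) - g a) ≤
      ∫ h in Metric.closedBall (0 : CSpace m) r,
        (fderiv ℝ g a h + 2⁻¹ * B h h + η / (2 * (d + 1)) * ‖h‖ ^ 2) := by
    refine setIntegral_mono_on (hI.sub hIc) (hIlB.add hIn) measurableSet_closedBall ?_
    intro h hh
    rw [mem_closedBall_zero_iff] at hh
    have := (abs_le.1 (htay h (hh.trans hrr₀))).2
    linarith
  rw [integral_add hIlB hIn, integral_add hIl hIB, hlin, integral_const_mul, hquad,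
    integral_const_mul, hnorm] at h1
  have h2 : 0 ≤ κ * ((∑ i, B (b i) (b i)) + η) := by
    have h3 : η / (2 * (d + 1)) * (κ * d) ≤ κ * η / 2 := by
      rw [div_mul_eq_mul_div, div_le_div_iff₀ (by positivity) (by norm_num)]
      nlinarith [mul_pos hκ hη]
    linarith
  exact nonneg_of_mul_nonneg_right h2 hκ

theorem laplacian_nonneg_of_isLocalMin {g : CSpace m → ℝ} {a : CSpace m} (hg : ContDiffAt ℝ 2 g a)
    (hmin : IsLocalMin g a) : 0 ≤ Laplacian.laplacian g a := by
  refine laplacian_nonneg_of_submean hg ?_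
  have h3 : ∀ᶠ x in 𝓝 a, ContinuousAt g x ∧ g a ≤ g x :=
    ((hg.eventually (by simp)).mono fun x hx => hx.continuousAt).and hmin
  obtain ⟨r₀, hr₀, h⟩ := Metric.eventually_nhds_iff_ball.1 h3
  filter_upwards [Ioo_mem_nhdsGT hr₀] with r hr
  have hfin : volume (Metric.closedBall a r) ≠ ⊤ := measure_closedBall_lt_top.ne
  have hvpos : 0 < volume.real (Metric.closedBall a r) :=
    ENNReal.toReal_pos (Metric.measure_closedBall_pos _ _ hr.1).ne' hfin
  have hsubset : Metric.closedBall a r ⊆ Metric.ball a r₀ := Metric.closedBall_subset_ball hr.2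
  rw [setAverage_eq, smul_eq_mul, ← div_eq_inv_mul, le_div_iff₀ hvpos]
  have hI : IntegrableOn g (Metric.closedBall a r) :=
    ContinuousOn.integrableOn_compact (isCompact_closedBall _ _)
      fun x hx => (h x (hsubset hx)).1.continuousWithinAt
  have := setIntegral_mono_on (integrableOn_closedBall_of_continuous
    (continuous_const (y := g a)) a r) hI measurableSet_closedBall fun x hx => (h x (hsubset hx)).2
  rw [setIntegral_const, smul_eq_mul] at this
  linarith

/-- Comparison of Laplacians of two `C^2` functions that touch at a point. -/
theorem laplacian_le_of_touching {g g' : CSpace m → ℝ} {a : CSpace m} (hg : ContDiffAt ℝ 2 g a)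
    (hg' : ContDiffAt ℝ 2 g' a) (hle : ∀ᶠ z in 𝓝 a, g' z ≤ g z) (heq : g' a = g a) :
    Laplacian.laplacian g' a ≤ Laplacian.laplacian g a := by
  have h1 := laplacian_nonneg_of_isLocalMin (hg.sub hg') (a := a) ?_
  · change 0 ≤ Laplacian.laplacian (g - g') a at h1
    rw [hg.laplacian_sub hg'] at h1
    linarith
  · filter_upwards [hle] with z hz
    linarith

end MeanValue

/-! ### Local potentials in charts and along holomorphic maps -/

section ComplexManifold

variable {m n : ℕ} {X : Type*} [TopologicalSpace X] [ChartedSpace (CSpace n) X]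

/-- Coordinate changes of a complex manifold are holomorphic. -/
theorem differentiableOn_chart_change [IsManifold 𝓘(ℂ, CSpace n) ω X] (c x : X) :
    DifferentiableOn ℂ (chartAt (CSpace n) x ∘ (chartAt (CSpace n) c).symm)
      ((chartAt (CSpace n) c).symm ≫ₕ chartAt (CSpace n) x).source := by
  have h := ModelWithCorners.contDiffOn_extendCoordChange (I := 𝓘(ℂ, CSpace n)) (n := ω)
    (IsManifold.chart_mem_maximalAtlas c) (IsManifold.chart_mem_maximalAtlas x)
  simpa [OpenPartialHomeomorph.extend, mfld_simps] using h.differentiableOn (by simp)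

/-- The real manifold underlying a complex manifold. -/
theorem isManifold_real_of_complex [IsManifold 𝓘(ℂ, CSpace n) ω X] :
    IsManifold 𝓘(ℝ, CSpace n) ∞ X := by
  refine isManifold_of_contDiffOn _ _ _ fun e e' he he' => ?_
  have h := ModelWithCorners.contDiffOn_extendCoordChange (I := 𝓘(ℂ, CSpace n)) (n := ω)
    (StructureGroupoid.subset_maximalAtlas _ he) (StructureGroupoid.subset_maximalAtlas _ he')
  have h2 := (h.restrict_scalars ℝ).of_le (m := ∞) le_top
  simpa [OpenPartialHomeomorph.extend, mfld_simps] using h2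

theorem isOpen_preimage_source_of_mdifferentiableOn {W : Set (CSpace m)} {f : CSpace m → X}
    (hW : IsOpen W) (hf : MDifferentiableOn 𝓘(ℂ, CSpace m) 𝓘(ℂ, CSpace n) f W) {S : Set X}
    (hS : IsOpen S) : IsOpen (W ∩ f ⁻¹' S) :=
  hf.continuousOn.isOpen_inter_preimage hW hS

theorem differentiableOn_chart_comp [IsManifold 𝓘(ℂ, CSpace n) ω X] {W : Set (CSpace m)}
    {f : CSpace m → X} (hf : MDifferentiableOn 𝓘(ℂ, CSpace m) 𝓘(ℂ, CSpace n) f W) (c : X) :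
    DifferentiableOn ℂ (chartAt (CSpace n) c ∘ f) (W ∩ f ⁻¹' (chartAt (CSpace n) c).source) := by
  have h1 : MDifferentiableOn 𝓘(ℂ, CSpace n) 𝓘(ℂ, CSpace n) (chartAt (CSpace n) c)
      (chartAt (CSpace n) c).source :=
    mdifferentiableOn_atlas (chart_mem_atlas _ c)
  exact mdifferentiableOn_iff_differentiableOn.1
    (h1.comp (hf.mono inter_subset_left) inter_subset_right)

theorem mdifferentiableOn_chart_symm_comp [IsManifold 𝓘(ℂ, CSpace n) ω X] {W : Set (CSpace m)}
    {g : CSpace m → CSpace n} (hg : DifferentiableOn ℂ g W) (c : X)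
    (hmap : MapsTo g W (chartAt (CSpace n) c).target) :
    MDifferentiableOn 𝓘(ℂ, CSpace m) 𝓘(ℂ, CSpace n) ((chartAt (CSpace n) c).symm ∘ g) W :=
  (mdifferentiableOn_atlas_symm (chart_mem_atlas _ c)).comp
    (mdifferentiableOn_iff_differentiableOn.2 hg) hmap

theorem contDiffOn_comp_chart_symm [IsManifold 𝓘(ℂ, CSpace n) ω X] {U : Set X} {ψ : X → ℝ}
    (hψ : ContMDiffOn 𝓘(ℝ, CSpace n) 𝓘(ℝ, ℝ) ∞ ψ U) (c : X) :
    ContDiffOn ℝ ∞ (ψ ∘ (chartAt (CSpace n) c).symm)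
      ((chartAt (CSpace n) c).target ∩ (chartAt (CSpace n) c).symm ⁻¹' U) := by
  have := isManifold_real_of_complex (n := n) (X := X)
  have h1 : ContMDiffOn 𝓘(ℝ, CSpace n) 𝓘(ℝ, CSpace n) ∞ (chartAt (CSpace n) c).symm
      (chartAt (CSpace n) c).target := contMDiffOn_chart_symm
  exact contMDiffOn_iff_contDiffOn.1 (hψ.comp (h1.mono inter_subset_left) inter_subset_right)

theorem isOpen_target_inter_preimage_symm {U : Set X} (hU : IsOpen U) (c : X) :
    IsOpen ((chartAt (CSpace n) c).target ∩ (chartAt (CSpace n) c).symm ⁻¹' U) :=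
  (chartAt (CSpace n) c).symm.isOpen_inter_preimage hU

section Potential

variable [IsManifold 𝓘(ℂ, CSpace n) ω X]
  {η : ∀ x : X, TangentSpace 𝓘(ℝ, CSpace n) x →L[ℝ] TangentSpace 𝓘(ℝ, CSpace n) x →L[ℝ] ℝ}

/-- The quadratic form `v ↦ η(v, iv)`. -/
noncomputable def formJ
    (η : ∀ x : X, TangentSpace 𝓘(ℝ, CSpace n) x →L[ℝ] TangentSpace 𝓘(ℝ, CSpace n) x →L[ℝ] ℝ)
    (x : X) (v : CSpace n) : ℝ :=
  η x (show TangentSpace 𝓘(ℝ, CSpace n) x from v)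
    (tangentJ (show TangentSpace 𝓘(ℝ, CSpace n) x from v))

theorem IsKahlerForm.formJ_pos (hη : IsKahlerForm η) (x : X) {v : CSpace n} (hv : v ≠ 0) :
    0 < formJ η x v := hη.pos x v hv

theorem IsKahlerForm.formJ_nonneg (hη : IsKahlerForm η) (x : X) (v : CSpace n) :
    0 ≤ formJ η x v := by
  rcases eq_or_ne v 0 with rfl | hv
  · have : formJ η x (0 : CSpace n) = 0 := by
      have h : η x (0 : TangentSpace 𝓘(ℝ, CSpace n) x) = 0 := map_zero _
      exact congrArg (fun L => L (tangentJ (0 : TangentSpace 𝓘(ℝ, CSpace n) x))) h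
    exact this.ge
  · exact (hη.formJ_pos x hv).le

/-- Since `i (i v) = -v`, the difference in `iDDbar` becomes the sum in `leviForm`; the factor `2`
undoes the halving in `iDDbar`. -/
theorem IsLocalPotential.leviForm_eq {U : Set X} {ψ : X → ℝ} (hψ : IsLocalPotential η U ψ) {x : X}
    (hx : x ∈ U) (v : CSpace n) :
    leviForm (ψ ∘ (chartAt (CSpace n) x).symm) (chartAt (CSpace n) x x) v = 2 * formJ η x v := by
  set H := fderiv ℝ (fderiv ℝ (ψ ∘ (chartAt (CSpace n) x).symm)) (chartAt (CSpace n) x x)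
  have h : formJ η x v = (H (Complex.I • v) (Complex.I • v) -
      H v (Complex.I • (Complex.I • v) : CSpace n)) / 2 :=
    hψ.eq_iDDbar x hx v (tangentJ (show TangentSpace 𝓘(ℝ, CSpace n) x from v))
  rw [h, smul_smul, Complex.I_mul_I, neg_one_smul, map_neg, leviForm]
  ring

theorem IsLocalPotential.contDiffAt {U : Set X} {ψ : X → ℝ} (hψ : IsLocalPotential η U ψ) (c : X)
    {b : CSpace n} (hb : b ∈ (chartAt (CSpace n) c).target)
    (hbU : (chartAt (CSpace n) c).symm b ∈ U) :
    ContDiffAt ℝ 2 (ψ ∘ (chartAt (CSpace n) c).symm) b :=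
  ((contDiffOn_comp_chart_symm hψ.smooth c).contDiffAt
    ((isOpen_target_inter_preimage_symm hψ.isOpen c).mem_nhds ⟨hb, hbU⟩)).of_le
      (WithTop.coe_le_coe.2 le_top)

/-- The Levi form of a local potential read in an arbitrary chart. -/
theorem IsLocalPotential.leviForm_chart_eq {U : Set X} {ψ : X → ℝ} (hψ : IsLocalPotential η U ψ)
    (c : X) {b : CSpace n} (hb : b ∈ (chartAt (CSpace n) c).target)
    (hbU : (chartAt (CSpace n) c).symm b ∈ U) (v : CSpace n) :
    leviForm (ψ ∘ (chartAt (CSpace n) c).symm) b v =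
      2 * formJ η ((chartAt (CSpace n) c).symm b)
        (fderiv ℂ (chartAt (CSpace n) ((chartAt (CSpace n) c).symm b) ∘
          (chartAt (CSpace n) c).symm) b v) := by
  set x := (chartAt (CSpace n) c).symm b with hx
  have hxs : x ∈ (chartAt (CSpace n) x).source := mem_chart_source _ x
  have hsrc : b ∈ ((chartAt (CSpace n) c).symm ≫ₕ chartAt (CSpace n) x).source := by
    simp only [OpenPartialHomeomorph.trans_source, OpenPartialHomeomorph.symm_source]
    exact ⟨hb, hxs⟩
  have hopen := ((chartAt (CSpace n) c).symm ≫ₕ chartAt (CSpace n) x).open_source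
  have hcd : ContDiffAt ℝ 2 (ψ ∘ (chartAt (CSpace n) x).symm)
      ((chartAt (CSpace n) x ∘ (chartAt (CSpace n) c).symm) b) := by
    refine hψ.contDiffAt x ((chartAt (CSpace n) x).map_source hxs) ?_
    change (chartAt (CSpace n) x).symm (chartAt (CSpace n) x x) ∈ U
    rwa [(chartAt (CSpace n) x).left_inv hxs]
  -- `η` is related to `ψ` only in the preferred chart at each point, so the potential read in the
  -- chart at `c` is factored through that chart.
  have h1 := leviForm_comp hopen (differentiableOn_chart_change c x) hsrc hcd v
  rw [← hψ.leviForm_eq hbU]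
  refine Eq.trans (leviForm_congr ?_ v) h1
  filter_upwards [hopen.mem_nhds hsrc] with y hy
  simp only [OpenPartialHomeomorph.trans_source, OpenPartialHomeomorph.symm_source] at hy
  simp only [Function.comp]
  rw [(chartAt (CSpace n) x).left_inv hy.2]

/-- The reverse coordinate change is a left inverse near `b`, so by the chain rule the derivative is
injective. -/
theorem fderiv_chart_change_ne_zero (c : X) {b : CSpace n}
    (hb : b ∈ (chartAt (CSpace n) c).target) {v : CSpace n} (hv : v ≠ 0) :
    fderiv ℂ (chartAt (CSpace n) ((chartAt (CSpace n) c).symm b) ∘ (chartAt (CSpace n) c).symm) b v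
      ≠ 0 := by
  set x := (chartAt (CSpace n) c).symm b with hx
  have hxs : x ∈ (chartAt (CSpace n) x).source := mem_chart_source _ x
  have hsrc : b ∈ ((chartAt (CSpace n) c).symm ≫ₕ chartAt (CSpace n) x).source := by
    simp only [OpenPartialHomeomorph.trans_source, OpenPartialHomeomorph.symm_source]
    exact ⟨hb, hxs⟩
  have hopen := ((chartAt (CSpace n) c).symm ≫ₕ chartAt (CSpace n) x).open_source
  have hsrc' : (chartAt (CSpace n) x ∘ (chartAt (CSpace n) c).symm) b ∈
      ((chartAt (CSpace n) x).symm ≫ₕ chartAt (CSpace n) c).source := by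
    simp only [OpenPartialHomeomorph.trans_source, OpenPartialHomeomorph.symm_source]
    refine ⟨(chartAt (CSpace n) x).map_source hxs, ?_⟩
    change (chartAt (CSpace n) x).symm (chartAt (CSpace n) x x) ∈
      (chartAt (CSpace n) c).source
    rw [(chartAt (CSpace n) x).left_inv hxs]
    exact (chartAt (CSpace n) c).map_target hb
  have hopen' := ((chartAt (CSpace n) x).symm ≫ₕ chartAt (CSpace n) c).open_source
  have h1 := ((differentiableOn_chart_change c x).differentiableAt (hopen.mem_nhds hsrc)).hasFDerivAt
  have h2 := ((differentiableOn_chart_change x c).differentiableAt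
    (hopen'.mem_nhds hsrc')).hasFDerivAt
  have h3 := h2.comp b h1
  have h4 : (chartAt (CSpace n) c ∘ (chartAt (CSpace n) x).symm) ∘
      (chartAt (CSpace n) x ∘ (chartAt (CSpace n) c).symm) =ᶠ[𝓝 b] id := by
    filter_upwards [hopen.mem_nhds hsrc] with y hy
    simp only [OpenPartialHomeomorph.trans_source, OpenPartialHomeomorph.symm_source] at hy
    simp only [Function.comp, id]
    rw [(chartAt (CSpace n) x).left_inv hy.2, (chartAt (CSpace n) c).right_inv hy.1]
  have h5 := (h3.congr_of_eventuallyEq h4.symm).unique (hasFDerivAt_id b)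
  intro h0
  have h6 := congrArg (fun L => L v) h5
  simp only [ContinuousLinearMap.comp_apply, h0, map_zero, ContinuousLinearMap.id_apply] at h6
  exact hv h6.symm

theorem IsLocalPotential.leviForm_chart_pos (hη : IsKahlerForm η) {U : Set X} {ψ : X → ℝ}
    (hψ : IsLocalPotential η U ψ)
    (c : X) {b : CSpace n} (hb : b ∈ (chartAt (CSpace n) c).target)
    (hbU : (chartAt (CSpace n) c).symm b ∈ U) {v : CSpace n} (hv : v ≠ 0) :
    0 < leviForm (ψ ∘ (chartAt (CSpace n) c).symm) b v := by
  rw [hψ.leviForm_chart_eq c hb hbU]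
  exact mul_pos two_pos (hη.formJ_pos _ (fderiv_chart_change_ne_zero c hb hv))

variable {W : Set (CSpace m)} {f : CSpace m → X}

/-- The Laplacian of a function on the manifold along a holomorphic map, in a chart. -/
theorem laplacian_comp_eq_of_chart {ι : Type*} [Fintype ι]
    (b : OrthonormalBasis ι ℝ (CSpace m)) (hW : IsOpen W)
    (hf : MDifferentiableOn 𝓘(ℂ, CSpace m) 𝓘(ℂ, CSpace n) f W) {z : CSpace m} (hz : z ∈ W) (c : X)
    (hc : f z ∈ (chartAt (CSpace n) c).source) {ψ : X → ℝ}
    (hψ : ContDiffAt ℝ 2 (ψ ∘ (chartAt (CSpace n) c).symm) (chartAt (CSpace n) c (f z))) :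
    Laplacian.laplacian (fun y => ψ (f y)) z =
      (∑ i, leviForm (ψ ∘ (chartAt (CSpace n) c).symm) (chartAt (CSpace n) c (f z))
        (fderiv ℂ (chartAt (CSpace n) c ∘ f) z (b i))) / 2 ∧
    ContDiffAt ℝ 2 (fun y => ψ (f y)) z := by
  have hop := isOpen_preimage_source_of_mdifferentiableOn hW hf (chartAt (CSpace n) c).open_source
  have hev : (fun y => ψ (f y)) =ᶠ[𝓝 z]
      (ψ ∘ (chartAt (CSpace n) c).symm) ∘ (chartAt (CSpace n) c ∘ f) := by
    filter_upwards [hop.mem_nhds ⟨hz, hc⟩] with y hy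
    simp only [Function.comp]
    rw [(chartAt (CSpace n) c).left_inv hy.2]
  constructor
  · rw [(InnerProductSpace.laplacian_congr_nhds hev).self_of_nhds]
    exact laplacian_comp_eq_sum_leviForm b hop (differentiableOn_chart_comp hf c) ⟨hz, hc⟩ hψ
  · exact (contDiffAt_two_comp_holomorphic hop (differentiableOn_chart_comp hf c) ⟨hz, hc⟩
      hψ).congr_of_eventuallyEq hev

theorem IsLocalPotential.contDiffAt_comp {U : Set X} {ψ : X → ℝ} (hψ : IsLocalPotential η U ψ)
    (hW : IsOpen W) (hf : MDifferentiableOn 𝓘(ℂ, CSpace m) 𝓘(ℂ, CSpace n) f W) {z : CSpace m}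
    (hz : z ∈ W) (hfz : f z ∈ U) : ContDiffAt ℝ 2 (fun y => ψ (f y)) z := by
  have hs := mem_chart_source (CSpace n) (f z)
  refine (laplacian_comp_eq_of_chart (stdOrthonormalBasis ℝ (CSpace m)) hW hf hz (f z) hs ?_).2
  refine hψ.contDiffAt _ ((chartAt (CSpace n) (f z)).map_source hs) ?_
  rwa [(chartAt (CSpace n) (f z)).left_inv hs]

/-- The right-hand side involves only `η` and `f`. Two local potentials therefore have the same
Laplacian along `f`, which is how one potential is exchanged for another below. -/
theorem IsLocalPotential.laplacian_comp_eq {U : Set X} {ψ : X → ℝ} (hψ : IsLocalPotential η U ψ)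
    (hW : IsOpen W) (hf : MDifferentiableOn 𝓘(ℂ, CSpace m) 𝓘(ℂ, CSpace n) f W) {z : CSpace m}
    (hz : z ∈ W) (hfz : f z ∈ U) :
    Laplacian.laplacian (fun y => ψ (f y)) z =
      ∑ i, formJ η (f z) (fderiv ℂ (chartAt (CSpace n) (f z) ∘ f) z
        (stdOrthonormalBasis ℝ (CSpace m) i)) := by
  have hs := mem_chart_source (CSpace n) (f z)
  have hcd : ContDiffAt ℝ 2 (ψ ∘ (chartAt (CSpace n) (f z)).symm)
      (chartAt (CSpace n) (f z) (f z)) := by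
    refine hψ.contDiffAt _ ((chartAt (CSpace n) (f z)).map_source hs) ?_
    rwa [(chartAt (CSpace n) (f z)).left_inv hs]
  rw [(laplacian_comp_eq_of_chart (stdOrthonormalBasis ℝ (CSpace m)) hW hf hz (f z) hs hcd).1]
  simp only [hψ.leviForm_eq hfz, ← Finset.mul_sum]
  ring

theorem IsLocalPotential.laplacian_comp_nonneg (hη : IsKahlerForm η) {U : Set X} {ψ : X → ℝ}
    (hψ : IsLocalPotential η U ψ)
    (hW : IsOpen W) (hf : MDifferentiableOn 𝓘(ℂ, CSpace m) 𝓘(ℂ, CSpace n) f W) {z : CSpace m}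
    (hz : z ∈ W) (hfz : f z ∈ U) : 0 ≤ Laplacian.laplacian (fun y => ψ (f y)) z := by
  rw [hψ.laplacian_comp_eq hW hf hz hfz]
  exact Finset.sum_nonneg fun i _ => hη.formJ_nonneg _ _

/-- A smooth function supported near a compact part of the domain of a local potential has its
Laplacian along holomorphic maps controlled by that of the potential. -/
theorem IsLocalPotential.exists_laplacian_comp_le (hη : IsKahlerForm η) {U : Set X} {ψ : X → ℝ}
    (hψ : IsLocalPotential η U ψ) (c : X) {O K : Set (CSpace n)} (hO : IsOpen O)
    (hOt : O ⊆ (chartAt (CSpace n) c).target ∩ (chartAt (CSpace n) c).symm ⁻¹' U)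
    (hK : IsCompact K) (hKO : K ⊆ O) {θ : X → ℝ}
    (hθ : ContDiffOn ℝ ∞ (θ ∘ (chartAt (CSpace n) c).symm) O) :
    ∃ C > 0, ∀ (W : Set (CSpace m)) (f : CSpace m → X), IsOpen W →
      MDifferentiableOn 𝓘(ℂ, CSpace m) 𝓘(ℂ, CSpace n) f W → ∀ z ∈ W,
      f z ∈ (chartAt (CSpace n) c).source → chartAt (CSpace n) c (f z) ∈ K →
      -(C * Laplacian.laplacian (fun y => ψ (f y)) z) ≤
        Laplacian.laplacian (fun y => θ (f y)) z := by
  have hψO : ContDiffOn ℝ ∞ (ψ ∘ (chartAt (CSpace n) c).symm) O :=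
    (contDiffOn_comp_chart_symm hψ.smooth c).mono hOt
  obtain ⟨c₁, hc₁, h1⟩ := exists_le_leviForm hO hψO hK hKO fun b hb v hv =>
    hψ.leviForm_chart_pos hη c (hOt (hKO hb)).1 (hOt (hKO hb)).2 hv
  obtain ⟨c₂, hc₂, h2⟩ := exists_abs_leviForm_le hO hθ hK hKO
  -- On `K`, `c₁` bounds the Levi form of the potential from below and `c₂` bounds that of `θ` in
  -- absolute value; the Laplacians are sums of Levi forms over the same vectors.
  refine ⟨c₂ / c₁, by positivity, fun W f hW hf z hz hs hzK => ?_⟩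
  have hle : (2 : ℕ∞ω) ≤ ∞ := WithTop.coe_le_coe.2 le_top
  rw [(laplacian_comp_eq_of_chart (stdOrthonormalBasis ℝ (CSpace m)) hW hf hz c hs
      ((hψO.contDiffAt (hO.mem_nhds (hKO hzK))).of_le hle)).1,
    (laplacian_comp_eq_of_chart (stdOrthonormalBasis ℝ (CSpace m)) hW hf hz c hs
      ((hθ.contDiffAt (hO.mem_nhds (hKO hzK))).of_le hle)).1,
    ← mul_div_assoc, Finset.mul_sum, ← neg_div, ← Finset.sum_neg_distrib]
  gcongr with i
  set v := fderiv ℂ (chartAt (CSpace n) c ∘ f) z (stdOrthonormalBasis ℝ (CSpace m) i)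
  have h3 := (abs_le.1 (h2 _ hzK v)).1
  have h4 := h1 _ hzK v
  have h5 : c₂ / c₁ * (c₁ * ‖v‖ ^ 2) = c₂ * ‖v‖ ^ 2 := by field_simp
  have h6 : c₂ / c₁ * (c₁ * ‖v‖ ^ 2) ≤
      c₂ / c₁ * leviForm (ψ ∘ (chartAt (CSpace n) c).symm) (chartAt (CSpace n) c (f z)) v := by
    gcongr
  linarith

end Potential

end ComplexManifold

/-! ### The sub-mean value property along graphs and on discs in the fibres -/

section GraphSubmean

variable {m n : ℕ}

/-- The sub-mean value property of `φ` along graphs over `D` of holomorphic maps into `O`. -/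
def GraphSubmean (D : Set (CSpace m)) (O : Set (CSpace n)) (φ : CSpace m × CSpace n → ℝ) : Prop :=
  ∀ (W : Set (CSpace m)) (h : CSpace m → CSpace n) (a : CSpace m) (r : ℝ), IsOpen W → W ⊆ D →
    DifferentiableOn ℂ h W → MapsTo h W O → 0 < r → Metric.closedBall a r ⊆ W →
    φ (a, h a) ≤ ⨍ z in Metric.closedBall a r, φ (z, h z)

theorem exists_measurable_eqOn {h : CSpace m → CSpace n} {s : Set (CSpace m)}
    (hs : MeasurableSet s) (hh : ContinuousOn h s) :
    ∃ h' : CSpace m → CSpace n, Measurable h' ∧ EqOn h' h s := by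
  classical
  exact ⟨s.piecewise h 0, hh.measurable_piecewise continuousOn_const hs, piecewise_eqOn s h 0⟩

theorem integrable_of_measurable_of_bound {α : Type*} [MeasurableSpace α] {μ : Measure α}
    [IsFiniteMeasure μ] {f : α → ℝ} (hf : Measurable f) {C : ℝ} (hC : ∀ x, |f x| ≤ C) :
    Integrable f μ :=
  Integrable.of_bound hf.aestronglyMeasurable C (Eventually.of_forall hC)

instance isFiniteMeasure_restrict_closedBall (a : CSpace m) (r : ℝ) :
    IsFiniteMeasure (volume.restrict (Metric.closedBall a r)) :=
  isFiniteMeasure_restrict.2 measure_closedBall_lt_top.ne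

theorem setAverage_closedBall_translate (g : CSpace m → ℝ) (a c : CSpace m) (r : ℝ) :
    ⨍ z in Metric.closedBall (a - c) r, g z = ⨍ z in Metric.closedBall a r, g (z - c) := by
  rw [setAverage_closedBall_eq_centered, setAverage_closedBall_eq_centered _ a]
  simp only [add_sub_right_comm]

theorem volume_real_closedBall_pos (a : CSpace m) {r : ℝ} (hr : 0 < r) :
    0 < volume.real (Metric.closedBall a r) :=
  ENNReal.toReal_pos (Metric.measure_closedBall_pos _ _ hr).ne' measure_closedBall_lt_top.ne

/-- Averages of translates preserve the sub-mean value property along graphs. -/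
theorem GraphSubmean.average {D D₁ : Set (CSpace m)} {O O₁ : Set (CSpace n)}
    {φ : CSpace m × CSpace n → ℝ} (hφ : GraphSubmean D O φ) (hmeas : Measurable φ) {C : ℝ}
    (hC : ∀ p, |φ p| ≤ C) (μ : Measure (CSpace m × CSpace n)) [IsFiniteMeasure μ]
    (hμ : ∀ᵐ q ∂μ, (∀ z ∈ D₁, z - q.1 ∈ D) ∧ ∀ b ∈ O₁, b - q.2 ∈ O) :
    GraphSubmean D₁ O₁ (fun p => ∫ q, φ (p - q) ∂μ) := by
  intro W h a r hW hWD hh hmap hr hball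
  set B := Metric.closedBall a r
  -- Nothing is known about `h` off `W`, so Fubini is applied to a globally measurable map that
  -- agrees with it on the ball.
  obtain ⟨h', hh', heq⟩ := exists_measurable_eqOn (s := B) measurableSet_closedBall
    (hh.continuousOn.mono hball)
  have hm : Measurable fun p : (CSpace m × CSpace n) × CSpace m => φ ((p.2, h' p.2) - p.1) :=
    hmeas.comp ((measurable_snd.prodMk (hh'.comp measurable_snd)).sub measurable_fst)
  have hI : Integrable (fun p : (CSpace m × CSpace n) × CSpace m => φ ((p.2, h' p.2) - p.1))
      (μ.prod (volume.restrict B)) := integrable_of_measurable_of_bound hm fun _ => hC _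
  -- A translate of a holomorphic graph is a holomorphic graph, so the inequality holds for almost
  -- every translation separately.
  have hstep : ∀ᵐ q ∂μ, φ ((a, h a) - q) ≤ ⨍ z in B, φ ((z, h' z) - q) := by
    filter_upwards [hμ] with q hq
    have h1 := hφ ((fun y => y + q.1) ⁻¹' W) (fun y => h (y + q.1) - q.2) (a - q.1) r
      (hW.preimage (by fun_prop)) ?_ ?_ ?_ hr ?_
    · rw [setAverage_closedBall_translate (fun z => φ (z, h (z + q.1) - q.2))] at h1
      simp only [sub_add_cancel] at h1
      refine h1.trans_eq ?_
      rw [setAverage_eq, setAverage_eq]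
      congr 1
      refine setIntegral_congr_fun measurableSet_closedBall fun z hz => ?_
      change φ (z - q.1, h z - q.2) = φ (z - q.1, h' z - q.2)
      rw [heq hz]
    · intro y hy
      simpa using hq.1 _ (hWD hy)
    · exact (hh.comp (f := fun y => y + q.1) (differentiable_id.add_const _).differentiableOn
        fun y hy => hy).sub_const q.2
    · intro y hy
      exact hq.2 _ (hmap hy)
    · intro y hy
      refine hball ?_
      rw [mem_closedBall_iff_norm] at hy ⊢
      rwa [show y + q.1 - a = y - (a - q.1) by abel]
  have hint1 : Integrable (fun q => φ ((a, h a) - q)) μ :=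
    integrable_of_measurable_of_bound (hmeas.comp (by fun_prop)) fun _ => hC _
  have h2 : ∫ q, φ ((a, h a) - q) ∂μ ≤ ∫ q, (⨍ z in B, φ ((z, h' z) - q)) ∂μ := by
    refine integral_mono_ae hint1 ?_ hstep
    simp only [setAverage_eq]
    exact hI.integral_prod_left.const_mul _
  refine h2.trans_eq ?_
  simp only [setAverage_eq, smul_eq_mul]
  rw [integral_const_mul, integral_integral_swap hI]
  congr 1
  refine setIntegral_congr_fun measurableSet_closedBall fun z hz => ?_
  simp only [heq hz]

theorem GraphSubmean.mono {D D₁ : Set (CSpace m)} {O O₁ : Set (CSpace n)}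
    {φ : CSpace m × CSpace n → ℝ} (hφ : GraphSubmean D O φ) (hD : D₁ ⊆ D) (hO : O₁ ⊆ O) :
    GraphSubmean D₁ O₁ φ := fun W h a r hW hWD hh hmap hr hball =>
  hφ W h a r hW (hWD.trans hD) hh (hmap.mono_right hO) hr hball

/-- The sub-mean value property of `Φ` along holomorphic discs in `O`, with respect to the
distribution of one coordinate on the unit ball of `ℂ^m`. -/
def DiscSubmean (i : Fin m) (O : Set (CSpace n)) (Φ : CSpace n → ℝ) : Prop :=
  ∀ (V : Set ℂ) (g : ℂ → CSpace n) (c : ℂ) (r : ℝ), IsOpen V → DifferentiableOn ℂ g V →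
    MapsTo g V O → 0 < r → Metric.closedBall c r ⊆ V →
    Φ (g c) ≤ ⨍ ζ in Metric.closedBall (0 : CSpace m) 1, Φ (g (c + r * ζ i))

theorem setAverage_closedBall_eq_unit (g : CSpace m → ℝ) (a : CSpace m) {r : ℝ} (hr : 0 < r) :
    ⨍ z in Metric.closedBall a r, g z = ⨍ ζ in Metric.closedBall 0 1, g (a + r • ζ) := by
  rw [setAverage_closedBall_eq_centered, setAverage_eq, setAverage_eq]
  rw [Measure.setIntegral_comp_smul_of_pos volume (fun h => g (a + h)) _ hr,
    smul_unitClosedBall, Real.norm_of_nonneg hr.le, measureReal_def, measureReal_def,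
    Measure.addHaar_closedBall' volume (0 : CSpace m) hr.le, smul_smul, ENNReal.toReal_mul,
    ENNReal.toReal_ofReal (by positivity), mul_inv, mul_comm]

theorem norm_coord_le (ζ : CSpace m) (i : Fin m) : ‖ζ i‖ ≤ ‖ζ‖ := PiLp.norm_apply_le ζ i

/-- A function with the sub-mean value property along graphs that is equicontinuous in the base
variable has the sub-mean value property on discs in the fibres. -/
theorem GraphSubmean.discSubmean (i : Fin m) {D : Set (CSpace m)} (hD : IsOpen D)
    {O : Set (CSpace n)} {φ : CSpace m × CSpace n → ℝ} (hφ : GraphSubmean D O φ)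
    (hmeas : Measurable φ) {C : ℝ} (hC : ∀ p, |φ p| ≤ C)
    (hequi : ∀ τ > 0, ∃ s > 0, ∀ z ∈ D, ∀ z' ∈ D, ‖z - z'‖ ≤ s → ∀ b ∈ O,
      |φ (z, b) - φ (z', b)| ≤ τ) {z : CSpace m} (hz : z ∈ D) :
    DiscSubmean i O (fun b => φ (z, b)) := by
  intro V g c r hV hg hmap hr hball
  refine le_of_forall_pos_le_add fun τ hτ => ?_
  obtain ⟨s, hs, hequi⟩ := hequi τ hτ
  obtain ⟨t₁, ht₁, hballD⟩ := Metric.isOpen_iff.1 hD z hz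
  set t := min s t₁ / 2 with ht
  have ht0 : 0 < t := by positivity
  have hts : t ≤ s := by rw [ht]; linarith [min_le_left s t₁]
  have htt₁ : t < t₁ := by rw [ht]; linarith [min_le_right s t₁]
  -- The base ball of radius `t` is stretched over the whole disc of radius `r`. As `t` is as small
  -- as desired, equicontinuity freezes the base variable at `z` at the cost of `τ`.
  set k : CSpace m → ℂ := fun z' => c + (r / t : ℝ) * (z' i - z i) with hk
  have hkc : Differentiable ℂ k := by
    rw [hk]
    exact ((((PiLp.proj 2 (fun _ : Fin m => ℂ) i).differentiable (𝕜 := ℂ)).sub_const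
      (z i)).const_mul _).const_add c
  have h1 := hφ (Metric.ball z t₁ ∩ k ⁻¹' V) (fun z' => g (k z')) z t
    (Metric.isOpen_ball.inter (hV.preimage hkc.continuous)) (inter_subset_left.trans hballD)
    (hg.comp hkc.differentiableOn inter_subset_right) (fun z' hz' => hmap hz'.2) ht0 ?_
  · rw [setAverage_closedBall_eq_unit _ _ ht0] at h1
    have htC : (t : ℂ) ≠ 0 := by exact_mod_cast ht0.ne'
    have hkz : ∀ ζ : CSpace m, k (z + t • ζ) = c + r * ζ i := by
      intro ζ
      simp only [hk, PiLp.add_apply, PiLp.smul_apply, add_sub_cancel_left, Complex.real_smul]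
      push_cast
      field_simp
    have hk0 : k z = c := by simp [hk]
    simp only [hkz, hk0] at h1
    refine h1.trans ?_
    have hin : ∀ ζ ∈ Metric.closedBall (0 : CSpace m) 1, c + r * ζ i ∈ V := by
      intro ζ hζ
      refine hball ?_
      rw [mem_closedBall_zero_iff] at hζ
      rw [mem_closedBall_iff_norm, add_sub_cancel_left, norm_mul, Complex.norm_real,
        Real.norm_of_nonneg hr.le]
      exact mul_le_of_le_one_right hr.le ((norm_coord_le ζ i).trans hζ)
    obtain ⟨h', hh', heq⟩ := exists_measurable_eqOn (s := Metric.closedBall (0 : CSpace m) 1)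
      (h := fun ζ => g (c + r * ζ i)) measurableSet_closedBall
      (hg.continuousOn.comp (by fun_prop) hin)
    have hvol := volume_real_closedBall_pos (0 : CSpace m) one_pos
    have e1 : ∀ w : CSpace m → CSpace m, ∫ ζ in Metric.closedBall (0 : CSpace m) 1,
        φ (w ζ, g (c + r * ζ i)) = ∫ ζ in Metric.closedBall (0 : CSpace m) 1, φ (w ζ, h' ζ) :=
      fun w => setIntegral_congr_fun measurableSet_closedBall fun ζ hζ => by rw [heq hζ]
    rw [setAverage_eq, setAverage_eq, e1, e1]
    have e2 : ∫ ζ in Metric.closedBall (0 : CSpace m) 1, φ (z + t • ζ, h' ζ) ≤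
        ∫ ζ in Metric.closedBall (0 : CSpace m) 1, (φ (z, h' ζ) + τ) := by
      refine setIntegral_mono_on ?_ ?_ measurableSet_closedBall fun ζ hζ => ?_
      · exact integrable_of_measurable_of_bound (hmeas.comp (by fun_prop)) fun _ => hC _
      · exact (integrable_of_measurable_of_bound (hmeas.comp (by fun_prop)) fun _ => hC _).add
          (integrable_const _)
      · have hb : h' ζ ∈ O := by rw [heq hζ]; exact hmap (hin ζ hζ)
        rw [mem_closedBall_zero_iff] at hζ
        have hn : ‖t • ζ‖ ≤ t := by
          rw [norm_smul, Real.norm_of_nonneg ht0.le]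
          exact mul_le_of_le_one_right ht0.le hζ
        have := hequi (z + t • ζ) (hballD (by
          rw [mem_ball_iff_norm, add_sub_cancel_left]; linarith)) z hz
          (by rw [add_sub_cancel_left]; linarith) _ hb
        linarith [(abs_le.1 this).2]
    have hIz : Integrable (fun ζ => φ (z, h' ζ))
        (volume.restrict (Metric.closedBall (0 : CSpace m) 1)) :=
      integrable_of_measurable_of_bound (hmeas.comp (by fun_prop)) fun _ => hC _
    rw [integral_add hIz (integrable_const _), setIntegral_const, smul_eq_mul] at e2
    rw [smul_eq_mul, smul_eq_mul, ← div_eq_inv_mul, ← div_eq_inv_mul, div_le_iff₀ hvol, add_mul,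
      div_mul_cancel₀ _ hvol.ne']
    linarith
  · intro z' hz'
    rw [mem_closedBall_iff_norm] at hz'
    refine ⟨by rw [mem_ball_iff_norm]; linarith, hball ?_⟩
    rw [mem_closedBall_iff_norm]
    simp only [hk, add_sub_cancel_left, norm_mul, Complex.norm_real]
    rw [Real.norm_of_nonneg (by positivity), div_mul_eq_mul_div, div_le_iff₀ ht0]
    have := norm_coord_le (z' - z) i
    simp only [PiLp.sub_apply] at this
    gcongr
    exact this.trans hz'

end GraphSubmean

/-! ### Growth of suprema over concentric balls -/

section Growth

variable {m n : ℕ}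

theorem setIntegral_re_coord (i : Fin m) :
    ∫ ζ in Metric.closedBall (0 : CSpace m) 1, (ζ i).re = 0 := by
  have := setIntegral_closedBall_comp_isometry (LinearIsometryEquiv.neg ℝ) 1
    (fun ζ : CSpace m => (ζ i).re)
  simp only [LinearIsometryEquiv.coe_neg, PiLp.neg_apply, Complex.neg_re, integral_neg] at this
  linarith

theorem setIntegral_re_coord_sq_pos (i : Fin m) :
    0 < ∫ ζ in Metric.closedBall (0 : CSpace m) 1, (ζ i).re ^ 2 := by
  rw [setIntegral_pos_iff_support_of_nonneg_ae
    (f := fun ζ : CSpace m => (ζ i).re ^ 2) (Eventually.of_forall fun h => sq_nonneg _)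
    (integrableOn_closedBall_of_continuous (by fun_prop) _ _)]
  have ho : IsOpen ({ζ : CSpace m | (ζ i).re ≠ 0} ∩ Metric.ball 0 1) :=
    (isOpen_ne_fun (by fun_prop) continuous_const).inter Metric.isOpen_ball
  refine (ho.measure_pos volume ⟨EuclideanSpace.single i (1 / 2 : ℂ), ?_, ?_⟩).trans_le
    (measure_mono ?_)
  · simp
  · simp; norm_num
  · exact fun h hh => ⟨by simpa using hh.1, Metric.ball_subset_closedBall hh.2⟩

/-- Maximum principle for the random walk driven by the real part of a coordinate: a bounded
increasing function with the sub-mean value property on `[s, T - 1]` grows at most linearly. -/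
theorem le_add_of_submean_walk (i : Fin m) {F : ℝ → ℝ} (hF : Monotone F) {C : ℝ}
    (hC : ∀ t, |F t| ≤ C) {s T : ℝ}
    (hsub : ∀ t, s ≤ t → t + 1 ≤ T →
      F t ≤ ⨍ ζ in Metric.closedBall (0 : CSpace m) 1, F (t + (ζ i).re))
    {t : ℝ} (hst : s ≤ t) (htT : t + 1 ≤ T) : F t ≤ F s + 2 * C * (t - s + 1) / (T - s) := by
  have hTs : 0 < T - s := by linarith
  have hC0 : 0 ≤ C := (abs_nonneg _).trans (hC 0)
  set V := volume.real (Metric.closedBall (0 : CSpace m) 1)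
  have hV : 0 < V := volume_real_closedBall_pos 0 one_pos
  set β := 2 * C / (T - s) with hβ
  have hβ0 : 0 ≤ β := by positivity
  set J := ∫ ζ in Metric.closedBall (0 : CSpace m) 1, (ζ i).re ^ 2
  have hJ : 0 < J := setIntegral_re_coord_sq_pos i
  set Bd := (T - s) ^ 2 + 1
  have key : ∀ ε > 0, F t - (F s + β * (t - s + 1)) ≤ ε * (Bd + J / V) := by
    intro ε hε
    -- `F` is compared with an affine barrier. The interval starts at `s - 1` because a step from
    -- `[s, T - 1]` can land there, and the shift by `1` keeps the barrier's slope term nonnegative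
    -- on it. The quadratic term makes every step gain a definite amount.
    set K : ℝ → ℝ := fun x => F x - (F s + β * (x - s + 1)) + ε * (x - s) ^ 2 with hK
    have hquad : ∀ x ∈ Icc (s - 1) T, (x - s) ^ 2 ≤ Bd := by
      intro x hx
      rcases le_total x s with h | h
      · nlinarith [hx.1, sq_nonneg (T - s)]
      · nlinarith [hx.2]
    have hbdd : BddAbove (K '' Icc (s - 1) T) := by
      refine ⟨C + C + ε * Bd, ?_⟩
      rintro _ ⟨x, hx, rfl⟩
      have h1 := (abs_le.1 (hC x)).2
      have h2 := (abs_le.1 (hC s)).1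
      have h3 : 0 ≤ β * (x - s + 1) := mul_nonneg hβ0 (by linarith [hx.1])
      have h4 : ε * (x - s) ^ 2 ≤ ε * Bd := by gcongr; exact hquad x hx
      simp only [hK]
      linarith
    have hne : (K '' Icc (s - 1) T).Nonempty := ⟨_, mem_image_of_mem _ ⟨by linarith, le_rfl⟩⟩
    set S := sSup (K '' Icc (s - 1) T)
    have hKS : ∀ x ∈ Icc (s - 1) T, K x ≤ S := fun x hx => le_csSup hbdd (mem_image_of_mem _ hx)
    -- The increment of the walk has mean zero, so affine terms average out and the quadratic term
    -- contributes its variance `J / V`. The supremum of `K` need not be attained; the definite gain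
    -- replaces attainment.
    have hstep : ∀ x, s ≤ x → x + 1 ≤ T → K x ≤ S - ε * (J / V) := by
      intro x hx hxT
      have h1 := hsub x hx hxT
      have hI1 : IntegrableOn (fun ζ : CSpace m => F (x + (ζ i).re)) (Metric.closedBall 0 1) :=
        integrable_of_measurable_of_bound (hF.measurable.comp (by fun_prop)) fun _ => hC _
      have hIr : IntegrableOn (fun ζ : CSpace m => (β - 2 * ε * (x - s)) * (ζ i).re)
          (Metric.closedBall 0 1) := integrableOn_closedBall_of_continuous (by fun_prop) _ _
      have hIq : IntegrableOn (fun ζ : CSpace m => ε * (ζ i).re ^ 2)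
          (Metric.closedBall 0 1) := integrableOn_closedBall_of_continuous (by fun_prop) _ _
      have hIc : IntegrableOn (fun _ : CSpace m =>
          S + (F s + β * (x - s + 1)) - ε * (x - s) ^ 2) (Metric.closedBall 0 1) :=
        integrableOn_closedBall_of_continuous (by fun_prop) _ _
      have hIcr : IntegrableOn (fun ζ : CSpace m =>
          S + (F s + β * (x - s + 1)) - ε * (x - s) ^ 2 + (β - 2 * ε * (x - s)) * (ζ i).re)
          (Metric.closedBall 0 1) := hIc.add hIr
      have h2 : ∫ ζ in Metric.closedBall (0 : CSpace m) 1, F (x + (ζ i).re) ≤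
          ∫ ζ in Metric.closedBall (0 : CSpace m) 1,
            (S + (F s + β * (x - s + 1)) - ε * (x - s) ^ 2 +
              (β - 2 * ε * (x - s)) * (ζ i).re - ε * (ζ i).re ^ 2) := by
        refine setIntegral_mono_on hI1 (hIcr.sub hIq) measurableSet_closedBall fun ζ hζ => ?_
        rw [mem_closedBall_zero_iff] at hζ
        have h3 := abs_le.1 ((Complex.abs_re_le_norm _).trans ((norm_coord_le ζ i).trans hζ))
        have h4 := hKS (x + (ζ i).re) ⟨by linarith [h3.1], by linarith [h3.2]⟩
        simp only [hK] at h4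
        linear_combination h4
      rw [integral_sub hIcr hIq, integral_add hIc hIr, setIntegral_const, integral_const_mul,
        integral_const_mul, setIntegral_re_coord, smul_eq_mul] at h2
      rw [setAverage_eq, smul_eq_mul, ← div_eq_inv_mul, le_div_iff₀ hV] at h1
      have h5 : F x * V ≤ (S + (F s + β * (x - s + 1)) - ε * (x - s) ^ 2 - ε * (J / V)) * V := by
        have : ε * (J / V) * V = ε * J := by field_simp
        rw [sub_mul _ (ε * (J / V)), this]
        refine h1.trans (h2.trans (le_of_eq ?_))
        ring
      have h6 := le_of_mul_le_mul_right h5 hV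
      simp only [hK]
      linarith
    have hS : S ≤ ε * (Bd + J / V) := by
      have hpos : 0 < ε * (J / V) := by positivity
      obtain ⟨_, ⟨x, hx, rfl⟩, hxS⟩ := exists_lt_of_lt_csSup hne (show S - ε * (J / V) < S by linarith)
      -- A nearly maximal point lies outside `[s, T - 1]`. To the left monotonicity suffices; to the
      -- right the slope term is at least `β * (T - s) = 2 * C`, which dominates any increment of
      -- `F`.
      have hle : F x - (F s + β * (x - s + 1)) ≤ 0 := by
        by_cases hxs : x ≤ s
        · have h3 : 0 ≤ β * (x - s + 1) := mul_nonneg hβ0 (by linarith [hx.1])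
          linarith [hF hxs]
        · by_cases hxT : x + 1 ≤ T
          · exact absurd (hstep x (not_le.1 hxs).le hxT) (not_le.2 hxS)
          · have h3 : β * (T - s) ≤ β * (x - s + 1) :=
              mul_le_mul_of_nonneg_left (by linarith) hβ0
            have h4 : β * (T - s) = 2 * C := by rw [hβ]; field_simp
            linarith [(abs_le.1 (hC x)).2, (abs_le.1 (hC s)).1]
      have h4 : ε * (x - s) ^ 2 ≤ ε * Bd := by gcongr; exact hquad x hx
      simp only [hK] at hxS
      linarith
    have h7 := hKS t ⟨by linarith, by linarith⟩
    have h8 : 0 ≤ ε * (t - s) ^ 2 := by positivity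
    simp only [hK] at h7
    linarith
  have hlim : F t - (F s + β * (t - s + 1)) ≤ 0 := by
    refine le_of_forall_pos_le_add fun δ hδ => ?_
    have hBJ : 0 < Bd + J / V := by positivity
    have := key (δ / (Bd + J / V)) (by positivity)
    rwa [div_mul_cancel₀ _ hBJ.ne', ← zero_add δ] at this
  have : β * (t - s + 1) = 2 * C * (t - s + 1) / (T - s) := by rw [hβ]; ring
  linarith

/-- The supremum of `Φ` over a closed ball. -/
noncomputable def supBall (Φ : CSpace n → ℝ) (b : CSpace n) (ρ : ℝ) : ℝ :=
  sSup (Φ '' Metric.closedBall b ρ)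

theorem bddAbove_image_of_abs_le {α : Type*} {Φ : α → ℝ} {C : ℝ} (hC : ∀ b, |Φ b| ≤ C)
    (s : Set α) : BddAbove (Φ '' s) :=
  ⟨C, by rintro _ ⟨y, _, rfl⟩; exact (abs_le.1 (hC y)).2⟩

theorem le_supBall {Φ : CSpace n → ℝ} {C : ℝ} (hC : ∀ b, |Φ b| ≤ C) {b y : CSpace n} {ρ : ℝ}
    (hy : y ∈ Metric.closedBall b ρ) : Φ y ≤ supBall Φ b ρ :=
  le_csSup (bddAbove_image_of_abs_le hC _) (mem_image_of_mem _ hy)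

theorem supBall_le {Φ : CSpace n → ℝ} {b : CSpace n} {ρ c : ℝ} (hρ : 0 ≤ ρ)
    (h : ∀ y ∈ Metric.closedBall b ρ, Φ y ≤ c) : supBall Φ b ρ ≤ c :=
  csSup_le ⟨_, mem_image_of_mem _ (Metric.mem_closedBall_self hρ)⟩
    (by rintro _ ⟨y, hy, rfl⟩; exact h y hy)

theorem supBall_mono {Φ : CSpace n → ℝ} {C : ℝ} (hC : ∀ b, |Φ b| ≤ C) {b : CSpace n} {ρ ρ' : ℝ}
    (hρ : 0 ≤ ρ) (h : ρ ≤ ρ') : supBall Φ b ρ ≤ supBall Φ b ρ' :=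
  supBall_le hρ fun _ hy => le_supBall hC (Metric.closedBall_subset_closedBall h hy)

theorem abs_supBall_le {Φ : CSpace n → ℝ} {C : ℝ} (hC : ∀ b, |Φ b| ≤ C) {b : CSpace n} {ρ : ℝ}
    (hρ : 0 ≤ ρ) : |supBall Φ b ρ| ≤ C :=
  abs_le.2 ⟨(abs_le.1 (hC b)).1.trans (le_supBall hC (Metric.mem_closedBall_self hρ)),
    supBall_le hρ fun y _ => (abs_le.1 (hC y)).2⟩

/-- Hadamard-type estimate: suprema over concentric balls grow slowly in the logarithm of the
radius. -/
theorem DiscSubmean.supBall_mul_le {i : Fin m} {O : Set (CSpace n)} (hO : IsOpen O)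
    {Φ : CSpace n → ℝ} (hΦ : DiscSubmean i O Φ) (hmeas : Measurable Φ) {C : ℝ}
    (hC : ∀ b, |Φ b| ≤ C) {b : CSpace n} {R : ℝ} (hb : Metric.closedBall b R ⊆ O) {ρ L : ℝ}
    (hρ : 0 < ρ) (hL : 1 ≤ L) (hLR : L * ρ * Real.exp 1 ≤ R) :
    supBall Φ b (L * ρ) ≤ supBall Φ b ρ + 2 * C * (Real.log L + 1) / Real.log (R / ρ) := by
  have hL0 : 0 < L := by linarith
  have hR : 0 < R := lt_of_lt_of_le (by positivity) hLR
  have hF : Monotone fun s => supBall Φ b (Real.exp s) := fun s t hst =>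
    supBall_mono hC (Real.exp_pos _).le (Real.exp_le_exp.2 hst)
  -- In the logarithm of the radius, the linear growth bound for the walk is the desired estimate.
  have h := le_add_of_submean_walk i hF (C := C) (fun t => abs_supBall_le hC (Real.exp_pos _).le)
    (s := Real.log ρ) (T := Real.log R) ?_ (t := Real.log (L * ρ)) ?_ ?_
  · simp only [Real.exp_log hρ, Real.exp_log (mul_pos hL0 hρ)] at h
    rwa [Real.log_mul hL0.ne' hρ.ne', add_sub_cancel_right, ← Real.log_div hR.ne' hρ.ne'] at h
  · intro t _ htR
    refine supBall_le (Real.exp_pos _).le fun y hy => ?_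
    rw [mem_closedBall_iff_norm] at hy
    -- On this exponential disc through `y` the distance to `b` is at most `exp (t + w.re)`, so the
    -- disc inequality for `Φ` at `y` becomes the walk inequality for the suprema.
    set g : ℂ → CSpace n := fun w => b + Complex.exp w • (y - b) with hg
    have hgd : Differentiable ℂ g := (Complex.differentiable_exp.smul_const _).const_add _
    have hnorm : ∀ w, ‖g w - b‖ ≤ Real.exp (t + w.re) := by
      intro w
      simp only [hg, add_sub_cancel_left, norm_smul, Complex.norm_exp]
      rw [add_comm, Real.exp_add]
      gcongr
    have h1 := hΦ (g ⁻¹' O) g 0 1 (hO.preimage hgd.continuous) hgd.differentiableOn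
      (fun w hw => hw) one_pos ?_
    · simp only [hg, Complex.exp_zero, one_smul, add_sub_cancel, zero_add, Complex.ofReal_one,
        one_mul] at h1
      refine h1.trans ?_
      rw [setAverage_eq, setAverage_eq]
      refine smul_le_smul_of_nonneg_left ?_ (by positivity)
      refine setIntegral_mono_on ?_ ?_ measurableSet_closedBall fun ζ _ => ?_
      · exact integrable_of_measurable_of_bound (hmeas.comp (by fun_prop)) fun _ => hC _
      · exact integrable_of_measurable_of_bound (hF.measurable.comp (by fun_prop))
          fun _ => abs_supBall_le hC (Real.exp_pos _).le
      · exact le_supBall hC (mem_closedBall_iff_norm.2 (hnorm (ζ i)))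
    · intro w hw
      rw [mem_closedBall_zero_iff] at hw
      refine hb (mem_closedBall_iff_norm.2 ((hnorm w).trans ?_))
      rw [← Real.exp_log hR]
      exact Real.exp_le_exp.2 (by linarith [(Complex.re_le_norm w).trans hw])
  · exact Real.log_le_log hρ (le_mul_of_one_le_left hρ.le hL)
  · rw [← Real.log_exp 1, ← Real.log_mul (by positivity) (by positivity)]
    exact Real.log_le_log (by positivity) hLR

theorem setIntegral_closedBall_eq_centered (g : CSpace n → ℝ) (a : CSpace n) (r : ℝ) :
    ∫ z in Metric.closedBall a r, g z = ∫ h in Metric.closedBall 0 r, g (a + h) := by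
  have h1 := (measurePreserving_add_left volume a).setIntegral_preimage_emb
    (Homeomorph.addLeft a).measurableEmbedding g (Metric.closedBall a r)
  have h2 : (fun x => a + x) ⁻¹' Metric.closedBall a r = Metric.closedBall 0 r := by
    ext; simp
  rw [h2] at h1
  exact h1.symm

/-- Multiplication by a unit complex number as a real isometry. -/
noncomputable def mulUnitIsometry (n : ℕ) (u : ℂ) (hu : ‖u‖ = 1) : CSpace n ≃ₗᵢ[ℝ] CSpace n where
  toLinearEquiv := (LinearEquiv.smulOfNeZero ℂ (CSpace n) u
    (norm_ne_zero_iff.1 (by rw [hu]; exact one_ne_zero))).restrictScalars ℝ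
  norm_map' v := by simp [norm_smul, hu]

/-- A complex scalar is a rotation, which preserves the ball and its measure, times a real dilation.
-/
theorem setIntegral_closedBall_comp_smul (q : CSpace n → ℝ) {lam : ℂ} (hl : lam ≠ 0) {R : ℝ} (hR : 0 ≤ R) :
    ∫ w in Metric.closedBall (0 : CSpace n) R, q (lam • w) =
      (‖lam‖ ^ Module.finrank ℝ (CSpace n))⁻¹ *
        ∫ w in Metric.closedBall (0 : CSpace n) (‖lam‖ * R), q w := by
  have hl' : 0 < ‖lam‖ := norm_pos_iff.2 hl
  set u : ℂ := lam / ‖lam‖ with hu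
  have hu1 : ‖u‖ = 1 := by
    rw [hu, norm_div, Complex.norm_real, norm_norm, div_self hl'.ne']
  have h1 := setIntegral_closedBall_comp_isometry (mulUnitIsometry n u hu1) R
    (fun w => q (‖lam‖ • w))
  have h2 : ∀ w : CSpace n, ‖lam‖ • (mulUnitIsometry n u hu1) w = lam • w := by
    intro w
    change ‖lam‖ • (u • w) = lam • w
    rw [← Complex.coe_smul ‖lam‖ (u • w), smul_smul, hu,
      mul_div_cancel₀ _ (by exact_mod_cast hl'.ne')]
  simp only [h2] at h1
  rw [h1, Measure.setIntegral_comp_smul_of_pos volume q _ hl', smul_closedBall _ _ hR, smul_zero, norm_norm, smul_eq_mul]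

end Growth

/-! ### Convolutions compared with suprema over small balls -/

section Mollification

variable {m n : ℕ}

/-- The mean defect of `Φ` from its supremum is controlled by the defect at any point. -/
theorem exists_setAverage_defect_le (i : Fin m) (n : ℕ) : ∃ c > 0, ∀ (O : Set (CSpace n))
    (Φ : CSpace n → ℝ) (C : ℝ), IsOpen O → DiscSubmean i O Φ → Measurable Φ → (∀ b, |Φ b| ≤ C) →
    ∀ (b : CSpace n) (ρ : ℝ), 0 < ρ → Metric.closedBall b (5 * ρ) ⊆ O →
    ∀ y ∈ Metric.closedBall b ρ,
      ⨍ x in Metric.closedBall b ρ, (supBall Φ b (5 * ρ) - Φ x) ≤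
        c * (supBall Φ b (5 * ρ) - Φ y) := by
  set B := Metric.closedBall (0 : CSpace m) 1
  -- The nonnegative defect is averaged over the discs `y + ζ i • w` with `‖w‖ ≤ 4ρ`, which stay
  -- within `5ρ` of `b`. For `ζ ∈ S` the points `y + ζ i • w` fill a ball of radius at least `2ρ`
  -- about `y`, which contains the ball of radius `ρ` about `b`.
  set S : Set (CSpace m) := B ∩ {ζ | 1 / 2 ≤ ‖ζ i‖} with hS
  have hSm : MeasurableSet S := measurableSet_closedBall.inter
    (isClosed_le continuous_const (by fun_prop)).measurableSet
  have hSB : S ⊆ B := inter_subset_left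
  have hSfin : volume S ≠ ⊤ := measure_ne_top_of_subset hSB measure_closedBall_lt_top.ne
  have hVB : 0 < volume.real B := volume_real_closedBall_pos 0 one_pos
  have hVS : 0 < volume.real S := by
    refine ENNReal.toReal_pos (ne_of_gt ?_) hSfin
    have ho : IsOpen ({ζ : CSpace m | 1 / 2 < ‖ζ i‖} ∩ Metric.ball 0 1) :=
      (isOpen_lt continuous_const (by fun_prop)).inter Metric.isOpen_ball
    refine (ho.measure_pos volume ⟨EuclideanSpace.single i (3 / 4 : ℂ), ?_, ?_⟩).trans_le
      (measure_mono ?_)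
    · simp; norm_num
    · simp; norm_num
    · exact fun h hh => ⟨Metric.ball_subset_closedBall hh.2, mem_ofPred.2 (le_of_lt (mem_ofPred.1 hh.1))⟩
  set d := Module.finrank ℝ (CSpace n)
  refine ⟨volume.real B / volume.real S * 4 ^ d, by positivity, ?_⟩
  intro O Φ C hO hΦ hmeas hC b ρ hρ hb y hy
  set M := supBall Φ b (5 * ρ)
  set v : CSpace n → ℝ := fun x => M - Φ x with hv
  have hvm : Measurable v := measurable_const.sub hmeas
  have hvC : ∀ x, |v x| ≤ C + C := fun x =>
    (abs_sub _ _).trans (add_le_add (abs_supBall_le hC (by positivity)) (hC x))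
  have hv0 : ∀ x ∈ Metric.closedBall b (5 * ρ), 0 ≤ v x := fun x hx =>
    sub_nonneg.2 (le_supBall hC hx)
  set Q := Metric.closedBall (0 : CSpace n) (4 * ρ)
  have hVQ : volume.real Q = 4 ^ d * volume.real (Metric.closedBall b ρ) := by
    rw [measureReal_def, measureReal_def, Measure.addHaar_closedBall' volume _ (by positivity),
      Measure.addHaar_closedBall' volume b hρ.le, ENNReal.toReal_mul, ENNReal.toReal_mul,
      ENNReal.toReal_ofReal (by positivity), ENNReal.toReal_ofReal (by positivity), mul_pow,
      mul_assoc]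
  have hVb : 0 < volume.real (Metric.closedBall b ρ) := volume_real_closedBall_pos b hρ
  rw [mem_closedBall_iff_norm] at hy
  have hin : ∀ (lam : ℂ) (w : CSpace n), ‖lam‖ ≤ 1 → ‖w‖ ≤ 4 * ρ →
      y + lam • w ∈ Metric.closedBall b (5 * ρ) := by
    intro lam w hl hw
    rw [mem_closedBall_iff_norm, show y + lam • w - b = (y - b) + lam • w by abel]
    refine (norm_add_le _ _).trans ?_
    rw [norm_smul]
    have : ‖lam‖ * ‖w‖ ≤ 1 * (4 * ρ) := by gcongr
    linarith
  have hm2 : Measurable fun p : CSpace m × CSpace n => v (y + p.1 i • p.2) :=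
    hvm.comp (by fun_prop)
  have hI : Integrable (fun p : CSpace m × CSpace n => v (y + p.1 i • p.2))
      ((volume.restrict B).prod (volume.restrict Q)) :=
    integrable_of_measurable_of_bound hm2 fun _ => hvC _
  -- averaging the disc inequality over directions
  have h1 : ∀ w ∈ Q, ∫ ζ in B, v (y + ζ i • w) ≤ volume.real B * v y := by
    intro w hw
    rw [mem_closedBall_zero_iff] at hw
    have hg : Differentiable ℂ fun t : ℂ => y + t • w := (differentiable_id.smul_const _).const_add _
    have h2 := hΦ ((fun t : ℂ => y + t • w) ⁻¹' O) (fun t => y + t • w) 0 1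
      (hO.preimage hg.continuous) hg.differentiableOn (fun t ht => ht) one_pos
      (fun t ht => hb (hin t w (by simpa using ht) hw))
    simp only [zero_smul, add_zero, zero_add, Complex.ofReal_one, one_mul] at h2
    rw [setAverage_eq, smul_eq_mul, ← div_eq_inv_mul, le_div_iff₀ hVB] at h2
    have hIΦ : IntegrableOn (fun ζ : CSpace m => Φ (y + ζ i • w)) B :=
      integrable_of_measurable_of_bound (hmeas.comp (by fun_prop)) fun _ => hC _
    simp only [hv]
    rw [integral_sub (integrable_const _) hIΦ, setIntegral_const, smul_eq_mul]
    linarith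
  have h3 : ∫ ζ in B, (∫ w in Q, v (y + ζ i • w)) ≤ volume.real Q * (volume.real B * v y) := by
    rw [integral_integral_swap hI]
    refine (setIntegral_mono_on hI.integral_prod_right (integrable_const (volume.real B * v y))
      measurableSet_closedBall h1).trans_eq ?_
    rw [setIntegral_const, smul_eq_mul]
  have h4 : ∀ ζ ∈ B, 0 ≤ ∫ w in Q, v (y + ζ i • w) := fun ζ hζ =>
    setIntegral_nonneg measurableSet_closedBall fun w hw => hv0 _ (hin _ _
      ((norm_coord_le ζ i).trans (mem_closedBall_zero_iff.1 hζ)) (mem_closedBall_zero_iff.1 hw))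
  have h5 : ∀ ζ ∈ S, ∫ x in Metric.closedBall b ρ, v x ≤ ∫ w in Q, v (y + ζ i • w) := by
    intro ζ hζ
    have hl1 : ‖ζ i‖ ≤ 1 := (norm_coord_le ζ i).trans (mem_closedBall_zero_iff.1 hζ.1)
    have hl2 : 1 / 2 ≤ ‖ζ i‖ := hζ.2
    have hl0 : ζ i ≠ 0 := norm_pos_iff.1 (by linarith)
    rw [setIntegral_closedBall_comp_smul (fun h => v (y + h)) hl0 (by positivity),
      ← setIntegral_closedBall_eq_centered]
    have hsub5 : Metric.closedBall y (‖ζ i‖ * (4 * ρ)) ⊆ Metric.closedBall b (5 * ρ) := by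
      refine Metric.closedBall_subset_closedBall' ?_
      rw [dist_eq_norm]
      nlinarith
    have h6 : ∫ x in Metric.closedBall b ρ, v x ≤
        ∫ x in Metric.closedBall y (‖ζ i‖ * (4 * ρ)), v x := by
      refine setIntegral_mono_set (integrable_of_measurable_of_bound hvm hvC) ?_
        (LE.le.eventuallyLE ?_)
      · exact (ae_restrict_iff' measurableSet_closedBall).2
          (Eventually.of_forall fun x hx => hv0 x (hsub5 hx))
      · refine Metric.closedBall_subset_closedBall' ?_
        rw [dist_comm, dist_eq_norm]
        nlinarith
    refine h6.trans (le_mul_of_one_le_left ?_ ?_)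
    · exact setIntegral_nonneg measurableSet_closedBall fun x hx => hv0 x (hsub5 hx)
    · exact one_le_inv_iff₀.2 ⟨by positivity, pow_le_one₀ (norm_nonneg _) hl1⟩
  have h7 : volume.real S * ∫ x in Metric.closedBall b ρ, v x ≤
      ∫ ζ in B, (∫ w in Q, v (y + ζ i • w)) := by
    have hIB := hI.integral_prod_left
    calc volume.real S * ∫ x in Metric.closedBall b ρ, v x
        = ∫ _ in S, (∫ x in Metric.closedBall b ρ, v x) := by rw [setIntegral_const, smul_eq_mul]
      _ ≤ ∫ ζ in S, (∫ w in Q, v (y + ζ i • w)) :=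
          setIntegral_mono_on (integrableOn_const hSfin) (IntegrableOn.mono_set hIB hSB) hSm h5
      _ ≤ _ := by
          refine setIntegral_mono_set hIB ?_ (LE.le.eventuallyLE hSB)
          exact (ae_restrict_iff' measurableSet_closedBall).2 (Eventually.of_forall h4)
  have h8 := h7.trans h3
  rw [setAverage_eq, smul_eq_mul, ← div_eq_inv_mul, div_le_iff₀ hVb]
  rw [hVQ] at h8
  calc ∫ x in Metric.closedBall b ρ, v x
      = (volume.real S * ∫ x in Metric.closedBall b ρ, v x) / volume.real S := by field_simp
    _ ≤ (4 ^ d * volume.real (Metric.closedBall b ρ) * (volume.real B * v y)) / volume.real S := by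
        gcongr
    _ = _ := by ring

/-- Bounded measurable functions on `D × O` with the sub-mean value property along graphs that are
equicontinuous in the base variable. -/
structure IsGraphPotential (D : Set (CSpace m)) (O : Set (CSpace n))
    (φ : CSpace m × CSpace n → ℝ) (C : ℝ) : Prop where
  isOpen_base : IsOpen D
  isOpen_fibre : IsOpen O
  measurable : Measurable φ
  bound : ∀ p, |φ p| ≤ C
  submean : GraphSubmean D O φ
  equicontinuous : ∀ τ > 0, ∃ s > 0, ∀ z ∈ D, ∀ z' ∈ D, ‖z - z'‖ ≤ s → ∀ b ∈ O,
    |φ (z, b) - φ (z', b)| ≤ τ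

variable {D : Set (CSpace m)} {O : Set (CSpace n)} {φ : CSpace m × CSpace n → ℝ} {C : ℝ}

theorem IsGraphPotential.discSubmean (h : IsGraphPotential D O φ C) (i : Fin m) {z : CSpace m}
    (hz : z ∈ D) : DiscSubmean i O (fun b => φ (z, b)) :=
  h.submean.discSubmean i h.isOpen_base h.measurable h.bound h.equicontinuous hz

/-- The growth bound has `log (R / ε)` in its denominator and does not depend on `z` or `b`, so it
tends to zero uniformly with `ε`. -/
theorem IsGraphPotential.exists_supBall_mul_le (h : IsGraphPotential D O φ C) (i : Fin m) {R τ L : ℝ}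
    (hR : 0 < R) (hτ : 0 < τ) (hL : 1 ≤ L) :
    ∃ ε₀ > 0, ∀ ε, 0 < ε → ε < ε₀ → ∀ z ∈ D, ∀ b, Metric.closedBall b R ⊆ O →
      supBall (fun b => φ (z, b)) b (L * ε) ≤ supBall (fun b => φ (z, b)) b ε + τ := by
  have hlim : Tendsto (fun ε => 2 * C * (Real.log L + 1) / Real.log (R / ε)) (𝓝[>] 0) (𝓝 0) := by
    refine Tendsto.div_atTop tendsto_const_nhds (Real.tendsto_log_atTop.comp ?_)
    change Tendsto (fun ε => R / ε) _ _
    simp only [div_eq_mul_inv]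
    exact tendsto_inv_nhdsGT_zero.const_mul_atTop hR
  have h1 : ∀ᶠ ε in 𝓝[>] (0 : ℝ), 2 * C * (Real.log L + 1) / Real.log (R / ε) < τ :=
    hlim.eventually (gt_mem_nhds hτ)
  obtain ⟨ε₁, hε₁, hlt⟩ := mem_nhdsGT_iff_exists_Ioo_subset.1 h1
  refine ⟨min ε₁ (R / (L * Real.exp 1)), lt_min hε₁ (by positivity), fun ε hε hεlt z hz b hb => ?_⟩
  have h2 := (h.discSubmean i hz).supBall_mul_le h.isOpen_fibre
    (h.measurable.comp (by fun_prop)) (fun b => h.bound _) hb hε hL ?_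
  · have h3 : _ < τ := hlt ⟨hε, hεlt.trans_le (min_le_left _ _)⟩
    linarith
  · have h3 := (hεlt.trans_le (min_le_right _ _)).le
    rw [le_div_iff₀ (by positivity)] at h3
    linarith

theorem isNegInvariant_volume_prod (m n : ℕ) :
    (volume : Measure (CSpace m × CSpace n)).IsNegInvariant := by
  constructor
  have h := Measure.map_prod_map (volume : Measure (CSpace m)) (volume : Measure (CSpace n))
    (f := Neg.neg) (g := Neg.neg) measurable_neg measurable_neg
  rw [Measure.map_neg_eq_self, Measure.map_neg_eq_self] at h
  exact h.symm

theorem locallyIntegrable_of_measurable_of_bound (hφ : Measurable φ) (hC : ∀ p, |φ p| ≤ C) :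
    LocallyIntegrable φ volume := by
  have : MemLp φ ⊤ volume := memLp_top_of_bound hφ.aestronglyMeasurable C (Eventually.of_forall hC)
  exact this.locallyIntegrable le_top

/-- Convolution with a bump in the fibre direction is bounded below by suprema over balls. -/
theorem exists_bump_integral_ge (i : Fin m) (n : ℕ) : ∃ c > 0, ∀ (O : Set (CSpace n))
    (Φ : CSpace n → ℝ) (C : ℝ), IsOpen O → DiscSubmean i O Φ → Measurable Φ → (∀ b, |Φ b| ≤ C) →
    ∀ (f : ContDiffBump (0 : CSpace n)), f.rOut ≤ 2 * f.rIn →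
    ∀ b, Metric.closedBall b (5 * f.rOut) ⊆ O →
      supBall Φ b (5 * f.rOut) - c * (supBall Φ b (5 * f.rOut) - supBall Φ b f.rOut) ≤
        ∫ q, f.normed volume q * Φ (b - q) := by
  obtain ⟨c, hc, h⟩ := exists_setAverage_defect_le i n
  set d := Module.finrank ℝ (CSpace n)
  -- As `rOut ≤ 2 * rIn`, the normalised bump is at most `2 ^ d` times the uniform density on its
  -- outer ball, so the mean defect controls the defect of the convolution.
  refine ⟨2 ^ d * c, by positivity, fun O Φ C hO hΦ hmeas hC f hf b hb => ?_⟩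
  have hρ := f.rOut_pos
  set ρ := f.rOut
  set M := supBall Φ b (5 * ρ)
  have hVb : 0 < volume.real (Metric.closedBall b ρ) := volume_real_closedBall_pos b hρ
  have hVb' : volume.real (Metric.closedBall (0 : CSpace n) ρ) =
      volume.real (Metric.closedBall b ρ) := by
    rw [measureReal_def, measureReal_def, Measure.addHaar_closedBall_center volume b]
  set v : CSpace n → ℝ := fun x => M - Φ x with hv
  have hvm : Measurable v := measurable_const.sub hmeas
  have hvC : ∀ x, |v x| ≤ C + C := fun x =>
    (abs_sub _ _).trans (add_le_add (abs_supBall_le hC (by positivity)) (hC x))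
  have hv0 : ∀ x ∈ Metric.closedBall b ρ, 0 ≤ v x := fun x hx =>
    sub_nonneg.2 (le_supBall hC (Metric.closedBall_subset_closedBall (by linarith) hx))
  -- the mean defect
  have h1 : ⨍ x in Metric.closedBall b ρ, v x ≤ c * (M - supBall Φ b ρ) := by
    set A := ⨍ x in Metric.closedBall b ρ, v x
    have h2 : supBall Φ b ρ ≤ M - A / c := by
      refine supBall_le hρ.le fun y hy => ?_
      have := h O Φ C hO hΦ hmeas hC b ρ hρ hb y hy
      rw [← div_le_iff₀' hc] at this
      linarith
    rw [← div_le_iff₀' hc]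
    linarith
  have hnC : ∀ q, f.normed volume q * v (b - q) ≤
      2 ^ d / volume.real (Metric.closedBall b ρ) *
        (Metric.closedBall (0 : CSpace n) ρ).indicator (fun q => v (b - q)) q := by
    intro q
    by_cases hq : q ∈ Metric.closedBall (0 : CSpace n) ρ
    · rw [indicator_of_mem hq]
      refine mul_le_mul_of_nonneg_right ?_ (hv0 _ ?_)
      · rw [← hVb']
        exact f.normed_le_div_measure_closedBall_rOut volume 2 hf q
      · rw [mem_closedBall_zero_iff] at hq
        rwa [mem_closedBall_iff_norm, sub_sub_cancel_left, norm_neg]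
    · have h0 : f.normed volume q = 0 := by
        refine image_eq_zero_of_notMem_tsupport ?_
        rwa [f.tsupport_normed_eq]
      rw [h0, zero_mul, indicator_of_notMem hq, mul_zero]
  have hIn : Integrable (f.normed volume) volume := f.integrable_normed
  have hIv : Integrable (fun q => f.normed volume q * v (b - q)) volume :=
    hIn.mul_bdd (hvm.comp (by fun_prop)).aestronglyMeasurable
      (Eventually.of_forall fun q => hvC (b - q))
  have hIΦ : Integrable (fun q => f.normed volume q * Φ (b - q)) volume :=
    hIn.mul_bdd (hmeas.comp (by fun_prop)).aestronglyMeasurable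
      (Eventually.of_forall fun q => hC (b - q))
  have hIon : IntegrableOn (fun q => v (b - q)) (Metric.closedBall (0 : CSpace n) ρ) :=
    integrable_of_measurable_of_bound (hvm.comp (by fun_prop)) fun _ => hvC _
  have h2 := integral_mono hIv ((hIon.integrable_indicator measurableSet_closedBall).const_mul
    (2 ^ d / volume.real (Metric.closedBall b ρ))) hnC
  rw [integral_const_mul, integral_indicator measurableSet_closedBall] at h2
  have h3 : ∫ q in Metric.closedBall (0 : CSpace n) ρ, v (b - q) =
      ∫ x in Metric.closedBall b ρ, v x := by
    rw [setIntegral_closedBall_eq_centered v b,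
      ← setIntegral_closedBall_comp_isometry (LinearIsometryEquiv.neg ℝ)]
    simp [sub_eq_add_neg]
  have h4 : ∫ q, f.normed volume q * v (b - q) = M - ∫ q, f.normed volume q * Φ (b - q) := by
    simp only [hv, mul_sub]
    rw [integral_sub (hIn.mul_const M) hIΦ, integral_mul_const, f.integral_normed, one_mul]
  rw [setAverage_eq, smul_eq_mul, ← div_eq_inv_mul] at h1
  rw [h3, h4, div_mul_eq_mul_div, mul_div_assoc] at h2
  have h5 : (2 : ℝ) ^ d * ((∫ x in Metric.closedBall b ρ, v x) /
      volume.real (Metric.closedBall b ρ)) ≤ 2 ^ d * (c * (M - supBall Φ b ρ)) := by gcongr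
  linarith

/-- Local smoothing: the mollifications of a graph potential are smooth, have the sub-mean value
property along graphs, and are uniformly close to the suprema over small fibre balls. -/
theorem IsGraphPotential.exists_mollification (h : IsGraphPotential D O φ C) (i : Fin m) {R τ : ℝ}
    (hR : 0 < R) (hτ : 0 < τ) :
    ∃ ε₀ > 0, ∀ ε, 0 < ε → ε < ε₀ → ∃ Γ : CSpace m × CSpace n → ℝ, ContDiff ℝ ∞ Γ ∧
      GraphSubmean {z | Metric.closedBall z R ⊆ D} {b | Metric.closedBall b R ⊆ O} Γ ∧
      ∀ z b, Metric.closedBall z R ⊆ D → Metric.closedBall b R ⊆ O →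
        |Γ (z, b) - supBall (fun b => φ (z, b)) b ε| ≤ τ := by
  obtain ⟨c, hc, hlow⟩ := exists_bump_integral_ge i n
  -- The convolution falls below the supremum over the `5ε`-ball by at most `c` times the growth of
  -- the supremum from `ε` to `5ε`, that is `τ / 2`; the other `τ / 2` pays for the oscillation in
  -- the base.
  obtain ⟨ε₁, hε₁, hgrow⟩ := h.exists_supBall_mul_le i (L := 5) hR
    (show 0 < τ / (2 * c) by positivity) (by norm_num)
  obtain ⟨s, hs, hequi⟩ := h.equicontinuous (τ / 2) (by positivity)
  refine ⟨min (min ε₁ s) (R / 5), by positivity, fun ε hε hεlt => ?_⟩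
  have hε1 : ε < ε₁ := hεlt.trans_le ((min_le_left _ _).trans (min_le_left _ _))
  have hε2 : ε < s := hεlt.trans_le ((min_le_left _ _).trans (min_le_right _ _))
  have hε3 : 5 * ε < R := by
    have := hεlt.trans_le (min_le_right _ _)
    linarith
  let f₁ : ContDiffBump (0 : CSpace m) := ⟨ε / 2, ε, by positivity, by linarith⟩
  let f₂ : ContDiffBump (0 : CSpace n) := ⟨ε / 2, ε, by positivity, by linarith⟩
  set k₁ := f₁.normed volume with hk₁
  set k₂ := f₂.normed volume with hk₂
  have hI₁ : Integrable k₁ volume := f₁.integrable_normed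
  have hI₂ : Integrable k₂ volume := f₂.integrable_normed
  set k : CSpace m × CSpace n → ℝ := fun q => k₁ q.1 * k₂ q.2 with hk
  have hk0 : ∀ q, 0 ≤ k q := fun q => mul_nonneg (f₁.nonneg_normed _) (f₂.nonneg_normed _)
  have hsupp : ∀ q, k q ≠ 0 → ‖q.1‖ ≤ ε ∧ ‖q.2‖ ≤ ε := by
    intro q hq
    have h1 : q.1 ∈ tsupport k₁ := subset_tsupport _ (left_ne_zero_of_mul hq)
    have h2 : q.2 ∈ tsupport k₂ := subset_tsupport _ (right_ne_zero_of_mul hq)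
    rw [hk₁, f₁.tsupport_normed_eq, mem_closedBall_zero_iff] at h1
    rw [hk₂, f₂.tsupport_normed_eq, mem_closedBall_zero_iff] at h2
    exact ⟨h1, h2⟩
  have hkd : ContDiff ℝ ∞ k :=
    (f₁.contDiff_normed.comp contDiff_fst).mul (f₂.contDiff_normed.comp contDiff_snd)
  have hkc : HasCompactSupport k := by
    refine HasCompactSupport.intro ((isCompact_closedBall (0 : CSpace m) ε).prod
      (isCompact_closedBall (0 : CSpace n) ε)) fun q hq => ?_
    by_contra hne
    exact hq ⟨mem_closedBall_zero_iff.2 (hsupp q hne).1, mem_closedBall_zero_iff.2 (hsupp q hne).2⟩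
  have hkI : Integrable k volume := hkd.continuous.integrable_of_hasCompactSupport hkc
  have hk1 : ∫ q, k q = 1 := by
    rw [Measure.volume_eq_prod, hk, integral_prod_mul k₁ k₂, f₁.integral_normed, f₂.integral_normed,
      one_mul]
  set Γ : CSpace m × CSpace n → ℝ := fun p => ∫ q, k q * φ (p - q) with hΓ
  have hkφ : ∀ p, Integrable (fun q => k q * φ (p - q)) volume := fun p =>
    hkI.mul_bdd (h.measurable.comp (by fun_prop)).aestronglyMeasurable
      (Eventually.of_forall fun q => h.bound (p - q))
  refine ⟨Γ, ?_, ?_, ?_⟩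
  · have : (volume : Measure (CSpace m × CSpace n)).IsAddHaarMeasure :=
      Measure.prod.instIsAddHaarMeasure _ _
    have := isNegInvariant_volume_prod m n
    exact hkc.contDiff_convolution_left (ContinuousLinearMap.lsmul ℝ ℝ) hkd
      (locallyIntegrable_of_measurable_of_bound h.measurable h.bound)
  · have hkm : Measurable fun q => ENNReal.ofReal (k q) :=
      hkd.continuous.measurable.ennreal_ofReal
    have hfin : IsFiniteMeasure (volume.withDensity fun q => ENNReal.ofReal (k q)) :=
      isFiniteMeasure_withDensity_ofReal hkI.2
    have h1 := h.submean.average (D₁ := {z | Metric.closedBall z R ⊆ D})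
      (O₁ := {b | Metric.closedBall b R ⊆ O}) h.measurable h.bound
      (volume.withDensity fun q => ENNReal.ofReal (k q)) ?_
    · convert h1 using 2 with p
      rw [integral_withDensity_eq_integral_toReal_smul hkm
        (Eventually.of_forall fun q => ENNReal.ofReal_lt_top)]
      simp only [ENNReal.toReal_ofReal (hk0 _), smul_eq_mul, hΓ]
    · refine (ae_withDensity_iff hkm).2 (Eventually.of_forall fun q hq => ?_)
      have hq' := hsupp q fun h0 => hq (by rw [h0, ENNReal.ofReal_zero])
      refine ⟨fun z hz => hz ?_, fun b hb => hb ?_⟩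
      · rw [mem_closedBall_iff_norm, sub_sub_cancel_left, norm_neg]
        linarith [hq'.1]
      · rw [mem_closedBall_iff_norm, sub_sub_cancel_left, norm_neg]
        linarith [hq'.2]
  · intro z b hz hb
    have hzD : z ∈ D := hz (Metric.mem_closedBall_self hR.le)
    set Φ : CSpace n → ℝ := fun b => φ (z, b)
    have hΦm : Measurable Φ := h.measurable.comp (by fun_prop)
    have hΦC : ∀ b, |Φ b| ≤ C := fun b => h.bound _
    have hclose : ∀ q, k q ≠ 0 → |φ ((z, b) - q) - Φ (b - q.2)| ≤ τ / 2 := by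
      intro q hq
      have hq' := hsupp q hq
      refine hequi (z - q.1) (hz ?_) z hzD ?_ (b - q.2) (hb ?_)
      · rw [mem_closedBall_iff_norm, sub_sub_cancel_left, norm_neg]
        linarith [hq'.1]
      · rw [sub_sub_cancel_left, norm_neg]
        linarith [hq'.1]
      · rw [mem_closedBall_iff_norm, sub_sub_cancel_left, norm_neg]
        linarith [hq'.2]
    rw [abs_le]
    constructor
    · have h1 := hlow O Φ C h.isOpen_fibre (h.discSubmean i hzD) hΦm hΦC f₂
        (show ε ≤ 2 * (ε / 2) by linarith) b
        ((Metric.closedBall_subset_closedBall hε3.le).trans hb)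
      change supBall Φ b (5 * ε) - c * (supBall Φ b (5 * ε) - supBall Φ b ε) ≤
        ∫ q, k₂ q * Φ (b - q) at h1
      have h2 := hgrow ε hε hε1 z hzD b hb
      have h3 : supBall Φ b ε ≤ supBall Φ b (5 * ε) := supBall_mono hΦC hε.le (by linarith)
      have h4 : c * (supBall Φ b (5 * ε) - supBall Φ b ε) ≤ τ / 2 := by
        calc c * (supBall Φ b (5 * ε) - supBall Φ b ε) ≤ c * (τ / (2 * c)) := by
              gcongr; linarith
          _ = τ / 2 := by field_simp
      have h5 : ∫ q, k₂ q * Φ (b - q) = ∫ q : CSpace m × CSpace n, k q * Φ (b - q.2) := by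
        have : (fun q : CSpace m × CSpace n => k q * Φ (b - q.2)) =
            fun q => k₁ q.1 * (k₂ q.2 * Φ (b - q.2)) := by
          ext q; simp only [hk]; ring
        rw [this, Measure.volume_eq_prod, integral_prod_mul k₁ (fun y => k₂ y * Φ (b - y)),
          f₁.integral_normed, one_mul]
      have hkΦ : Integrable (fun q : CSpace m × CSpace n => k q * Φ (b - q.2)) volume :=
        hkI.mul_bdd (hΦm.comp (by fun_prop)).aestronglyMeasurable
          (Eventually.of_forall fun q => hΦC (b - q.2))
      have h6 : ∫ q, (k q * Φ (b - q.2) - k q * (τ / 2)) ≤ Γ (z, b) := by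
        refine integral_mono (hkΦ.sub (hkI.mul_const _)) (hkφ _) fun q => ?_
        by_cases hq : k q = 0
        · simp [hq]
        · have := mul_le_mul_of_nonneg_left (abs_le.1 (hclose q hq)).1 (hk0 q)
          simp only
          linarith
      rw [integral_sub hkΦ (hkI.mul_const _), integral_mul_const, hk1] at h6
      linarith
    · have h6 : Γ (z, b) ≤ ∫ q, k q * (supBall Φ b ε + τ / 2) := by
        refine integral_mono (hkφ _) (hkI.mul_const _) fun q => ?_
        by_cases hq : k q = 0
        · simp [hq]
        · refine mul_le_mul_of_nonneg_left ?_ (hk0 q)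
          have h7 : Φ (b - q.2) ≤ supBall Φ b ε := le_supBall hΦC (by
            rw [mem_closedBall_iff_norm, sub_sub_cancel_left, norm_neg]
            exact (hsupp q hq).2)
          linarith [(abs_le.1 (hclose q hq)).2]
      rw [integral_mul_const, hk1] at h6
      linarith

end Mollification

/-! ### Averages over balls of the base -/

section BaseAverage

variable {m n : ℕ}

theorem abs_setIntegral_sub_le {q : CSpace m → ℝ} (hq : Measurable q) {C : ℝ} (hC : ∀ z, |q z| ≤ C)
    {z z' : CSpace m} {r r' : ℝ} (hsub : Metric.closedBall z r ⊆ Metric.closedBall z' r') :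
    |(∫ y in Metric.closedBall z' r', q y) - ∫ y in Metric.closedBall z r, q y| ≤
      C * (volume.real (Metric.closedBall z' r') - volume.real (Metric.closedBall z r)) := by
  have hI : IntegrableOn q (Metric.closedBall z' r') := integrable_of_measurable_of_bound hq hC
  rw [← setIntegral_sdiff measurableSet_closedBall hI hsub,
    ← measureReal_sdiff hsub measurableSet_closedBall measure_closedBall_lt_top.ne]
  have := norm_setIntegral_le_of_norm_le_const (μ := volume) (f := q) (C := C)
    (s := Metric.closedBall z' r' \ Metric.closedBall z r)
    (measure_lt_top_of_subset sdiff_subset measure_closedBall_lt_top.ne) fun y _ => hC y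
  simpa using this

/-- Means over balls of a bounded function depend continuously on the centre, uniformly. -/
theorem exists_abs_setAverage_sub_le (m : ℕ) {C δ τ : ℝ} (hδ : 0 < δ) (hτ : 0 < τ) :
    ∃ s > 0, ∀ q : CSpace m → ℝ, Measurable q → (∀ z, |q z| ≤ C) → ∀ z z' : CSpace m,
      ‖z - z'‖ ≤ s →
      |(⨍ y in Metric.closedBall z δ, q y) - ⨍ y in Metric.closedBall z' δ, q y| ≤ τ := by
  set V : ℝ → ℝ := fun r => r ^ Module.finrank ℝ (CSpace m) *
    volume.real (Metric.closedBall (0 : CSpace m) 1) with hV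
  have hVr : ∀ (z : CSpace m) (r : ℝ), 0 ≤ r → volume.real (Metric.closedBall z r) = V r := by
    intro z r hr
    rw [measureReal_def, Measure.addHaar_closedBall' volume _ hr, ENNReal.toReal_mul,
      ENNReal.toReal_ofReal (by positivity)]
    rfl
  have hVpos : 0 < V δ := by rw [← hVr 0 δ hδ.le]; exact volume_real_closedBall_pos _ hδ
  have hlim : Tendsto (fun s => 2 * C * (V δ - V (δ - s)) / V δ) (𝓝 0) (𝓝 0) := by
    have hc : Continuous fun s => 2 * C * (V δ - V (δ - s)) / V δ := by
      simp only [hV]; fun_prop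
    have := hc.tendsto 0
    simpa using this
  have hev : ∀ᶠ s in 𝓝[>] (0 : ℝ), 2 * C * (V δ - V (δ - s)) / V δ < τ :=
    (hlim.mono_left nhdsWithin_le_nhds).eventually (gt_mem_nhds hτ)
  obtain ⟨s, hsτ, hs0, hsδ⟩ := (hev.and (Ioo_mem_nhdsGT hδ)).exists
  refine ⟨s, hs0, fun q hq hC z z' hzz' => ?_⟩
  -- Both balls of radius `δ` contain the ball of radius `δ - s` about `z`, and each integral
  -- differs from the integral over it by at most `C` times the difference of volumes.
  have h1 := abs_setIntegral_sub_le hq hC (z := z) (z' := z) (r := δ - s) (r' := δ)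
    (Metric.closedBall_subset_closedBall (by linarith))
  have h2 := abs_setIntegral_sub_le hq hC (z := z) (z' := z') (r := δ - s) (r' := δ)
    (Metric.closedBall_subset_closedBall' (by rw [dist_eq_norm]; linarith))
  rw [hVr _ _ hδ.le, hVr _ _ (by linarith)] at h1 h2
  rw [setAverage_eq, setAverage_eq, hVr _ _ hδ.le, hVr _ _ hδ.le, smul_eq_mul, smul_eq_mul,
    ← mul_sub, abs_mul, abs_of_pos (inv_pos.2 hVpos), ← div_eq_inv_mul]
  refine (div_le_div_of_nonneg_right ?_ hVpos.le).trans hsτ.le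
  rw [abs_le] at h1 h2 ⊢
  constructor <;> linarith [h1.1, h1.2, h2.1, h2.2]

theorem setAverage_closedBall_sub (q : CSpace m → ℝ) (z : CSpace m) (δ : ℝ) :
    ⨍ a in Metric.closedBall (0 : CSpace m) δ, q (z - a) = ⨍ y in Metric.closedBall z δ, q y := by
  rw [setAverage_closedBall_eq_centered q z, setAverage_eq, setAverage_eq,
    ← setIntegral_closedBall_comp_isometry (LinearIsometryEquiv.neg ℝ) δ]
  simp [sub_eq_add_neg]

/-- Averaging a bounded function with the sub-mean value property along graphs over small balls in
the base makes it equicontinuous in the base variable. -/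
theorem GraphSubmean.isGraphPotential_average {D D₁ : Set (CSpace m)} {O : Set (CSpace n)}
    {φ : CSpace m × CSpace n → ℝ} (hφ : GraphSubmean D O φ) (hD₁ : IsOpen D₁) (hO : IsOpen O)
    (hmeas : Measurable φ) {C : ℝ} (hC : ∀ p, |φ p| ≤ C) {δ : ℝ} (hδ : 0 < δ)
    (hsub : ∀ z ∈ D₁, Metric.closedBall z δ ⊆ D) :
    IsGraphPotential D₁ O
      (fun p => ⨍ a in Metric.closedBall (0 : CSpace m) δ, φ (p.1 - a, p.2)) C := by
  set V := volume.real (Metric.closedBall (0 : CSpace m) δ)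
  have hV : 0 < V := volume_real_closedBall_pos 0 hδ
  have hmeas' : Measurable fun p : (CSpace m × CSpace n) × CSpace m => φ (p.1.1 - p.2, p.1.2) :=
    hmeas.comp (by fun_prop)
  refine ⟨hD₁, hO, ?_, fun p => ?_, ?_, fun τ hτ => ?_⟩
  · simp only [setAverage_eq]
    exact (hmeas'.stronglyMeasurable.integral_prod_right'
      (ν := volume.restrict (Metric.closedBall 0 δ))).measurable.const_smul V⁻¹
  · rw [setAverage_eq, smul_eq_mul, abs_mul, abs_of_pos (inv_pos.2 hV), ← div_eq_inv_mul,
      div_le_iff₀ hV]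
    exact norm_setIntegral_le_of_norm_le_const (f := fun a => φ (p.1 - a, p.2))
      measure_closedBall_lt_top fun a _ => hC _
  · have hVe : ENNReal.ofReal V⁻¹ ≠ ⊤ := ENNReal.ofReal_ne_top
    -- The base average is the average over translations distributed uniformly on the ball, with no
    -- fibre component.
    set μ : Measure (CSpace m × CSpace n) :=
      ENNReal.ofReal V⁻¹ • Measure.map (fun a => (a, (0 : CSpace n)))
        (volume.restrict (Metric.closedBall 0 δ)) with hμ
    have hfm : Measurable fun a : CSpace m => (a, (0 : CSpace n)) := by fun_prop
    have hfin : IsFiniteMeasure μ := Measure.smul_finite _ hVe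
    have h1 := hφ.average (D₁ := D₁) (O₁ := O) hmeas hC μ ?_
    · convert h1 using 2 with p
      have hm : Measurable fun q => φ (p - q) := hmeas.comp (by fun_prop)
      rw [hμ, integral_smul_measure, integral_map hfm.aemeasurable hm.aestronglyMeasurable,
        setAverage_eq, ENNReal.toReal_ofReal (by positivity)]
      congr 2
      ext a
      change φ _ = φ (p.1 - a, p.2 - 0)
      rw [sub_zero]
    · refine Measure.ae_smul_measure ?_ _
      have hae : ∀ᵐ q ∂Measure.map (fun a => (a, (0 : CSpace n)))
          (volume.restrict (Metric.closedBall 0 δ)),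
          q ∈ Metric.closedBall (0 : CSpace m) δ ×ˢ ({0} : Set (CSpace n)) := by
        refine (ae_map_iff hfm.aemeasurable
          (measurableSet_closedBall.prod (measurableSet_singleton _))).2 ?_
        exact (ae_restrict_iff' measurableSet_closedBall).2 (Eventually.of_forall fun a ha =>
          ⟨ha, rfl⟩)
      filter_upwards [hae] with q hq
      have h1 := mem_closedBall_zero_iff.1 hq.1
      have h2 : q.2 = 0 := hq.2
      refine ⟨fun z hz => hsub z hz ?_, fun b hb => by simpa [h2] using hb⟩
      rwa [mem_closedBall_iff_norm, sub_sub_cancel_left, norm_neg]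
  · obtain ⟨s, hs, h⟩ := exists_abs_setAverage_sub_le m hδ hτ
    refine ⟨s, hs, fun z _ z' _ hzz' b _ => ?_⟩
    simp only
    rw [setAverage_closedBall_sub (fun y => φ (y, b)), setAverage_closedBall_sub (fun y => φ (y, b))]
    exact h _ (hmeas.comp (by fun_prop)) (fun _ => hC _) z z' hzz'

/-- A holomorphic map is uniformly Lipschitz at small scales near a compact set. -/
theorem exists_lipschitz_near_compact {T : CSpace n → CSpace n} {Ω K : Set (CSpace n)}
    (hΩ : IsOpen Ω) (hT : DifferentiableOn ℂ T Ω) (hK : IsCompact K) (hKΩ : K ⊆ Ω) :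
    ∃ L ≥ 1, ∃ ε₀ > 0, ∀ b ∈ K, ∀ b', dist b' b ≤ ε₀ → b' ∈ Ω ∧ dist (T b') (T b) ≤ L * dist b' b := by
  obtain ⟨ε₀, hε₀, hsub⟩ := hK.exists_cthickening_subset_open hΩ hKΩ
  have hKc : IsCompact (Metric.cthickening ε₀ K) := hK.cthickening
  have hcont : ContinuousOn (fderiv ℂ T) Ω :=
    (contDiffOn_of_differentiableOn_complex hΩ hT).continuousOn_fderiv_of_isOpen hΩ
      (WithTop.coe_le_coe.2 le_top)
  obtain ⟨C, hC⟩ := (hKc.image_of_continuousOn (hcont.mono hsub)).isBounded.exists_norm_le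
  refine ⟨max C 1, le_max_right _ _, ε₀, hε₀, fun b hb b' hb' => ?_⟩
  have hball : Metric.closedBall b ε₀ ⊆ Metric.cthickening ε₀ K :=
    Metric.closedBall_subset_cthickening hb ε₀
  refine ⟨hsub (hball hb'), ?_⟩
  rw [dist_eq_norm, dist_eq_norm]
  exact (convex_closedBall b ε₀).norm_image_sub_le_of_norm_fderiv_le (𝕜 := ℂ)
    (fun x hx => hT.differentiableAt (hΩ.mem_nhds (hsub (hball hx))))
    (fun x hx => (hC _ (mem_image_of_mem _ (hball hx))).trans (le_max_left _ _))
    (Metric.mem_closedBall_self hε₀.le) hb'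

/-- Strict sublevel sets are relatively open in `s`. Extension by zero gives the global
measurability that the Fubini arguments need. -/
theorem UpperSemicontinuousOn.measurable_indicator {α : Type*} [TopologicalSpace α]
    [MeasurableSpace α] [BorelSpace α] {f : α → ℝ} {s : Set α} (hs : MeasurableSet s)
    (hf : UpperSemicontinuousOn f s) : Measurable (s.indicator f) := by
  classical
  refine measurable_of_Iio fun c => ?_
  obtain ⟨V, hV, hVs⟩ := upperSemicontinuousOn_iff_preimage_Iio.1 hf c
  have : s.indicator f ⁻¹' Iio c = (s ∩ V) ∪ (sᶜ ∩ {_x | 0 < c}) := by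
    rw [← hVs]
    ext x
    by_cases hx : x ∈ s <;> simp [hx]
  rw [this]
  exact (hs.inter hV.measurableSet).union (hs.compl.inter (MeasurableSet.const _))

end BaseAverage

/-! ### Coordinate patches and the comparison of suprema between them -/

section Patch

variable {m n : ℕ} {X : Type*} [TopologicalSpace X] [ChartedSpace (CSpace n) X]

/-- The mean of `u(·, x)` over the ball of radius `δ` centred at `z`. -/
noncomputable def baseAverage (u : CSpace m × X → ℝ) (δ : ℝ) (z : CSpace m) (x : X) : ℝ :=
  ⨍ a in Metric.closedBall (0 : CSpace m) δ, u (z - a, x)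

/-- Bounded upper semicontinuous functions on `D × X` that are `η`-subharmonic on graphs. -/
structure IsBoundedGraphSubharmonic
    (η : ∀ x : X, TangentSpace 𝓘(ℝ, CSpace n) x →L[ℝ] TangentSpace 𝓘(ℝ, CSpace n) x →L[ℝ] ℝ)
    (D : Set (CSpace m)) (u : CSpace m × X → ℝ) (C : ℝ) : Prop where
  isOpen : IsOpen D
  bound : ∀ p ∈ D ×ˢ (univ : Set X), |u p| ≤ C
  usc : UpperSemicontinuousOn u (D ×ˢ (univ : Set X))
  sub : IsSubharmonicOnGraphs η D u

/-- A coordinate patch carrying a local potential, with a compact part `K` at distance `R` from its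
boundary. -/
structure CoordPatch
    (η : ∀ x : X, TangentSpace 𝓘(ℝ, CSpace n) x →L[ℝ] TangentSpace 𝓘(ℝ, CSpace n) x →L[ℝ] ℝ) where
  c : X
  U : Set X
  ψ : X → ℝ
  O : Set (CSpace n)
  K : Set (CSpace n)
  R : ℝ
  Cψ : ℝ
  isLocalPotential : IsLocalPotential η U ψ
  isOpen : IsOpen O
  subset : O ⊆ (chartAt (CSpace n) c).target ∩ (chartAt (CSpace n) c).symm ⁻¹' U
  bound : ∀ b ∈ O, |ψ ((chartAt (CSpace n) c).symm b)| ≤ Cψ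
  isCompact : IsCompact K
  R_pos : 0 < R
  closedBall_subset : ∀ b ∈ K, Metric.closedBall b R ⊆ O

variable {η : ∀ x : X, TangentSpace 𝓘(ℝ, CSpace n) x →L[ℝ] TangentSpace 𝓘(ℝ, CSpace n) x →L[ℝ] ℝ}

namespace CoordPatch

/-- The points of `X` over the compact part of the patch. -/
def core (p : CoordPatch η) : Set X :=
  (chartAt (CSpace n) p.c).source ∩ chartAt (CSpace n) p.c ⁻¹' p.K

/-- The supremum of `A` over the coordinate ball of radius `ε` around `x`. -/
noncomputable def sup (p : CoordPatch η) (A : X → ℝ) (x : X) (ε : ℝ) : ℝ :=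
  supBall (fun b => A ((chartAt (CSpace n) p.c).symm b)) (chartAt (CSpace n) p.c x) ε

/-- `ψ + u` read in the patch, extended by zero. -/
noncomputable def localFun (p : CoordPatch η) (D : Set (CSpace m)) (u : CSpace m × X → ℝ) :
    CSpace m × CSpace n → ℝ :=
  (D ×ˢ p.O).indicator fun q => p.ψ ((chartAt (CSpace n) p.c).symm q.2) +
    u (q.1, (chartAt (CSpace n) p.c).symm q.2)

theorem K_subset (p : CoordPatch η) : p.K ⊆ p.O := fun b hb =>
  p.closedBall_subset b hb (Metric.mem_closedBall_self p.R_pos.le)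

end CoordPatch

section Averages

variable {D D₁ : Set (CSpace m)} {u : CSpace m × X → ℝ} {C δ : ℝ}

theorem IsBoundedGraphSubharmonic.integrableOn (h : IsBoundedGraphSubharmonic η D u C)
    {z : CSpace m} (hz : Metric.closedBall z δ ⊆ D) (x : X) :
    IntegrableOn (fun a => u (z - a, x)) (Metric.closedBall (0 : CSpace m) δ) := by
  have h1 : UpperSemicontinuousOn (fun z => u (z, x)) D :=
    h.usc.comp (g := fun z => (z, x)) (by fun_prop) fun z hz => ⟨hz, mem_univ _⟩
  have hm := h1.measurable_indicator h.isOpen.measurableSet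
  have hC0 : ∀ y, |D.indicator (fun z => u (z, x)) y| ≤ max C 0 := by
    intro y
    by_cases hy : y ∈ D
    · rw [indicator_of_mem hy]
      exact (h.bound _ ⟨hy, mem_univ _⟩).trans (le_max_left _ _)
    · rw [indicator_of_notMem hy, abs_zero]
      exact le_max_right _ _
  have h2 : IntegrableOn (fun a => D.indicator (fun z => u (z, x)) (z - a))
      (Metric.closedBall (0 : CSpace m) δ) :=
    integrable_of_measurable_of_bound (hm.comp (by fun_prop)) fun a => hC0 _
  refine h2.congr_fun (fun a ha => ?_) measurableSet_closedBall
  simp only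
  rw [indicator_of_mem (hz _)]
  rw [mem_closedBall_zero_iff] at ha
  rwa [mem_closedBall_iff_norm, sub_sub_cancel_left, norm_neg]

theorem mem_of_closedBall_subset {z a : CSpace m} (hz : Metric.closedBall z δ ⊆ D)
    (ha : a ∈ Metric.closedBall (0 : CSpace m) δ) : z - a ∈ D := by
  refine hz ?_
  rw [mem_closedBall_zero_iff] at ha
  rwa [mem_closedBall_iff_norm, sub_sub_cancel_left, norm_neg]

theorem IsBoundedGraphSubharmonic.abs_baseAverage_le (h : IsBoundedGraphSubharmonic η D u C)
    (hδ : 0 < δ) {z : CSpace m} (hz : Metric.closedBall z δ ⊆ D) (x : X) :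
    |baseAverage u δ z x| ≤ C := by
  have hV := volume_real_closedBall_pos (0 : CSpace m) hδ
  rw [baseAverage, setAverage_eq, smul_eq_mul, abs_mul, abs_of_pos (inv_pos.2 hV),
    ← div_eq_inv_mul, div_le_iff₀ hV]
  exact norm_setIntegral_le_of_norm_le_const (f := fun a => u (z - a, x))
    measure_closedBall_lt_top fun a ha => h.bound _ ⟨mem_of_closedBall_subset hz ha, mem_univ _⟩

/-- A function is somewhere at least its mean. This converts upper bounds by averages into upper
bounds by values of `u` at nearby points. -/
theorem IsBoundedGraphSubharmonic.exists_baseAverage_le (h : IsBoundedGraphSubharmonic η D u C)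
    (hδ : 0 < δ) {z : CSpace m} (hz : Metric.closedBall z δ ⊆ D) (x : X) :
    ∃ z' ∈ Metric.closedBall z δ, baseAverage u δ z x ≤ u (z', x) := by
  obtain ⟨a, ha, hle⟩ := exists_setAverage_le
    (Metric.measure_closedBall_pos volume (0 : CSpace m) hδ).ne'
    measure_closedBall_lt_top.ne (h.integrableOn hz x)
  refine ⟨z - a, ?_, hle⟩
  rw [mem_closedBall_zero_iff] at ha
  rwa [mem_closedBall_iff_norm, sub_sub_cancel_left, norm_neg]

theorem setAverage_const_add {q : CSpace m → ℝ} (hδ : 0 < δ) {z : CSpace m}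
    (hq : IntegrableOn q (Metric.closedBall z δ)) (k : ℝ) :
    ⨍ a in Metric.closedBall z δ, (k + q a) = k + ⨍ a in Metric.closedBall z δ, q a := by
  have hV := volume_real_closedBall_pos z hδ
  rw [setAverage_eq, setAverage_eq, integral_add (integrable_const _) hq, setIntegral_const,
    smul_eq_mul, smul_eq_mul, smul_eq_mul, mul_add, inv_mul_cancel_left₀ hV.ne']

/-- Constant maps are holomorphic, and along them the potential is a constant that cancels. -/
theorem IsBoundedGraphSubharmonic.le_baseAverage (hη : IsKahlerForm η)
    (h : IsBoundedGraphSubharmonic η D u C)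
    (hδ : 0 < δ) {z : CSpace m} (hz : Metric.closedBall z δ ⊆ D) (x : X) :
    u (z, x) ≤ baseAverage u δ z x := by
  obtain ⟨U, ψ, hxU, hψ⟩ := hη.exists_potential x
  have h1 := (h.sub D (fun _ => x) U ψ h.isOpen subset_rfl mdifferentiableOn_const hψ
    (fun _ _ => hxU)).submean z δ hδ hz
  have hI : IntegrableOn (fun y => u (y, x)) (Metric.closedBall z δ) := by
    have h2 := (h.sub D (fun _ => x) U ψ h.isOpen subset_rfl mdifferentiableOn_const hψ
      (fun _ _ => hxU)).integrable z δ hδ hz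
    have h3 := h2.sub (integrable_const (μ := volume.restrict (Metric.closedBall z δ)) (ψ x))
    refine h3.congr (Eventually.of_forall fun y => ?_)
    simp
  rw [setAverage_const_add hδ hI] at h1
  rw [baseAverage, setAverage_closedBall_sub (fun y => u (y, x))]
  linarith

end Averages

section Local

variable [IsManifold 𝓘(ℂ, CSpace n) ω X] {D D₁ : Set (CSpace m)} {u : CSpace m × X → ℝ} {C δ : ℝ}

theorem CoordPatch.graphSubmean_localFun (p : CoordPatch η)
    (h : IsBoundedGraphSubharmonic η D u C) : GraphSubmean D p.O (p.localFun D u) := by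
  intro W g a r hW hWD hg hmap hr hball
  have hval : ∀ z ∈ W, p.localFun D u (z, g z) =
      p.ψ (((chartAt (CSpace n) p.c).symm ∘ g) z) + u (z, ((chartAt (CSpace n) p.c).symm ∘ g) z) :=
    fun z hz => indicator_of_mem (show (z, g z) ∈ D ×ˢ p.O from ⟨hWD hz, hmap hz⟩) _
  have h1 := (h.sub W ((chartAt (CSpace n) p.c).symm ∘ g) p.U p.ψ hW hWD
    (mdifferentiableOn_chart_symm_comp hg p.c fun z hz => (p.subset (hmap hz)).1)
    p.isLocalPotential (fun z hz => (p.subset (hmap hz)).2)).submean a r hr hball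
  rw [hval a (hball (Metric.mem_closedBall_self hr.le)), setAverage_eq,
    setIntegral_congr_fun measurableSet_closedBall fun z hz => hval z (hball hz), ← setAverage_eq]
  exact h1

theorem CoordPatch.contDiffOn_potential (p : CoordPatch η) :
    ContDiffOn ℝ ∞ (p.ψ ∘ (chartAt (CSpace n) p.c).symm) p.O :=
  (contDiffOn_comp_chart_symm p.isLocalPotential.smooth p.c).mono p.subset

theorem CoordPatch.measurable_localFun (p : CoordPatch η)
    (h : IsBoundedGraphSubharmonic η D u C) : Measurable (p.localFun D u) := by
  refine UpperSemicontinuousOn.measurable_indicator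
    (h.isOpen.prod p.isOpen).measurableSet (UpperSemicontinuousOn.add ?_ ?_)
  · refine ContinuousOn.upperSemicontinuousOn ?_
    exact p.contDiffOn_potential.continuousOn.comp continuousOn_snd fun q hq => hq.2
  · refine h.usc.comp (g := fun q : CSpace m × CSpace n =>
      (q.1, (chartAt (CSpace n) p.c).symm q.2)) ?_ fun q hq => ⟨hq.1, mem_univ _⟩
    exact continuousOn_fst.prodMk (((chartAt (CSpace n) p.c).continuousOn_symm).comp
      continuousOn_snd fun q hq => (p.subset hq.2).1)

theorem CoordPatch.abs_localFun_le (p : CoordPatch η)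
    (h : IsBoundedGraphSubharmonic η D u C) (q : CSpace m × CSpace n) :
    |p.localFun D u q| ≤ |p.Cψ| + |C| := by
  by_cases hq : q ∈ D ×ˢ p.O
  · rw [localFun, indicator_of_mem hq]
    exact (abs_add_le _ _).trans (add_le_add ((p.bound _ hq.2).trans (le_abs_self _))
      ((h.bound _ ⟨hq.1, mem_univ _⟩).trans (le_abs_self _)))
  · rw [localFun, indicator_of_notMem hq, abs_zero]
    positivity

/-- The base average of the local function. -/
noncomputable def CoordPatch.localAverage (p : CoordPatch η) (D : Set (CSpace m))
    (u : CSpace m × X → ℝ) (δ : ℝ) (q : CSpace m × CSpace n) : ℝ :=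
  ⨍ a in Metric.closedBall (0 : CSpace m) δ, p.localFun D u (q.1 - a, q.2)

theorem CoordPatch.isGraphPotential_localAverage (p : CoordPatch η)
    (h : IsBoundedGraphSubharmonic η D u C) (hD₁ : IsOpen D₁) (hδ : 0 < δ)
    (hsub : ∀ z ∈ D₁, Metric.closedBall z δ ⊆ D) :
    IsGraphPotential D₁ p.O (p.localAverage D u δ) (|p.Cψ| + |C|) :=
  (p.graphSubmean_localFun h).isGraphPotential_average hD₁ p.isOpen (p.measurable_localFun h)
    (p.abs_localFun_le h) hδ hsub

theorem CoordPatch.localAverage_eq (p : CoordPatch η)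
    (h : IsBoundedGraphSubharmonic η D u C) (hδ : 0 < δ) {z : CSpace m}
    (hz : Metric.closedBall z δ ⊆ D) {b : CSpace n} (hb : b ∈ p.O) :
    p.localAverage D u δ (z, b) = p.ψ ((chartAt (CSpace n) p.c).symm b) +
      baseAverage u δ z ((chartAt (CSpace n) p.c).symm b) := by
  rw [baseAverage, ← setAverage_const_add hδ (h.integrableOn hz _), localAverage, setAverage_eq,
    setAverage_eq]
  congr 1
  refine setIntegral_congr_fun measurableSet_closedBall fun a ha => ?_
  exact indicator_of_mem (show (z - a, b) ∈ D ×ˢ p.O from ⟨mem_of_closedBall_subset hz ha, hb⟩) _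

theorem CoordPatch.exists_potential_close (p : CoordPatch η) {τ : ℝ} (hτ : 0 < τ) :
    ∃ ε₀ > 0, ∀ b ∈ p.K, ∀ b' ∈ Metric.closedBall b ε₀,
      |p.ψ ((chartAt (CSpace n) p.c).symm b') - p.ψ ((chartAt (CSpace n) p.c).symm b)| ≤ τ := by
  have h1 := p.isCompact.uniformContinuousAt_of_continuousAt
    (p.ψ ∘ (chartAt (CSpace n) p.c).symm) (fun b hb =>
      p.contDiffOn_potential.continuousOn.continuousAt (p.isOpen.mem_nhds (p.K_subset hb)))
    (Metric.dist_mem_uniformity hτ)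
  obtain ⟨ε, hε, h2⟩ := Metric.mem_uniformity_dist.1 h1
  refine ⟨ε / 2, by positivity, fun b hb b' hb' => ?_⟩
  have h3 := h2 (a := b) (b := b') (by
    rw [dist_comm]; exact (Metric.mem_closedBall.1 hb').trans_lt (by linarith)) hb
  rw [← Real.dist_eq, dist_comm]
  exact le_of_lt h3

/-- On small coordinate balls about the core the potential oscillates by at most `τ`, so it can be
taken out of the supremum. -/
theorem CoordPatch.exists_sup_close (p : CoordPatch η)
    (h : IsBoundedGraphSubharmonic η D u C) (hD₁ : IsOpen D₁) (hδ : 0 < δ)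
    (hsub : ∀ z ∈ D₁, Metric.closedBall z δ ⊆ D) {τ : ℝ} (hτ : 0 < τ) :
    ∃ ε₀ > 0, ∀ ε, 0 < ε → ε < ε₀ → ∀ z ∈ D₁, ∀ x ∈ p.core,
      |supBall (fun b => p.localAverage D u δ (z, b)) (chartAt (CSpace n) p.c x) ε -
        (p.ψ x + p.sup (baseAverage u δ z) x ε)| ≤ τ := by
  obtain ⟨ε₁, hε₁, hψ⟩ := p.exists_potential_close hτ
  have hpot := p.isGraphPotential_localAverage h hD₁ hδ hsub
  refine ⟨min ε₁ p.R, lt_min hε₁ p.R_pos, fun ε hε hεlt z hz x hx => ?_⟩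
  have hε1 := hεlt.trans_le (min_le_left _ _)
  have hε2 := hεlt.trans_le (min_le_right _ _)
  set b := chartAt (CSpace n) p.c x with hb
  have hxb : (chartAt (CSpace n) p.c).symm b = x := (chartAt (CSpace n) p.c).left_inv hx.1
  have hAC : ∀ b, |baseAverage u δ z ((chartAt (CSpace n) p.c).symm b)| ≤ C := fun b =>
    h.abs_baseAverage_le hδ (hsub z hz) _
  have hval : ∀ b' ∈ Metric.closedBall b ε, p.localAverage D u δ (z, b') =
      p.ψ ((chartAt (CSpace n) p.c).symm b') +
        baseAverage u δ z ((chartAt (CSpace n) p.c).symm b') := fun b' hb' =>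
    p.localAverage_eq h hδ (hsub z hz) (p.closedBall_subset b hx.2
      (Metric.closedBall_subset_closedBall hε2.le hb'))
  have hψ' : ∀ b' ∈ Metric.closedBall b ε,
      |p.ψ ((chartAt (CSpace n) p.c).symm b') - p.ψ x| ≤ τ := fun b' hb' => by
    have := hψ b hx.2 b' (Metric.closedBall_subset_closedBall hε1.le hb')
    rwa [hxb] at this
  rw [abs_le]
  constructor
  · have h1 : p.sup (baseAverage u δ z) x ε ≤
        supBall (fun b => p.localAverage D u δ (z, b)) b ε - p.ψ x + τ := by
      refine supBall_le hε.le fun b' hb' => ?_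
      have h2 := le_supBall (Φ := fun b => p.localAverage D u δ (z, b)) (fun b => hpot.bound _) hb'
      simp only [hval b' hb'] at h2
      linarith [(abs_le.1 (hψ' b' hb')).1]
    linarith
  · have h1 : supBall (fun b => p.localAverage D u δ (z, b)) b ε ≤
        p.ψ x + p.sup (baseAverage u δ z) x ε + τ := by
      refine supBall_le hε.le fun b' hb' => ?_
      have h2 := le_supBall hAC hb'
      rw [hval b' hb']
      have h3 : supBall (fun b => baseAverage u δ z ((chartAt (CSpace n) p.c).symm b)) b ε =
        p.sup (baseAverage u δ z) x ε := rfl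
      linarith [(abs_le.1 (hψ' b' hb')).2]
    linarith

/-- Local smoothing in a coordinate patch. -/
theorem CoordPatch.exists_mollification (i : Fin m) (p : CoordPatch η)
    (h : IsBoundedGraphSubharmonic η D u C) (hD₁ : IsOpen D₁) (hδ : 0 < δ)
    (hsub : ∀ z ∈ D₁, Metric.closedBall z δ ⊆ D) {δ' : ℝ} (hδ' : 0 < δ') {τ : ℝ} (hτ : 0 < τ) :
    ∃ ε₀ > 0, ∀ ε, 0 < ε → ε < ε₀ → ∃ Γ : CSpace m × CSpace n → ℝ, ContDiff ℝ ∞ Γ ∧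
      GraphSubmean {z | Metric.closedBall z δ' ⊆ D₁} {b | Metric.closedBall b p.R ⊆ p.O} Γ ∧
      ∀ z, Metric.closedBall z δ' ⊆ D₁ → ∀ x ∈ p.core,
        |Γ (z, chartAt (CSpace n) p.c x) - p.ψ x - p.sup (baseAverage u δ z) x ε| ≤ τ := by
  obtain ⟨ε₁, hε₁, h1⟩ := p.exists_sup_close h hD₁ hδ hsub (half_pos hτ)
  obtain ⟨ε₂, hε₂, h2⟩ := (p.isGraphPotential_localAverage h hD₁ hδ hsub).exists_mollification i
    (lt_min hδ' p.R_pos) (half_pos hτ)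
  refine ⟨min ε₁ ε₂, lt_min hε₁ hε₂, fun ε hε hεlt => ?_⟩
  obtain ⟨Γ, hΓ, hΓs, hΓc⟩ := h2 ε hε (hεlt.trans_le (min_le_right _ _))
  refine ⟨Γ, hΓ, hΓs.mono ?_ ?_, fun z hz x hx => ?_⟩
  · exact fun z hz => (Metric.closedBall_subset_closedBall (min_le_left _ _)).trans hz
  · exact fun b hb => (Metric.closedBall_subset_closedBall (min_le_right _ _)).trans hb
  · have hzD : z ∈ D₁ := hz (Metric.mem_closedBall_self hδ'.le)
    have h3 := h1 ε hε (hεlt.trans_le (min_le_left _ _)) z hzD x hx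
    have h4 := hΓc z (chartAt (CSpace n) p.c x)
      ((Metric.closedBall_subset_closedBall (min_le_left _ _)).trans hz)
      ((Metric.closedBall_subset_closedBall (min_le_right _ _)).trans (p.closedBall_subset _ hx.2))
    rw [abs_le] at h3 h4 ⊢
    constructor <;> linarith [h3.1, h3.2, h4.1, h4.2]

/-- The growth estimate is available for the potential plus the average. Removing the potential
costs `τ / 3` at each of the radii `ε` and `L * ε`. -/
theorem CoordPatch.exists_sup_mul_le (i : Fin m) (p : CoordPatch η)
    (h : IsBoundedGraphSubharmonic η D u C) (hD₁ : IsOpen D₁) (hδ : 0 < δ)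
    (hsub : ∀ z ∈ D₁, Metric.closedBall z δ ⊆ D) {τ L : ℝ} (hτ : 0 < τ) (hL : 1 ≤ L) :
    ∃ ε₀ > 0, ∀ ε, 0 < ε → ε < ε₀ → ∀ z ∈ D₁, ∀ x ∈ p.core,
      p.sup (baseAverage u δ z) x (L * ε) ≤ p.sup (baseAverage u δ z) x ε + τ := by
  obtain ⟨ε₁, hε₁, h1⟩ := p.exists_sup_close h hD₁ hδ hsub (show 0 < τ / 3 by positivity)
  obtain ⟨ε₂, hε₂, h2⟩ := (p.isGraphPotential_localAverage h hD₁ hδ hsub).exists_supBall_mul_le i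
    p.R_pos (show 0 < τ / 3 by positivity) hL
  have hL0 : 0 < L := by linarith
  refine ⟨min (ε₁ / L) ε₂, by positivity, fun ε hε hεlt z hz x hx => ?_⟩
  have hε1 : L * ε < ε₁ := by
    have := hεlt.trans_le (min_le_left _ _)
    rw [lt_div_iff₀ hL0] at this
    linarith
  have h3 := h1 ε hε ((le_mul_of_one_le_left hε.le hL).trans_lt hε1) z hz x hx
  have h4 := h1 (L * ε) (by positivity) hε1 z hz x hx
  have h5 := h2 ε hε (hεlt.trans_le (min_le_right _ _)) z hz _ (p.closedBall_subset _ hx.2)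
  rw [abs_le] at h3 h4
  linarith [h3.1, h3.2, h4.1, h4.2]

theorem CoordPatch.isCompact_core (p : CoordPatch η) : IsCompact p.core := by
  have h1 : p.core = (chartAt (CSpace n) p.c).symm '' p.K := by
    rw [(chartAt (CSpace n) p.c).symm_image_eq_source_inter_preimage
      fun b hb => (p.subset (p.K_subset hb)).1]
    rfl
  rw [h1]
  exact p.isCompact.image_of_continuousOn ((chartAt (CSpace n) p.c).continuousOn_symm.mono
    fun b hb => (p.subset (p.K_subset hb)).1)

/-- Suprema over small coordinate balls are almost independent of the patch. -/
theorem CoordPatch.exists_sup_le_sup [T2Space X] (i : Fin m) (p p' : CoordPatch η)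
    (h : IsBoundedGraphSubharmonic η D u C) (hD₁ : IsOpen D₁) (hδ : 0 < δ)
    (hsub : ∀ z ∈ D₁, Metric.closedBall z δ ⊆ D) {τ : ℝ} (hτ : 0 < τ) :
    ∃ ε₀ > 0, ∀ ε, 0 < ε → ε < ε₀ → ∀ z ∈ D₁, ∀ x ∈ p.core ∩ p'.core,
      p.sup (baseAverage u δ z) x ε ≤ p'.sup (baseAverage u δ z) x ε + τ := by
  set S := p.core ∩ p'.core
  have hS : IsCompact S := p.isCompact_core.inter p'.isCompact_core
  set κ := chartAt (CSpace n) p.c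
  set κ' := chartAt (CSpace n) p'.c
  have hK : IsCompact (κ '' S) :=
    hS.image_of_continuousOn (κ.continuousOn.mono fun x hx => hx.1.1)
  have hKΩ : κ '' S ⊆ (κ.symm ≫ₕ κ').source := by
    rintro _ ⟨x, hx, rfl⟩
    simp only [OpenPartialHomeomorph.trans_source, OpenPartialHomeomorph.symm_source]
    refine ⟨κ.map_source hx.1.1, ?_⟩
    change κ.symm (κ x) ∈ κ'.source
    rw [κ.left_inv hx.1.1]
    exact hx.2.1
  -- An `ε`-ball of the first chart lies in an `Lε`-ball of the second, and slow growth of the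
  -- suprema removes the factor `L`.
  obtain ⟨L, hL, ε₁, hε₁, hlip⟩ := exists_lipschitz_near_compact (κ.symm ≫ₕ κ').open_source
    (differentiableOn_chart_change p.c p'.c) hK hKΩ
  obtain ⟨ε₂, hε₂, hgrow⟩ := p'.exists_sup_mul_le i h hD₁ hδ hsub hτ hL
  refine ⟨min ε₁ ε₂, lt_min hε₁ hε₂, fun ε hε hεlt z hz x hx => ?_⟩
  refine le_trans ?_ (hgrow ε hε (hεlt.trans_le (min_le_right _ _)) z hz x hx.2)
  refine supBall_le hε.le fun b hb => ?_
  obtain ⟨hbΩ, hbd⟩ := hlip (κ x) (mem_image_of_mem _ hx) b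
    ((Metric.mem_closedBall.1 hb).trans (hεlt.trans_le (min_le_left _ _)).le)
  simp only [OpenPartialHomeomorph.trans_source, OpenPartialHomeomorph.symm_source] at hbΩ
  simp only [Function.comp] at hbd
  have hκx : κ.symm (κ x) = x := κ.left_inv hx.1.1
  rw [hκx] at hbd
  have h1 : κ' (κ.symm b) ∈ Metric.closedBall (κ' x) (L * ε) :=
    hbd.trans (by gcongr; exact hb)
  have h2 := le_supBall (Φ := fun b => baseAverage u δ z (κ'.symm b))
    (fun b => h.abs_baseAverage_le hδ (hsub z hz) _) h1
  rwa [κ'.left_inv hbΩ.2] at h2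

end Local

end Patch

/-! ### A smooth convex substitute for the maximum -/

section RegularisedMax

/-- The supporting affine function of a smooth convex function. -/
theorem ConvexOn.fderiv_le_sub {E : Type*} [NormedAddCommGroup E] [NormedSpace ℝ E] {M : E → ℝ}
    (hM : ConvexOn ℝ univ M) {t : E} (hd : DifferentiableAt ℝ M t) (v : E) :
    fderiv ℝ M t v ≤ M (t + v) - M t := by
  have h1 : HasDerivAt (fun s : ℝ => M (t + s • v)) (fderiv ℝ M t v) 0 := by
    have h2 : HasDerivAt (fun s : ℝ => t + s • v) v 0 := by
      simpa using ((hasDerivAt_id (0 : ℝ)).smul_const v).const_add t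
    have h3 : HasFDerivAt M (fderiv ℝ M t) (t + (0 : ℝ) • v) := by
      simpa using hd.hasFDerivAt
    exact h3.comp_hasDerivAt 0 h2
  have h4 := h1.tendsto_slope_zero_right
  refine le_of_tendsto h4 ?_
  filter_upwards [Ioo_mem_nhdsGT (show (0 : ℝ) < 1 by norm_num)] with s hs
  have h5 := hM.2 (mem_univ t) (mem_univ (t + v)) (sub_nonneg.2 hs.2.le) hs.1.le (by ring)
  have h6 : (1 - s) • t + s • (t + v) = t + s • v := by module
  rw [h6] at h5
  simp only [smul_eq_mul, zero_add, zero_smul, add_zero] at h5 ⊢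
  rw [inv_mul_le_iff₀ hs.1]
  linarith

variable {ι : Type*} [Fintype ι] [Nonempty ι]

/-- The largest coordinate. -/
noncomputable def maxCoord (t : ι → ℝ) : ℝ := Finset.univ.sup' Finset.univ_nonempty t

theorem le_maxCoord (t : ι → ℝ) (j : ι) : t j ≤ maxCoord t :=
  Finset.le_sup' t (Finset.mem_univ j)

theorem maxCoord_le {t : ι → ℝ} {c : ℝ} (h : ∀ j, t j ≤ c) : maxCoord t ≤ c :=
  Finset.sup'_le _ _ fun j _ => h j

theorem exists_eq_maxCoord (t : ι → ℝ) : ∃ j, maxCoord t = t j := by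
  obtain ⟨j, -, hj⟩ := Finset.exists_mem_eq_sup' (Finset.univ_nonempty (α := ι)) t
  exact ⟨j, hj⟩

theorem maxCoord_le_add_dist (t s : ι → ℝ) : maxCoord t ≤ maxCoord s + dist t s :=
  maxCoord_le fun j => by
    have h1 := dist_le_pi_dist t s j
    rw [Real.dist_eq] at h1
    linarith [le_maxCoord s j, (abs_le.1 h1).2]

theorem dist_maxCoord_le (t s : ι → ℝ) : dist (maxCoord t) (maxCoord s) ≤ dist t s := by
  rw [Real.dist_eq, abs_le]
  have h := maxCoord_le_add_dist s t
  rw [dist_comm] at h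
  constructor <;> linarith [maxCoord_le_add_dist t s]

theorem continuous_maxCoord : Continuous (maxCoord : (ι → ℝ) → ℝ) :=
  (LipschitzWith.of_dist_le_mul (K := 1) fun t s => by
    simpa using dist_maxCoord_le t s).continuous

open scoped Convolution in
/-- A regularised maximum: smooth, convex, increasing, compatible with adding constants, uniformly
close to the maximum, and blind to the coordinates that are far from the maximum. -/
theorem exists_regularised_max (ι : Type*) [Fintype ι] [Nonempty ι] {κ : ℝ} (hκ : 0 < κ) :
    ∃ M : (ι → ℝ) → ℝ, ContDiff ℝ ∞ M ∧ (∀ t j, t j ≤ M t + κ) ∧ (∀ t, ∃ j, M t ≤ t j + κ) ∧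
      (∀ t, ∃ p : ι → ℝ, (∀ j, 0 ≤ p j) ∧ ∑ j, p j = 1 ∧
        ∀ t', M t + ∑ j, p j * (t' j - t j) ≤ M t') ∧
      (∀ t t' : ι → ℝ, ∀ k, (∀ j, t j = t' j ∨ (t j + 2 * κ < t k ∧ t' j + 2 * κ < t' k)) →
        M t = M t') := by
  classical
  let φ : ContDiffBump (0 : ι → ℝ) := ⟨κ / 2, κ, by positivity, by linarith⟩
  set w : (ι → ℝ) → ℝ := φ.normed volume with hw
  have hw0 : ∀ s, 0 ≤ w s := fun s => φ.nonneg_normed s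
  have hw1 : ∫ s, w s = 1 := φ.integral_normed
  have hwz : ∀ s, κ ≤ ‖s‖ → w s = 0 := fun s hs => by
    have : s ∉ Function.support (φ.normed volume) := by
      rw [φ.support_normed_eq, mem_ball_zero_iff]
      exact not_lt.2 hs
    exact Function.notMem_support.1 this
  have hwc : Continuous w := φ.continuous_normed
  have hwint : ∀ g : (ι → ℝ) → ℝ, Continuous g → Integrable fun s => w s * g s := fun g hg =>
    (hwc.mul hg).integrable_of_hasCompactSupport φ.hasCompactSupport_normed.mul_right
  have hcm : ∀ t : ι → ℝ, Continuous fun s => maxCoord (t - s) := fun t =>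
    continuous_maxCoord.comp (continuous_const.sub continuous_id)
  -- Convolution with a kernel supported in the sup-norm ball of radius `κ`: it inherits convexity,
  -- monotonicity and equivariance under constants, and moves the maximum by at most `κ`.
  set M : (ι → ℝ) → ℝ := fun t => ∫ s, w s * maxCoord (t - s) with hM
  have hMconv : M = w ⋆[ContinuousLinearMap.lsmul ℝ ℝ, volume] maxCoord := by
    funext t
    simp [hM, convolution]
  have hsmooth : ContDiff ℝ ∞ M := by
    rw [hMconv]
    exact φ.hasCompactSupport_normed.contDiff_convolution_left _ φ.contDiff_normed
      continuous_maxCoord.locallyIntegrable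
  have hmono : ∀ t t' : ι → ℝ, (∀ j, t j ≤ t' j) → M t ≤ M t' := fun t t' h =>
    integral_mono (hwint _ (hcm t)) (hwint _ (hcm t')) fun s =>
      mul_le_mul_of_nonneg_left (maxCoord_le fun j => (sub_le_sub_right (h j) (s j)).trans
        (le_maxCoord (t' - s) j)) (hw0 s)
  have hadd : ∀ (t : ι → ℝ) (c : ℝ), M (t + fun _ => c) ≤ M t + c := fun t c => by
    have h1 : M t + c = ∫ s, (w s * maxCoord (t - s) + w s * c) := by
      rw [integral_add (hwint _ (hcm t)) (hwint _ continuous_const), integral_mul_const, hw1,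
        one_mul]
    rw [h1]
    refine integral_mono (hwint _ (hcm _)) ((hwint _ (hcm t)).add (hwint _ continuous_const))
      fun s => ?_
    simp only [← mul_add]
    refine mul_le_mul_of_nonneg_left (maxCoord_le fun j => ?_) (hw0 s)
    have := le_maxCoord (t - s) j
    simp only [Pi.sub_apply, Pi.add_apply] at this ⊢
    linarith
  have hconvex : ConvexOn ℝ univ M := by
    refine ⟨convex_univ, fun t _ t' _ a b ha hb hab => ?_⟩
    have h1 : a • M t + b • M t' =
        ∫ s, (a * (w s * maxCoord (t - s)) + b * (w s * maxCoord (t' - s))) := by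
      rw [integral_add ((hwint _ (hcm t)).const_mul a) ((hwint _ (hcm t')).const_mul b),
        integral_const_mul, integral_const_mul]
      rfl
    rw [h1]
    refine integral_mono (hwint _ (hcm _)) (((hwint _ (hcm t)).const_mul a).add
      ((hwint _ (hcm t')).const_mul b)) fun s => ?_
    have h2 : maxCoord (a • t + b • t' - s) ≤ a * maxCoord (t - s) + b * maxCoord (t' - s) := by
      refine maxCoord_le fun j => ?_
      have h3 := mul_le_mul_of_nonneg_left (le_maxCoord (t - s) j) ha
      have h4 := mul_le_mul_of_nonneg_left (le_maxCoord (t' - s) j) hb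
      simp only [Pi.sub_apply, Pi.add_apply, Pi.smul_apply, smul_eq_mul] at h3 h4 ⊢
      have h5 : s j = a * s j + b * s j := by rw [← add_mul, hab, one_mul]
      linarith
    calc w s * maxCoord (a • t + b • t' - s) ≤
        w s * (a * maxCoord (t - s) + b * maxCoord (t' - s)) :=
          mul_le_mul_of_nonneg_left h2 (hw0 s)
      _ = _ := by ring
  have hclose : ∀ t, |M t - maxCoord t| ≤ κ := fun t => by
    have h1 : M t - maxCoord t = ∫ s, w s * (maxCoord (t - s) - maxCoord t) := by
      simp only [mul_sub]
      rw [integral_sub (hwint _ (hcm t)) (hwint _ continuous_const), integral_mul_const, hw1,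
        one_mul]
    have h2 : κ = ∫ s, w s * κ := by rw [integral_mul_const, hw1, one_mul]
    rw [h1, h2]
    refine (abs_integral_le_integral_abs).trans (integral_mono
      (hwint _ ((hcm t).sub continuous_const)).abs (hwint _ continuous_const) fun s => ?_)
    simp only [abs_mul, abs_of_nonneg (hw0 s)]
    by_cases hs : κ ≤ ‖s‖
    · simp [hwz s hs]
    · refine mul_le_mul_of_nonneg_left ?_ (hw0 s)
      have h3 := dist_maxCoord_le (t - s) t
      rw [Real.dist_eq, dist_eq_norm, sub_sub_cancel_left, norm_neg] at h3
      exact h3.trans (not_le.1 hs).le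
  refine ⟨M, hsmooth, fun t j => ?_, fun t => ?_, fun t => ?_, fun t t' k h => ?_⟩
  · linarith [le_maxCoord t j, (abs_le.1 (hclose t)).1]
  · obtain ⟨j, hj⟩ := exists_eq_maxCoord t
    exact ⟨j, by linarith [(abs_le.1 (hclose t)).2]⟩
  -- The weights are the partial derivatives of `M` at `t`: monotonicity makes them nonnegative, and
  -- adding the constants `1` and `-1` shows that their sum is `1`.
  · have hL := fun v => hconvex.fderiv_le_sub (hsmooth.differentiable (by simp) t) v
    set L := fderiv ℝ M t
    have hsum : ∀ v : ι → ℝ, L v = ∑ j, L (Pi.single j 1) * v j := fun v => by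
      conv_lhs => rw [pi_eq_sum_univ' v]
      rw [map_sum]
      refine Finset.sum_congr rfl fun j _ => ?_
      rw [map_smul, smul_eq_mul, mul_comm]
    refine ⟨fun j => L (Pi.single j 1), fun j => ?_, ?_, fun t' => ?_⟩
    · have h1 := hL (-Pi.single j 1)
      have h2 := hmono (t + -Pi.single j 1) t fun i => by
        simp only [Pi.add_apply, Pi.neg_apply, Pi.single_apply]
        split_ifs <;> linarith
      rw [map_neg] at h1
      linarith
    · have h1 := (hsum fun _ => 1).symm
      simp only [mul_one] at h1
      rw [h1]
      refine le_antisymm ?_ ?_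
      · linarith [hL fun _ => 1, hadd t 1]
      · have h2 := hL (-fun _ => 1)
        rw [map_neg] at h2
        have h3 : (-fun _ => 1 : ι → ℝ) = fun _ => -1 := rfl
        rw [h3] at h2
        linarith [hadd t (-1)]
    · have h1 := hL (t' - t)
      rw [hsum, add_sub_cancel] at h1
      simp only [Pi.sub_apply] at h1
      linarith
  · have key : ∀ t t' : ι → ℝ, (∀ j, t j = t' j ∨ (t j + 2 * κ < t k ∧ t' j + 2 * κ < t' k)) →
        M t ≤ M t' := by
      intro t t' h
      refine integral_mono (hwint _ (hcm t)) (hwint _ (hcm t')) fun s => ?_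
      by_cases hs : κ ≤ ‖s‖
      · simp [hwz s hs]
      refine mul_le_mul_of_nonneg_left (maxCoord_le fun j => ?_) (hw0 s)
      have hs' := fun j => abs_le.1 ((norm_le_pi_norm s j).trans (not_le.1 hs).le)
      rcases h j with hj | hj
      · exact (sub_le_sub_right hj.le (s j)).trans (le_maxCoord (t' - s) j)
      · have hk : t k = t' k := (h k).resolve_right fun h => by linarith [h.1]
        refine le_trans ?_ (le_maxCoord (t' - s) k)
        simp only [Pi.sub_apply]
        linarith [(hs' j).1, (hs' k).2]
    exact le_antisymm (key t t' h) (key t' t fun j => (h j).imp Eq.symm And.symm)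

end RegularisedMax

/-! ### Cut-off functions and local smoothings on the manifold -/

section Bump

variable {m n : ℕ} {X : Type*} [TopologicalSpace X] [ChartedSpace (CSpace n) X]
  [IsManifold 𝓘(ℂ, CSpace n) ω X]
  {η : ∀ x : X, TangentSpace 𝓘(ℝ, CSpace n) x →L[ℝ] TangentSpace 𝓘(ℝ, CSpace n) x →L[ℝ] ℝ}

/-- A smooth function that is at most one, supported in the core of a coordinate patch. -/
structure IsPatchBump (p : CoordPatch η) (θ : X → ℝ) : Prop where
  smooth : ContMDiff 𝓘(ℝ, CSpace n) 𝓘(ℝ, ℝ) ∞ θ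
  le_one : ∀ x, θ x ≤ 1
  mem_core : ∀ x, θ x ≠ 0 → x ∈ p.core

theorem exists_patchBump [T2Space X] (hη : IsKahlerForm η) (x : X) :
    ∃ (p : CoordPatch η) (θ : X → ℝ), IsPatchBump p θ ∧ ∀ᶠ y in 𝓝 x, θ y = 1 := by
  have := isManifold_real_of_complex (n := n) (X := X)
  obtain ⟨U, ψ, hxU, hψ⟩ := hη.exists_potential x
  have hop := isOpen_target_inter_preimage_symm (n := n) hψ.isOpen x
  set κ := chartAt (CSpace n) x
  have hmem : κ x ∈ κ.target ∩ κ.symm ⁻¹' U := by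
    refine ⟨κ.map_source (mem_chart_source _ x), ?_⟩
    change κ.symm (κ x) ∈ U
    rwa [κ.left_inv (mem_chart_source _ x)]
  obtain ⟨s, hs, hball⟩ := Metric.nhds_basis_closedBall.mem_iff.1 (hop.mem_nhds hmem)
  obtain ⟨B, hB⟩ := (isCompact_closedBall (κ x) s).exists_bound_of_continuousOn
    ((contDiffOn_comp_chart_symm hψ.smooth x).continuousOn.mono hball)
  -- Nested coordinate balls: the cut-off equals one near the centre and vanishes outside radius `s
  -- / 2`, the radius of the core, and `R = s / 4` keeps balls about core points inside `O`.
  let p : CoordPatch η :=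
    { c := x, U := U, ψ := ψ, O := Metric.ball (κ x) s, K := Metric.closedBall (κ x) (s / 2)
      R := s / 4, Cψ := B
      isLocalPotential := hψ
      isOpen := Metric.isOpen_ball
      subset := Metric.ball_subset_closedBall.trans hball
      bound := fun b hb => hB b (Metric.ball_subset_closedBall hb)
      isCompact := isCompact_closedBall _ _
      R_pos := by positivity
      closedBall_subset := fun b hb => by
        refine Metric.closedBall_subset_ball' ?_
        rw [Metric.mem_closedBall] at hb
        linarith }
  let θ : SmoothBumpFunction 𝓘(ℝ, CSpace n) x :=
    { rIn := s / 4, rOut := s / 2, rIn_pos := by positivity, rIn_lt_rOut := by linarith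
      closedBall_subset := by
        simp only [mfld_simps]
        exact (Metric.closedBall_subset_closedBall (by linarith)).trans
          (hball.trans inter_subset_left) }
  refine ⟨p, θ, ⟨θ.contMDiff, fun y => θ.le_one, fun y hy => ?_⟩,
    θ.eventuallyEq_one⟩
  have h1 : y ∈ Function.support θ := hy
  rw [θ.support_eq_inter_preimage] at h1
  exact ⟨h1.1, Metric.ball_subset_closedBall (by simpa [mfld_simps] using h1.2)⟩

namespace IsPatchBump

variable {p : CoordPatch η} {θ : X → ℝ}

theorem isOpen_support (hθ : IsPatchBump p θ) : IsOpen {x | θ x ≠ 0} :=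
  hθ.smooth.continuous.isOpen_preimage _ isOpen_ne

/-- The part of a holomorphic map where the bump function does not vanish, in the chart. -/
theorem isOpen_inter (hθ : IsPatchBump p θ) {W : Set (CSpace m)} (hW : IsOpen W)
    {f : CSpace m → X} (hf : MDifferentiableOn 𝓘(ℂ, CSpace m) 𝓘(ℂ, CSpace n) f W) :
    IsOpen (W ∩ f ⁻¹' {x | θ x ≠ 0}) :=
  isOpen_preimage_source_of_mdifferentiableOn hW hf hθ.isOpen_support

/-- The bound is obtained for the potential of the patch; it passes to every other potential with
the same constant, because their Laplacians along `f` agree. -/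
theorem exists_laplacian_comp_le (hη : IsKahlerForm η) (hθ : IsPatchBump p θ) (m : ℕ) :
    ∃ C > 0, ∀ (W : Set (CSpace m)) (f : CSpace m → X) (U : Set X) (ψ : X → ℝ), IsOpen W →
      MDifferentiableOn 𝓘(ℂ, CSpace m) 𝓘(ℂ, CSpace n) f W → IsLocalPotential η U ψ →
      ∀ z ∈ W, f z ∈ U → θ (f z) ≠ 0 → ContDiffAt ℝ 2 (fun y => θ (f y)) z ∧
        -(C * Laplacian.laplacian (fun y => ψ (f y)) z) ≤
          Laplacian.laplacian (fun y => θ (f y)) z := by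
  have hsm : ContDiffOn ℝ ∞ (θ ∘ (chartAt (CSpace n) p.c).symm) p.O :=
    (contDiffOn_comp_chart_symm (contMDiffOn_univ.2 hθ.smooth) p.c).mono fun b hb =>
      ⟨(p.subset hb).1, mem_univ _⟩
  obtain ⟨C, hC, h⟩ := p.isLocalPotential.exists_laplacian_comp_le (m := m) hη p.c p.isOpen
    p.subset p.isCompact p.K_subset hsm
  refine ⟨C, hC, fun W f U ψ hW hf hψ z hz hfz hne => ?_⟩
  have hcore := hθ.mem_core _ hne
  have hU : f z ∈ p.U := by
    have := (p.subset (p.K_subset hcore.2)).2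
    rwa [mem_preimage, (chartAt (CSpace n) p.c).left_inv hcore.1] at this
  refine ⟨(laplacian_comp_eq_of_chart (stdOrthonormalBasis ℝ (CSpace m)) hW hf hz p.c hcore.1
    ((hsm.contDiffAt (p.isOpen.mem_nhds (p.K_subset hcore.2))).of_le
      (WithTop.coe_le_coe.2 le_top))).2, ?_⟩
  rw [hψ.laplacian_comp_eq hW hf hz hfz, ← p.isLocalPotential.laplacian_comp_eq hW hf hz hU]
  exact h W f hW hf z hz hcore.1 hcore.2

end IsPatchBump

theorem CoordPatch.core_subset (p : CoordPatch η) : p.core ⊆ p.U := fun x hx => by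
  have := (p.subset (p.K_subset hx.2)).2
  rwa [mem_preimage, (chartAt (CSpace n) p.c).left_inv hx.1] at this

/-- A function of coordinates minus the local potential, read on the manifold. -/
noncomputable def CoordPatch.toManifold (p : CoordPatch η) (Γ : CSpace m × CSpace n → ℝ)
    (q : CSpace m × X) : ℝ :=
  Γ (q.1, chartAt (CSpace n) p.c q.2) - p.ψ q.2

theorem CoordPatch.contMDiffAt_toManifold (p : CoordPatch η) {Γ : CSpace m × CSpace n → ℝ}
    (hΓ : ContDiff ℝ ∞ Γ) {q : CSpace m × X} (hq : q.2 ∈ p.core) :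
    ContMDiffAt (𝓘(ℝ, CSpace m).prod 𝓘(ℝ, CSpace n)) 𝓘(ℝ, ℝ) ∞ (p.toManifold Γ) q := by
  have := isManifold_real_of_complex (n := n) (X := X)
  have h1 : ContMDiffAt 𝓘(ℝ, CSpace n) 𝓘(ℝ, CSpace n) ∞ (chartAt (CSpace n) p.c) q.2 :=
    contMDiffOn_chart.contMDiffAt ((chartAt (CSpace n) p.c).open_source.mem_nhds hq.1)
  have h2 : ContMDiffAt (𝓘(ℝ, CSpace m).prod 𝓘(ℝ, CSpace n)) 𝓘(ℝ, CSpace m × CSpace n) ∞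
      (fun q : CSpace m × X => (q.1, chartAt (CSpace n) p.c q.2)) q :=
    contMDiffAt_fst.prodMk_space (h1.comp q contMDiffAt_snd)
  have h3 : ContMDiffAt 𝓘(ℝ, CSpace n) 𝓘(ℝ, ℝ) ∞ p.ψ q.2 :=
    p.isLocalPotential.smooth.contMDiffAt
      (p.isLocalPotential.isOpen.mem_nhds (p.core_subset hq))
  exact (hΓ.contMDiff.contMDiffAt.comp q h2).sub (h3.comp q contMDiffAt_snd)

/-- The Laplacians of `ψ` and of the patch potential along `f` cancel, leaving that of `Γ` along the
graph of `f` in coordinates, which is nonnegative by the sub-mean value property. -/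
theorem CoordPatch.laplacian_toManifold_nonneg {p : CoordPatch η} {θ : X → ℝ}
    (hθ : IsPatchBump p θ)
    {Γ : CSpace m × CSpace n → ℝ} (hΓ : ContDiff ℝ ∞ Γ) {D : Set (CSpace m)}
    (hsub : GraphSubmean D {b | Metric.closedBall b p.R ⊆ p.O} Γ) {W : Set (CSpace m)}
    {f : CSpace m → X} {U : Set X} {ψ : X → ℝ} (hW : IsOpen W) (hWD : W ⊆ D)
    (hf : MDifferentiableOn 𝓘(ℂ, CSpace m) 𝓘(ℂ, CSpace n) f W) (hψ : IsLocalPotential η U ψ)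
    {z : CSpace m} (hz : z ∈ W) (hfz : f z ∈ U) (hne : θ (f z) ≠ 0) :
    ContDiffAt ℝ 2 (fun y => p.toManifold Γ (y, f y)) z ∧
      0 ≤ Laplacian.laplacian (fun y => ψ (f y) + p.toManifold Γ (y, f y)) z := by
  have hcore := hθ.mem_core _ hne
  set κ := chartAt (CSpace n) p.c
  have hW' := hθ.isOpen_inter hW hf
  set W' := W ∩ f ⁻¹' {x | θ x ≠ 0}
  have hzW' : z ∈ W' := ⟨hz, hne⟩
  have hκf : DifferentiableOn ℂ (κ ∘ f) W' := (differentiableOn_chart_comp hf p.c).mono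
    fun y hy => ⟨hy.1, (hθ.mem_core _ hy.2).1⟩
  have hg : ContDiffAt ℝ 2 (fun y => Γ (y, κ (f y))) z := by
    have h1 : ContDiffAt ℝ 2 (κ ∘ f) z :=
      ((contDiffOn_real_of_holomorphic hW' hκf).contDiffAt (hW'.mem_nhds hzW')).of_le
        (WithTop.coe_le_coe.2 le_top)
    exact ((hΓ.of_le (WithTop.coe_le_coe.2 le_top)).contDiffAt).comp z
      (contDiffAt_id.prodMk h1)
  have hp := p.isLocalPotential.contDiffAt_comp hW hf hz (p.core_subset hcore)
  have hψ' := hψ.contDiffAt_comp hW hf hz hfz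
  refine ⟨hg.sub hp, ?_⟩
  have h2 : 0 ≤ Laplacian.laplacian (fun y => Γ (y, κ (f y))) z := by
    refine laplacian_nonneg_of_submean hg ?_
    obtain ⟨s, hs, hball⟩ := Metric.nhds_basis_closedBall.mem_iff.1 (hW'.mem_nhds hzW')
    filter_upwards [Ioo_mem_nhdsGT hs] with r hr
    exact hsub W' (κ ∘ f) z r hW' (inter_subset_left.trans hWD) hκf
      (fun y hy => p.closedBall_subset _ (hθ.mem_core _ hy.2).2) hr.1
      ((Metric.closedBall_subset_closedBall hr.2.le).trans hball)
  have h3 : (fun y => ψ (f y) + p.toManifold Γ (y, f y)) =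
      ((fun y => ψ (f y)) + fun y => Γ (y, κ (f y))) - fun y => p.ψ (f y) := by
    funext y
    simp only [CoordPatch.toManifold, Pi.add_apply, Pi.sub_apply]
    ring
  have h4 : ContDiffAt ℝ 2 ((fun y => ψ (f y)) + fun y => Γ (y, κ (f y))) z := hψ'.add hg
  rw [h3, h4.laplacian_sub hp, hψ'.laplacian_add hg,
    hψ.laplacian_comp_eq hW hf hz hfz,
    ← p.isLocalPotential.laplacian_comp_eq hW hf hz (p.core_subset hcore)]
  linarith

end Bump

/-! ### Gluing by the regularised maximum -/

section Glue

open scoped Classical in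
theorem contDiffAt_laplacian_sum {m : ℕ} {ι : Type*} (s : Finset ι) (c : ι → ℝ)
    (F : ι → CSpace m → ℝ) {z : CSpace m} (hF : ∀ j ∈ s, ContDiffAt ℝ 2 (F j) z) :
    ContDiffAt ℝ 2 (∑ j ∈ s, c j • F j) z ∧
      Laplacian.laplacian (∑ j ∈ s, c j • F j) z =
        ∑ j ∈ s, c j * Laplacian.laplacian (F j) z := by
  induction s using Finset.induction_on with
  | empty =>
    simp only [Finset.sum_empty]
    refine ⟨contDiffAt_const, ?_⟩
    have := InnerProductSpace.laplacian_const (E := CSpace m) (F := ℝ) (c := 0)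
    exact congrFun this z
  | insert j s hj ih =>
    obtain ⟨h1, h2⟩ := ih fun i hi => hF i (Finset.mem_insert_of_mem hi)
    have h3 := hF j (Finset.mem_insert_self _ _)
    have h4 : ContDiffAt ℝ 2 (c j • F j) z := contDiffAt_const.smul h3
    rw [Finset.sum_insert hj, Finset.sum_insert hj]
    refine ⟨h4.add h1, ?_⟩
    rw [h4.laplacian_add h1, h2, InnerProductSpace.laplacian_smul _ h3, smul_eq_mul]

variable {m n : ℕ} {X : Type*} [TopologicalSpace X] [ChartedSpace (CSpace n) X]
  [IsManifold 𝓘(ℂ, CSpace n) ω X]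
  {η : ∀ x : X, TangentSpace 𝓘(ℝ, CSpace n) x →L[ℝ] TangentSpace 𝓘(ℝ, CSpace n) x →L[ℝ] ℝ}

/-- Gluing local smoothings that almost agree, by a regularised maximum. -/
theorem exists_glue (hη : IsKahlerForm η) {ι : Type*} [Fintype ι] [Nonempty ι]
    {θ : ι → X → ℝ} {g : ι → CSpace m × X → ℝ} {D : Set (CSpace m)} {B C σ γ : ℝ}
    (hD : IsOpen D) (hC : 0 ≤ C) (hγ : 0 < γ) (hσ : σ < γ / 2)
    (hθ : ∀ j, ContMDiff 𝓘(ℝ, CSpace n) 𝓘(ℝ, ℝ) ∞ (θ j))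
    (hθ1 : ∀ j x, θ j x ≤ 1) (hcov : ∀ x, ∃ j, θ j x = 1)
    (hθΔ : ∀ j (W : Set (CSpace m)) (f : CSpace m → X) (U : Set X) (ψ : X → ℝ), IsOpen W →
      MDifferentiableOn 𝓘(ℂ, CSpace m) 𝓘(ℂ, CSpace n) f W → IsLocalPotential η U ψ →
      ∀ z ∈ W, f z ∈ U → θ j (f z) ≠ 0 → ContDiffAt ℝ 2 (fun y => θ j (f y)) z ∧
        -(C * Laplacian.laplacian (fun y => ψ (f y)) z) ≤
          Laplacian.laplacian (fun y => θ j (f y)) z)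
    (hg : ∀ j q, q.1 ∈ D → θ j q.2 ≠ 0 →
      ContMDiffAt (𝓘(ℝ, CSpace m).prod 𝓘(ℝ, CSpace n)) 𝓘(ℝ, ℝ) ∞ (g j) q)
    (hgB : ∀ j q, q.1 ∈ D → θ j q.2 ≠ 0 → |g j q| ≤ B)
    (hgg : ∀ j k q, q.1 ∈ D → θ j q.2 ≠ 0 → θ k q.2 ≠ 0 → g j q ≤ g k q + σ)
    (hgΔ : ∀ j (W : Set (CSpace m)) (f : CSpace m → X) (U : Set X) (ψ : X → ℝ), IsOpen W →
      W ⊆ D → MDifferentiableOn 𝓘(ℂ, CSpace m) 𝓘(ℂ, CSpace n) f W → IsLocalPotential η U ψ →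
      ∀ z ∈ W, f z ∈ U → θ j (f z) ≠ 0 → ContDiffAt ℝ 2 (fun y => g j (y, f y)) z ∧
        0 ≤ Laplacian.laplacian (fun y => ψ (f y) + g j (y, f y)) z) :
    ∃ V : CSpace m × X → ℝ,
      (∀ q, q.1 ∈ D →
        ContMDiffAt (𝓘(ℝ, CSpace m).prod 𝓘(ℝ, CSpace n)) 𝓘(ℝ, ℝ) ∞ V q) ∧
      (∀ q, q.1 ∈ D → ∃ k, θ k q.2 ≠ 0 ∧ g k q ≤ V q) ∧
      (∀ q, q.1 ∈ D → ∃ k, θ k q.2 ≠ 0 ∧ V q ≤ g k q + 2 * γ) ∧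
      ∀ (W : Set (CSpace m)) (f : CSpace m → X) (U : Set X) (ψ : X → ℝ), IsOpen W →
        W ⊆ D → MDifferentiableOn 𝓘(ℂ, CSpace m) 𝓘(ℂ, CSpace n) f W → IsLocalPotential η U ψ →
        ∀ z ∈ W, f z ∈ U → ContDiffAt ℝ 2 (fun y => V (y, f y)) z ∧
          -(γ * C * Laplacian.laplacian (fun y => ψ (f y)) z) ≤
            Laplacian.laplacian (fun y => ψ (f y) + V (y, f y)) z := by
  classical
  -- The bound `γ / 2` keeps the regularisation error within the estimates for `V`. The other bound
  -- leaves a gap of more than `2κ` between a candidate with `θ < 1/2` and one with `θ = 1`.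
  set κ := min (γ / 2) ((γ / 2 - σ) / 4) with hκdef
  have hκ : 0 < κ := lt_min (half_pos hγ) (by linarith)
  have hκ1 : κ ≤ γ / 2 := min_le_left _ _
  have hκ2 : κ ≤ (γ / 2 - σ) / 4 := min_le_right _ _
  obtain ⟨M, hMs, hMl, hMu, hMc, hMloc⟩ := exists_regularised_max ι hκ
  set G : ι → CSpace m × X → ℝ := fun j q =>
    if θ j q.2 ≠ 0 then g j q + γ * θ j q.2 else -(B + 2 * κ) with hG
  set V : CSpace m × X → ℝ := fun q => M fun j => G j q with hV
  have hGne : ∀ j q, θ j q.2 ≠ 0 → G j q = g j q + γ * θ j q.2 := fun j q h => if_pos h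
  have hGz : ∀ j q, θ j q.2 = 0 → G j q = -(B + 2 * κ) := fun j q h => if_neg (not_not.2 h)
  have hGk : ∀ k q, q.1 ∈ D → θ k q.2 = 1 → G k q = g k q + γ ∧ θ k q.2 ≠ 0 ∧ -B ≤ g k q := by
    intro k q hq hk
    have h0 : θ k q.2 ≠ 0 := by rw [hk]; exact one_ne_zero
    exact ⟨by rw [hGne _ _ h0, hk, mul_one], h0, (abs_le.1 (hgB k q hq h0)).1⟩
  -- `G j` may jump where `θ j` vanishes. Near `q`, indices outside `A` have `θ < 1/2` and are
  -- invisible to `M`, so they may be replaced by a constant; those in `A` keep `θ > 1/4`, where `g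
  -- j` is smooth.
  have hloc : ∀ q : CSpace m × X, ∀ A : Finset ι, (∀ j, j ∈ A ↔ 1 / 4 < θ j q.2) →
      ∀ᶠ q' in 𝓝 q, (∀ j ∈ A, θ j q'.2 ≠ 0) ∧ (q'.1 ∈ D →
        V q' = M fun j => if j ∈ A then g j q' + γ * θ j q'.2 else -(B + 2 * κ)) := by
    intro q A hA
    have hev : ∀ᶠ q' in 𝓝 q, ∀ j, (j ∈ A → 1 / 4 < θ j q'.2) ∧ (j ∉ A → θ j q'.2 < 1 / 2) := by
      refine eventually_all.2 fun j => ?_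
      have hcont : ContinuousAt (fun q' : CSpace m × X => θ j q'.2) q :=
        ((hθ j).continuous.comp continuous_snd).continuousAt
      by_cases hj : j ∈ A
      · filter_upwards [hcont.eventually_const_lt ((hA j).1 hj)] with q' h
        exact ⟨fun _ => h, fun h' => absurd hj h'⟩
      · have : θ j q.2 < 1 / 2 := by
          have := not_lt.1 fun h => hj ((hA j).2 h)
          linarith
        filter_upwards [hcont.eventually_lt_const this] with q' h
        exact ⟨fun h' => absurd h' hj, fun _ => h⟩
    filter_upwards [hev] with q' h
    have hne : ∀ j ∈ A, θ j q'.2 ≠ 0 := fun j hj =>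
      (lt_trans (by norm_num) ((h j).1 hj)).ne'
    refine ⟨hne, fun hq' => ?_⟩
    obtain ⟨k, hk⟩ := hcov q'.2
    obtain ⟨hk1, hk0, hkB⟩ := hGk k q' hq' hk
    have hkA : k ∈ A := by
      by_contra hkA
      linarith [(h k).2 hkA]
    refine hMloc _ _ k fun j => ?_
    by_cases hj : j ∈ A
    · left
      simp only [if_pos hj]
      exact hGne j q' (hne j hj)
    · right
      simp only [if_neg hj, if_pos hkA, hk1, hk, mul_one]
      refine ⟨?_, by linarith⟩
      by_cases hj0 : θ j q'.2 = 0
      · rw [hGz j q' hj0]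
        linarith
      · rw [hGne j q' hj0]
        have h1 := hgg j k q' hq' hj0 hk0
        have h2 : γ * θ j q'.2 ≤ γ * (1 / 2) :=
          mul_le_mul_of_nonneg_left ((h j).2 hj).le hγ.le
        linarith
  refine ⟨V, fun q hq => ?_, fun q hq => ?_, fun q hq => ?_, ?_⟩
  · set A := Finset.univ.filter fun j => 1 / 4 < θ j q.2
    have hA : ∀ j, j ∈ A ↔ 1 / 4 < θ j q.2 := fun j => by simp [A]
    have hev : V =ᶠ[𝓝 q] fun q' => M fun j =>
        if j ∈ A then g j q' + γ * θ j q'.2 else -(B + 2 * κ) := by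
      filter_upwards [hloc q A hA, continuousAt_fst.eventually (hD.mem_nhds hq)] with q' h hq'
      exact h.2 hq'
    refine ContMDiffAt.congr_of_eventuallyEq ?_ hev
    refine hMs.contMDiff.contMDiffAt.comp q (contMDiffAt_pi_space.2 fun j => ?_)
    by_cases hj : j ∈ A
    · simp only [if_pos hj]
      have h0 : θ j q.2 ≠ 0 := (hloc q A hA).self_of_nhds.1 j hj
      exact (hg j q hq h0).add (contMDiffAt_const.mul
        ((hθ j).contMDiffAt.comp q contMDiffAt_snd))
    · simp only [if_neg hj]
      exact contMDiffAt_const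
  · obtain ⟨k, hk⟩ := hcov q.2
    obtain ⟨hk1, hk0, hkB⟩ := hGk k q hq hk
    refine ⟨k, hk0, ?_⟩
    have := hMl (fun j => G j q) k
    simp only [hk1] at this
    linarith
  · obtain ⟨k, hk⟩ := hcov q.2
    obtain ⟨hk1, hk0, hkB⟩ := hGk k q hq hk
    have h1 := hMl (fun j => G j q) k
    obtain ⟨j, hj⟩ := hMu fun j => G j q
    simp only [hk1] at h1
    have hj0 : θ j q.2 ≠ 0 := fun h0 => by
      simp only [hGz j q h0] at hj
      linarith
    refine ⟨j, hj0, ?_⟩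
    simp only [hGne j q hj0] at hj
    have h2 : γ * θ j q.2 ≤ γ * 1 := mul_le_mul_of_nonneg_left (hθ1 j q.2) hγ.le
    change M _ ≤ _
    linarith
  · intro W f U ψ hW hWD hf hψ z hz hfz
    set A := Finset.univ.filter fun j => 1 / 4 < θ j (f z)
    have hA : ∀ j, j ∈ A ↔ 1 / 4 < θ j (f z) := fun j => by simp [A]
    set h : ι → CSpace m → ℝ := fun j y =>
      if j ∈ A then g j (y, f y) + γ * θ j (f y) else -(B + 2 * κ) with hh
    have hfc : ContinuousAt f z := hf.continuousOn.continuousAt (hW.mem_nhds hz)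
    have hev : (fun y => V (y, f y)) =ᶠ[𝓝 z] fun y => M fun j => h j y := by
      have h1 : ContinuousAt (fun y => (y, f y)) z := continuousAt_id.prodMk hfc
      filter_upwards [h1.eventually (hloc (z, f z) A hA), hW.mem_nhds hz] with y hy hyW
      exact hy.2 (hWD hyW)
    have hψ2 := hψ.contDiffAt_comp hW hf hz hfz
    have hψ0 := hψ.laplacian_comp_nonneg hη hW hf hz hfz
    set L := Laplacian.laplacian (fun y => ψ (f y)) z with hL
    have hγC : 0 ≤ γ * C * L := by positivity
    have hh2 : ∀ j, ContDiffAt ℝ 2 (h j) z ∧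
        -(γ * C * L) ≤ Laplacian.laplacian (fun y => ψ (f y) + h j y) z := by
      intro j
      by_cases hj : j ∈ A
      · simp only [hh, if_pos hj]
        have h0 : θ j (f z) ≠ 0 := (hloc (z, f z) A hA).self_of_nhds.1 j hj
        obtain ⟨hg2, hgL⟩ := hgΔ j W f U ψ hW hWD hf hψ z hz hfz h0
        obtain ⟨hθ2, hθL⟩ := hθΔ j W f U ψ hW hf hψ z hz hfz h0
        have hθ3 : ContDiffAt ℝ 2 (γ • fun y => θ j (f y)) z := contDiffAt_const.smul hθ2
        refine ⟨hg2.add hθ3, ?_⟩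
        have e : (fun y => ψ (f y) + (g j (y, f y) + γ * θ j (f y))) =
            (fun y => ψ (f y) + g j (y, f y)) + γ • fun y => θ j (f y) := by
          funext y
          simp only [Pi.add_apply, Pi.smul_apply, smul_eq_mul]
          ring
        rw [e, (hψ2.add hg2).laplacian_add hθ3, InnerProductSpace.laplacian_smul _ hθ2, smul_eq_mul]
        have := mul_le_mul_of_nonneg_left hθL hγ.le
        linarith
      · simp only [hh, if_neg hj]
        refine ⟨contDiffAt_const, ?_⟩
        have hc := InnerProductSpace.laplacian_const (E := CSpace m) (c := -(B + 2 * κ))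
        have e : (fun y => ψ (f y) + -(B + 2 * κ)) =
            (fun y => ψ (f y)) + fun _ => -(B + 2 * κ) := rfl
        rw [e, hψ2.laplacian_add contDiffAt_const, congrFun hc z]
        simp only [Pi.zero_apply, add_zero]
        linarith
    have hMh : ContDiffAt ℝ 2 (fun y => M fun j => h j y) z :=
      ((hMs.of_le (WithTop.coe_le_coe.2 le_top)).contDiffAt).comp z
        (contDiffAt_pi.2 fun j => (hh2 j).1)
    have hVc : ContDiffAt ℝ 2 (fun y => V (y, f y)) z := hMh.congr_of_eventuallyEq hev
    refine ⟨hVc, ?_⟩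
    -- A supporting affine function of `M` yields a convex combination of the `h j`, plus a
    -- constant, that lies below `V` along `f` and touches it at `z`. As the weights sum to one, `ψ`
    -- may be added to every term.
    obtain ⟨q, hq0, hq1, hqM⟩ := hMc fun j => h j z
    obtain ⟨hF2, hFL⟩ := contDiffAt_laplacian_sum Finset.univ q
      (fun j y => ψ (f y) + h j y) (z := z) fun j _ => hψ2.add (hh2 j).1
    set S := ∑ j, q j • fun y => ψ (f y) + h j y with hS
    have hSy : ∀ y, S y = ψ (f y) + ∑ j, q j * h j y := fun y => by
      simp only [hS, Finset.sum_apply, Pi.smul_apply, smul_eq_mul, mul_add, Finset.sum_add_distrib]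
      rw [← Finset.sum_mul, hq1, one_mul]
    set k := M (fun j => h j z) - ∑ j, q j * h j z with hk
    have hle := laplacian_le_of_touching (g := fun y => ψ (f y) + V (y, f y))
      (g' := S + fun _ => k) (hψ2.add hVc) (hF2.add contDiffAt_const) (by
        filter_upwards [hev] with y hy
        have h1 := hqM fun j => h j y
        simp only [mul_sub, Finset.sum_sub_distrib] at h1
        simp only [Pi.add_apply, hSy, hy]
        linarith) (by
        simp only [Pi.add_apply, hSy, hev.self_of_nhds]
        linarith)
    have hc := InnerProductSpace.laplacian_const (E := CSpace m) (c := k)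
    rw [hF2.laplacian_add contDiffAt_const, congrFun hc z, hFL] at hle
    refine le_trans ?_ hle
    have h5 : -(γ * C * L) = ∑ j, q j * -(γ * C * L) := by
      rw [← Finset.sum_mul, hq1, one_mul]
    simp only [Pi.zero_apply, add_zero]
    rw [h5]
    exact Finset.sum_le_sum fun j _ => mul_le_mul_of_nonneg_left (hh2 j).2 (hq0 j)

end Glue

/-! ### Global smoothing with a small loss of positivity -/

section Smoothing

theorem eventually_nhdsGT_of_exists {P : ℝ → Prop} (h : ∃ ε₀ > 0, ∀ ε, 0 < ε → ε < ε₀ → P ε) :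
    ∀ᶠ ε in 𝓝[>] (0 : ℝ), P ε := by
  obtain ⟨ε₀, hε₀, h⟩ := h
  filter_upwards [Ioo_mem_nhdsGT hε₀] with ε hε using h ε hε.1 hε.2

variable {m n : ℕ} {X : Type*} [MetricSpace X] [CompactSpace X] [ChartedSpace (CSpace n) X]
  {η : ∀ x : X, TangentSpace 𝓘(ℝ, CSpace n) x →L[ℝ] TangentSpace 𝓘(ℝ, CSpace n) x →L[ℝ] ℝ}

/-- Small coordinate balls around points of the core are small in the metric of the manifold. -/
theorem CoordPatch.exists_dist_symm_le (p : CoordPatch η) {r : ℝ} (hr : 0 < r) :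
    ∃ ε₀ > 0, ∀ ε, 0 < ε → ε < ε₀ → ∀ x ∈ p.core,
      ∀ b ∈ Metric.closedBall (chartAt (CSpace n) p.c x) ε,
        dist ((chartAt (CSpace n) p.c).symm b) x ≤ r := by
  have h1 := p.isCompact.uniformContinuousAt_of_continuousAt (chartAt (CSpace n) p.c).symm
    (fun b hb => (chartAt (CSpace n) p.c).continuousAt_symm (p.subset (p.K_subset hb)).1)
    (Metric.dist_mem_uniformity hr)
  obtain ⟨ε₀, hε₀, h⟩ := Metric.mem_uniformity_dist.1 h1
  refine ⟨ε₀, hε₀, fun ε hε hεlt x hx b hb => ?_⟩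
  have h2 := h (a := chartAt (CSpace n) p.c x) (b := b)
    (by rw [dist_comm]; exact (Metric.mem_closedBall.1 hb).trans_lt hεlt) hx.2
  simp only [mem_ofPred_eq] at h2
  rw [(chartAt (CSpace n) p.c).left_inv hx.1, dist_comm] at h2
  exact h2.le

variable [IsManifold 𝓘(ℂ, CSpace n) ω X]

theorem exists_finite_patchBump_cover [Nonempty X] (hη : IsKahlerForm η) :
    ∃ (t : Finset X) (p : t → CoordPatch η) (θ : t → X → ℝ), Nonempty t ∧
      (∀ j, IsPatchBump (p j) (θ j)) ∧ ∀ x, ∃ j, θ j x = 1 := by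
  choose p θ hθ h1 using fun x : X => exists_patchBump hη x
  obtain ⟨t, -, ht⟩ := isCompact_univ.elim_nhds_subcover (fun x => {y | θ x y = 1})
    fun x _ => h1 x
  have hcov : ∀ x, ∃ j : t, θ j x = 1 := fun x => by
    obtain ⟨y, hy, hxy⟩ := mem_iUnion₂.1 (ht (mem_univ x))
    exact ⟨⟨y, hy⟩, hxy⟩
  exact ⟨t, fun j => p j, fun j => θ j, ⟨(hcov (Classical.arbitrary X)).choose⟩,
    fun j => hθ j, hcov⟩

/-- Smoothing with a small loss of subharmonicity, above `u` and not much above the values of `u`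
at nearby points. -/
theorem IsBoundedGraphSubharmonic.exists_smoothing [Nonempty X] (i : Fin m) (hη : IsKahlerForm η)
    {D K : Set (CSpace m)} {u : CSpace m × X → ℝ} {C : ℝ}
    (h : IsBoundedGraphSubharmonic η D u C) (hK : IsCompact K) (hKD : K ⊆ D) {r γ : ℝ}
    (hr : 0 < r) (hγ : 0 < γ) :
    ∃ (D₂ : Set (CSpace m)) (V : CSpace m × X → ℝ), IsOpen D₂ ∧ K ⊆ D₂ ∧ D₂ ⊆ D ∧
      (∀ q, q.1 ∈ D₂ →
        ContMDiffAt (𝓘(ℝ, CSpace m).prod 𝓘(ℝ, CSpace n)) 𝓘(ℝ, ℝ) ∞ V q) ∧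
      (∀ q, q.1 ∈ D₂ → u q - γ ≤ V q) ∧
      (∀ q, q.1 ∈ D₂ → ∃ q', q'.1 ∈ D ∧ dist q' q ≤ r ∧ V q ≤ u q' + γ) ∧
      ∀ (W : Set (CSpace m)) (f : CSpace m → X) (U : Set X) (ψ : X → ℝ), IsOpen W →
        W ⊆ D₂ → MDifferentiableOn 𝓘(ℂ, CSpace m) 𝓘(ℂ, CSpace n) f W → IsLocalPotential η U ψ →
        ∀ z ∈ W, f z ∈ U → ContDiffAt ℝ 2 (fun y => V (y, f y)) z ∧
          -(γ * Laplacian.laplacian (fun y => ψ (f y)) z) ≤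
            Laplacian.laplacian (fun y => ψ (f y) + V (y, f y)) z := by
  obtain ⟨t, p, θ, ht, hθ, hcov⟩ := exists_finite_patchBump_cover hη
  choose Cθ hCθ hθΔ using fun j => (hθ j).exists_laplacian_comp_le hη m
  set Cs := ∑ j, Cθ j
  have hCs0 : 0 ≤ Cs := Finset.sum_nonneg fun j _ => (hCθ j).le
  have hCle : ∀ j, Cθ j ≤ Cs := fun j =>
    Finset.single_le_sum (fun j _ => (hCθ j).le) (Finset.mem_univ j)
  -- The first bound controls the distance to `u`, the second the loss `γ' * Cs` caused by the
  -- cut-offs.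
  set γ' := min (γ / 8) (γ / (Cs + 1)) with hγ'def
  have hγ' : 0 < γ' := lt_min (by positivity) (by positivity)
  have hγ1 : γ' ≤ γ / 8 := min_le_left _ _
  have hγ2 : γ' * Cs ≤ γ := by
    have h1 : γ' * (Cs + 1) ≤ γ := (le_div_iff₀ (by positivity)).1 (min_le_right _ _)
    linarith
  -- Two local smoothings differ by at most `3 * τ`: one `τ` for each mollification and one for the
  -- change of patch. This is below `γ' / 2`, as gluing requires.
  set τ := γ' / 8 with hτdef
  have hτ : 0 < τ := by positivity
  obtain ⟨δ₀, hδ₀, hthick⟩ := hK.exists_cthickening_subset_open h.isOpen hKD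
  set δ := min (δ₀ / 2) r
  have hδ : 0 < δ := lt_min (by positivity) hr
  set D₁ := Metric.thickening (δ₀ / 2) K
  set D₂ := Metric.thickening (δ₀ / 4) K
  have hball : ∀ {s s' : ℝ} {z : CSpace m}, z ∈ Metric.thickening s K →
      Metric.closedBall z s' ⊆ Metric.thickening (s + s') K := fun {s s' z} hz y hy => by
    rw [Metric.mem_thickening_iff] at hz ⊢
    obtain ⟨a, ha, hza⟩ := hz
    exact ⟨a, ha, by linarith [dist_triangle y z a, Metric.mem_closedBall.1 hy]⟩
  have hD₁ : IsOpen D₁ := Metric.isOpen_thickening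
  have hsub : ∀ z ∈ D₁, Metric.closedBall z δ ⊆ D := fun z hz =>
    (Metric.closedBall_subset_closedBall (min_le_left _ _)).trans ((hball hz).trans
      (by rw [add_halves]; exact (Metric.thickening_subset_cthickening _ _).trans hthick))
  have hδ' : 0 < δ₀ / 4 := by positivity
  have hD₂ : D₂ ⊆ {z | Metric.closedBall z (δ₀ / 4) ⊆ D₁} := fun z hz => by
    have := hball (s' := δ₀ / 4) hz
    rwa [show δ₀ / 4 + δ₀ / 4 = δ₀ / 2 by ring] at this
  have hD₂₁ : D₂ ⊆ D₁ := Metric.thickening_mono (by linarith) _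
  -- There are finitely many patches, so one radius `ε` serves all patches and all pairs of them.
  obtain ⟨ε, hε, hmoll, hcmp, hdist⟩ := ((eventually_mem_nhdsWithin (a := (0 : ℝ)) (s := Ioi 0)).and
    ((eventually_all.2 fun j => eventually_nhdsGT_of_exists
      ((p j).exists_mollification i h hD₁ hδ hsub hδ' hτ)).and
    ((eventually_all.2 fun j => eventually_all.2 fun k => eventually_nhdsGT_of_exists
      (CoordPatch.exists_sup_le_sup i (p j) (p k) h hD₁ hδ hsub hτ)).and
    (eventually_all.2 fun j => eventually_nhdsGT_of_exists
      ((p j).exists_dist_symm_le hr))))).exists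
  replace hε : 0 < ε := hε
  choose Γ hΓ hΓsub hΓclose using hmoll
  set g : t → CSpace m × X → ℝ := fun j => (p j).toManifold (Γ j) with hgdef
  set S : t → CSpace m × X → ℝ := fun j q => (p j).sup (baseAverage u δ q.1) q.2 ε with hSdef
  have hgS : ∀ j q, q.1 ∈ D₂ → θ j q.2 ≠ 0 → |g j q - S j q| ≤ τ := fun j q hq hne =>
    hΓclose j q.1 (hD₂ hq) q.2 ((hθ j).mem_core _ hne)
  have hAle : ∀ q : CSpace m × X, q.1 ∈ D₂ → ∀ j, θ j q.2 ≠ 0 →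
      baseAverage u δ q.1 q.2 ≤ S j q := fun q hq j hne => by
    have h1 := le_supBall
      (Φ := fun b => baseAverage u δ q.1 ((chartAt (CSpace n) (p j).c).symm b))
      (fun b => h.abs_baseAverage_le hδ (hsub q.1 (hD₂₁ hq)) _)
      (Metric.mem_closedBall_self (x := chartAt (CSpace n) (p j).c q.2) hε.le)
    rwa [(chartAt (CSpace n) (p j).c).left_inv ((hθ j).mem_core _ hne).1] at h1
  have hSle : ∀ q : CSpace m × X, q.1 ∈ D₂ → ∀ j, S j q ≤ C := fun q hq j =>
    supBall_le hε.le fun b _ => (abs_le.1 (h.abs_baseAverage_le hδ (hsub q.1 (hD₂₁ hq)) _)).2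
  have key := exists_glue (θ := θ) (g := g) (D := D₂) (B := C + τ) (C := Cs)
    (σ := 3 * τ) (γ := γ') hη Metric.isOpen_thickening hCs0 hγ' (by linarith)
    (fun j => (hθ j).smooth) (fun j => (hθ j).le_one) hcov
    (fun j W f U ψ hW hf hψ z hz hfz hne => by
      obtain ⟨h1, h2⟩ := hθΔ j W f U ψ hW hf hψ z hz hfz hne
      refine ⟨h1, le_trans (neg_le_neg ?_) h2⟩
      exact mul_le_mul_of_nonneg_right (hCle j) (hψ.laplacian_comp_nonneg hη hW hf hz hfz))
    (fun j q hq hne => (p j).contMDiffAt_toManifold (hΓ j) ((hθ j).mem_core _ hne))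
    (fun j q hq hne => by
      have h1 := abs_le.1 (hgS j q hq hne)
      have h2 := (abs_le.1 (h.abs_baseAverage_le hδ (hsub q.1 (hD₂₁ hq)) q.2)).1
      rw [abs_le]
      constructor <;> linarith [hAle q hq j hne, hSle q hq j, h1.1, h1.2])
    (fun j k q hq hj hk => by
      have h1 := hcmp j k q.1 (hD₂₁ hq) q.2 ⟨(hθ j).mem_core _ hj, (hθ k).mem_core _ hk⟩
      change S j q ≤ S k q + τ at h1
      linarith [(abs_le.1 (hgS j q hq hj)).2, (abs_le.1 (hgS k q hq hk)).1])
    (fun j W f U ψ hW hWD hf hψ z hz hfz hne =>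
      CoordPatch.laplacian_toManifold_nonneg (hθ j) (hΓ j) ((hΓsub j).mono hD₂ subset_rfl)
        hW hWD hf hψ hz hfz hne)
  obtain ⟨V, hVs, hVl, hVu, hVΔ⟩ := key
  refine ⟨D₂, V, Metric.isOpen_thickening, Metric.self_subset_thickening hδ' K, ?_, hVs,
    fun q hq => ?_, fun q hq => ?_, fun W f U ψ hW hWD hf hψ z hz hfz => ?_⟩
  · exact (Metric.thickening_subset_cthickening _ _).trans
      ((Metric.cthickening_mono (by linarith) _).trans hthick)
  · obtain ⟨k, hk, hkV⟩ := hVl q hq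
    have h1 := h.le_baseAverage hη hδ (hsub q.1 (hD₂₁ hq)) q.2
    linarith [hAle q hq k hk, (abs_le.1 (hgS k q hq hk)).1]
  · obtain ⟨k, hk, hkV⟩ := hVu q hq
    -- Otherwise all values of `u` near `q` are below `V q - γ`, hence so are the base averages and
    -- their supremum; but `V q` exceeds that supremum by at most `2 * γ' + τ < γ`.
    by_contra! hcon
    have h1 : S k q ≤ V q - γ := by
      refine supBall_le hε.le fun b hb => ?_
      obtain ⟨z', hz', hle⟩ := h.exists_baseAverage_le hδ (hsub q.1 (hD₂₁ hq))
        ((chartAt (CSpace n) (p k).c).symm b)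
      have h2 := hcon (z', (chartAt (CSpace n) (p k).c).symm b) (hsub q.1 (hD₂₁ hq) hz')
        (max_le ((Metric.mem_closedBall.1 hz').trans (min_le_right _ _))
          (hdist k q.2 ((hθ k).mem_core _ hk) b hb))
      linarith
    linarith [(abs_le.1 (hgS k q hq hk)).2]
  · obtain ⟨h1, h2⟩ := hVΔ W f U ψ hW hWD hf hψ z hz hfz
    refine ⟨h1, le_trans (neg_le_neg ?_) h2⟩
    exact mul_le_mul_of_nonneg_right hγ2 (hψ.laplacian_comp_nonneg hη hW hf hz hfz)

end Smoothing

/-! ### The decreasing sequence and the gain of positivity -/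

section Main

/-- Uniform version of upper semicontinuity below a continuous majorant. -/
theorem exists_radius_of_usc_le {Y : Type*} [PseudoMetricSpace Y] {S K : Set Y} {u V : Y → ℝ}
    (hu : UpperSemicontinuousOn u S) (hK : IsCompact K) (hKS : K ⊆ S)
    (hV : ∀ q ∈ K, ContinuousAt V q) {s s' : ℝ} (hs' : 0 < s') (hle : ∀ q ∈ K, u q ≤ V q + s) :
    ∃ r > 0, ∀ q ∈ K, ∀ q' ∈ S, dist q' q ≤ r → u q' ≤ V q + s + s' := by
  have h1 : ∀ q : K, ∃ N : Set Y, IsOpen N ∧ (q : Y) ∈ N ∧ ∀ q' ∈ N,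
      (q' ∈ S → u q' < u q + s' / 2) ∧ V q - s' / 2 < V q' := fun ⟨q, hq⟩ => by
    have h2 := eventually_nhdsWithin_iff.1 (hu q (hKS hq) (u q + s' / 2) (by linarith))
    have h3 := (hV q hq).eventually_const_lt (show V q - s' / 2 < V q by linarith)
    obtain ⟨N, hN, hNo, hqN⟩ := eventually_nhds_iff.1 (h2.and h3)
    exact ⟨N, hNo, hqN, hN⟩
  choose N hNo hqN hN using h1
  obtain ⟨r, hr, hball⟩ := lebesgue_number_lemma_of_metric hK hNo
    fun q hq => mem_iUnion.2 ⟨⟨q, hq⟩, hqN _⟩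
  refine ⟨r / 2, half_pos hr, fun q hq q' hq' hd => ?_⟩
  obtain ⟨i, hi⟩ := hball q hq
  have h2 := (hN i q' (hi (Metric.mem_ball.2 (by linarith)))).1 hq'
  have h3 := (hN i q (hi (Metric.mem_ball_self hr))).2
  linarith [hle i i.2]

/-- Dependent choice: how fine the next smoothing must be depends on the one already chosen. -/
theorem exists_seq_of_step {α : Type*} {Q : ℕ → α → Prop} {R : ℕ → α → α → Prop}
    (h0 : ∃ a, Q 0 a) (hstep : ∀ j a, Q j a → ∃ b, Q (j + 1) b ∧ R j a b) :
    ∃ a : ℕ → α, (∀ j, Q j (a j)) ∧ ∀ j, R j (a j) (a (j + 1)) := by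
  choose next hnext using hstep
  obtain ⟨a₀, ha₀⟩ := h0
  let S : ∀ j, {a // Q j a} := fun j =>
    Nat.rec ⟨a₀, ha₀⟩ (fun j a => ⟨next j a.1 a.2, (hnext j a.1 a.2).1⟩) j
  exact ⟨fun j => (S j).1, fun j => (S j).2, fun j => (hnext j (S j).1 (S j).2).2⟩

variable {m n : ℕ}

/-- The approximation theorem for a metrized compact complex manifold. -/
theorem IsBoundedGraphSubharmonic.exists_approximation {X : Type*} [MetricSpace X] [CompactSpace X]
    [ChartedSpace (CSpace n) X] [IsManifold 𝓘(ℂ, CSpace n) ω X] [Nonempty X] (i : Fin m)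
    {η : ∀ x : X, TangentSpace 𝓘(ℝ, CSpace n) x →L[ℝ] TangentSpace 𝓘(ℝ, CSpace n) x →L[ℝ] ℝ}
    (hη : IsKahlerForm η) {D K : Set (CSpace m)} {u : CSpace m × X → ℝ} {C : ℝ}
    (h : IsBoundedGraphSubharmonic η D u C) (hK : IsCompact K) (hKD : K ⊆ D) :
    ∃ (ε : ℕ → ℝ) (v : ℕ → CSpace m × X → ℝ),
      (∀ j, 0 < ε j) ∧ StrictAnti ε ∧ Tendsto ε atTop (𝓝 0) ∧
      (∀ j, ∀ p ∈ K ×ˢ (univ : Set X),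
        ContMDiffAt (𝓘(ℝ, CSpace m).prod 𝓘(ℝ, CSpace n)) 𝓘(ℝ, ℝ) ∞ (v j) p) ∧
      (∀ p ∈ K ×ˢ (univ : Set X),
        Antitone (fun j => v j p) ∧ Tendsto (fun j => v j p) atTop (𝓝 (u p))) ∧
      (∀ (j : ℕ) (W : Set (CSpace m)) (f : CSpace m → X) (U : Set X) (ψ : X → ℝ),
        IsOpen W → W ⊆ K → MDifferentiableOn 𝓘(ℂ, CSpace m) 𝓘(ℂ, CSpace n) f W →
        IsLocalPotential η U ψ → MapsTo f W U →
        ∀ z ∈ W, ε j * Laplacian.laplacian (fun y => ψ (f y)) z ≤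
          Laplacian.laplacian (fun y => ψ (f y) + v j (y, f y)) z) := by
  -- With ratio `1/4` the monotonicity of `V j + 2 * γ j` is exactly balanced: passing to nearby
  -- points costs `γ j + γ j / 4`, and the new smoothing costs `3 * γ (j + 1) = 3 * γ j / 4`.
  set γ : ℕ → ℝ := fun j => (1 / 4) ^ (j + 1) with hγdef
  have hγ : ∀ j, 0 < γ j := fun j => by positivity
  have hγs : ∀ j, γ (j + 1) = γ j / 4 := fun j => by simp only [hγdef, pow_succ]; ring
  have hγanti : StrictAnti γ := strictAnti_nat_of_succ_lt fun j => by
    rw [hγs]; linarith [hγ j]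
  have hγ4 : ∀ j, γ j ≤ 1 / 4 := fun j => by
    have := hγanti.antitone (Nat.zero_le j)
    simpa [hγdef] using this
  have hγlim : Tendsto γ atTop (𝓝 0) :=
    (tendsto_add_atTop_iff_nat 1).2
      (tendsto_pow_atTop_nhds_zero_of_lt_one (by norm_num : (0 : ℝ) ≤ 1 / 4) (by norm_num))
  have hKc : IsCompact (K ×ˢ (univ : Set X)) := hK.prod isCompact_univ
  have hKD' : K ×ˢ (univ : Set X) ⊆ D ×ˢ univ := prod_mono hKD subset_rfl
  let Q : ℕ → (CSpace m × X → ℝ) → Prop := fun j V =>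
    (∀ q ∈ K ×ˢ (univ : Set X),
      ContMDiffAt (𝓘(ℝ, CSpace m).prod 𝓘(ℝ, CSpace n)) 𝓘(ℝ, ℝ) ∞ V q) ∧
    (∀ q ∈ K ×ˢ (univ : Set X), u q - γ j ≤ V q) ∧
    (∀ q ∈ K ×ˢ (univ : Set X), ∃ q' ∈ D ×ˢ (univ : Set X), dist q' q ≤ γ j ∧ V q ≤ u q' + γ j) ∧
    ∀ (W : Set (CSpace m)) (f : CSpace m → X) (U : Set X) (ψ : X → ℝ), IsOpen W →
      W ⊆ K → MDifferentiableOn 𝓘(ℂ, CSpace m) 𝓘(ℂ, CSpace n) f W → IsLocalPotential η U ψ →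
      ∀ z ∈ W, f z ∈ U → ContDiffAt ℝ 2 (fun y => V (y, f y)) z ∧
        -(γ j * Laplacian.laplacian (fun y => ψ (f y)) z) ≤
          Laplacian.laplacian (fun y => ψ (f y) + V (y, f y)) z
  have hex : ∀ j r, 0 < r → ∃ V, Q j V ∧ ∀ q ∈ K ×ˢ (univ : Set X), ∃ q' ∈ D ×ˢ (univ : Set X),
      dist q' q ≤ r ∧ V q ≤ u q' + γ j := by
    intro j r hr
    obtain ⟨D₂, V, -, hKD₂, -, hVs, hVl, hVu, hVΔ⟩ :=
      h.exists_smoothing i hη hK hKD (lt_min (hγ j) hr) (hγ j)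
    refine ⟨V, ⟨fun q hq => hVs q (hKD₂ hq.1), fun q hq => hVl q (hKD₂ hq.1), fun q hq => ?_,
      fun W f U ψ hW hWK => hVΔ W f U ψ hW (hWK.trans hKD₂)⟩, fun q hq => ?_⟩
    · obtain ⟨q', hq', hd, hle⟩ := hVu q (hKD₂ hq.1)
      exact ⟨q', ⟨hq', mem_univ _⟩, hd.trans (min_le_left _ _), hle⟩
    · obtain ⟨q', hq', hd, hle⟩ := hVu q (hKD₂ hq.1)
      exact ⟨q', ⟨hq', mem_univ _⟩, hd.trans (min_le_right _ _), hle⟩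
  obtain ⟨V, hQ, hR⟩ := exists_seq_of_step (Q := Q)
    (R := fun j V V' => ∀ q ∈ K ×ˢ (univ : Set X), V' q + 2 * γ (j + 1) ≤ V q + 2 * γ j)
    ((hex 0 1 one_pos).imp fun V hV => hV.1) (by
      intro j V hV
      obtain ⟨r, hr, hru⟩ := exists_radius_of_usc_le h.usc hKc hKD'
        (fun q hq => (hV.1 q hq).continuousAt) (s := γ j) (s' := γ j / 4) (by linarith [hγ j])
        fun q hq => by linarith [hV.2.1 q hq]
      obtain ⟨V', hV', hd⟩ := hex (j + 1) r hr
      refine ⟨V', hV', fun q hq => ?_⟩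
      obtain ⟨q', hq', hdist, hle⟩ := hd q hq
      linarith [hru q hq q' hq' hdist, hγs j])
  set w : ℕ → CSpace m × X → ℝ := fun j q => V j q + 2 * γ j with hwdef
  have hwC : ∀ j, ∀ q ∈ K ×ˢ (univ : Set X), w j q ≤ C + 1 := fun j q hq => by
    obtain ⟨q', hq', -, hle⟩ := (hQ j).2.2.1 q hq
    simp only [hwdef]
    linarith [(abs_le.1 (h.bound q' hq')).2, hγ4 j]
  have hwlim : ∀ q ∈ K ×ˢ (univ : Set X), Tendsto (fun j => w j q) atTop (𝓝 (u q)) := by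
    intro q hq
    rw [tendsto_order]
    constructor
    · intro a ha
      refine Eventually.of_forall fun j => ?_
      simp only [hwdef]
      linarith [(hQ j).2.1 q hq, hγ j]
    · intro a ha
      set e := (a - u q) / 2 with he
      have he0 : 0 < e := by rw [he]; linarith
      have h1 := h.usc q (hKD' hq) (u q + e) (by linarith)
      obtain ⟨r, hr, hball⟩ := Metric.eventually_nhds_iff.1 (eventually_nhdsWithin_iff.1 h1)
      filter_upwards [hγlim.eventually_lt_const hr,
        hγlim.eventually_lt_const (show (0 : ℝ) < e / 3 by positivity)] with j hj1 hj2
      obtain ⟨q', hq', hd, hle⟩ := (hQ j).2.2.1 q hq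
      have h2 := hball (hd.trans_lt hj1) hq'
      simp only [hwdef]
      linarith
  -- Contraction towards the upper bound `C + 1` keeps the sequence decreasing, since `w j - (C + 1)
  -- ≤ 0` and the factors increase. Up to a constant, `ψ` plus the new function is `2γψ + (1 - 2γ)(ψ
  -- + V)`, so the net coefficient of `Δψ` is at least `2γ - (1 - 2γ)γ ≥ γ`.
  refine ⟨γ, fun j q => (1 - 2 * γ j) * (w j q - (C + 1)) + (C + 1), hγ, hγanti, hγlim,
    fun j p hp => ?_, fun p hp => ⟨antitone_nat_of_succ_le fun j => ?_, ?_⟩, ?_⟩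
  · exact (contMDiffAt_const.mul ((((hQ j).1 p hp).add contMDiffAt_const).sub
      contMDiffAt_const)).add contMDiffAt_const
  · have h1 : w (j + 1) p ≤ w j p := hR j p hp
    have h2 := hwC (j + 1) p hp
    have h3 : (1 - 2 * γ (j + 1)) * (w (j + 1) p - (C + 1)) ≤
        (1 - 2 * γ j) * (w (j + 1) p - (C + 1)) :=
      mul_le_mul_of_nonpos_right (by linarith [hγs j, hγ j]) (by linarith)
    have h4 : (1 - 2 * γ j) * (w (j + 1) p - (C + 1)) ≤ (1 - 2 * γ j) * (w j p - (C + 1)) :=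
      mul_le_mul_of_nonneg_left (by linarith) (by linarith [hγ4 j])
    linarith
  · have h1 := ((((hγlim.const_mul 2).const_sub 1).mul ((hwlim p hp).sub_const (C + 1))).add_const
      (C + 1))
    have h2 : (1 - 2 * (0 : ℝ)) * (u p - (C + 1)) + (C + 1) = u p := by ring
    rwa [h2] at h1
  · intro j W f U ψ hW hWK hf hψ hmap z hz
    obtain ⟨hV2, hVL⟩ := (hQ j).2.2.2 W f U ψ hW hWK hf hψ z hz (hmap hz)
    have hψ2 := hψ.contDiffAt_comp hW hf hz (hmap hz)
    have hψ0 := hψ.laplacian_comp_nonneg hη hW hf hz (hmap hz)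
    set L := Laplacian.laplacian (fun y => ψ (f y)) z
    set k := (1 - 2 * γ j) * (2 * γ j - (C + 1)) + (C + 1) with hk
    have e : (fun y => ψ (f y) + ((1 - 2 * γ j) * (w j (y, f y) - (C + 1)) + (C + 1))) =
        ((2 * γ j) • (fun y => ψ (f y)) + (1 - 2 * γ j) • fun y => ψ (f y) + V j (y, f y)) +
          fun _ => k := by
      funext y
      simp only [Pi.add_apply, Pi.smul_apply, smul_eq_mul, hwdef, hk]
      ring
    have hs : ContDiffAt ℝ 2 (fun y => ψ (f y) + V j (y, f y)) z := hψ2.add hV2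
    have h1 : ContDiffAt ℝ 2 ((2 * γ j) • (fun y => ψ (f y))) z := contDiffAt_const.smul hψ2
    have h2 : ContDiffAt ℝ 2 ((1 - 2 * γ j) • fun y => ψ (f y) + V j (y, f y)) z :=
      contDiffAt_const.smul hs
    have h12 : ContDiffAt ℝ 2 ((2 * γ j) • (fun y => ψ (f y)) +
        (1 - 2 * γ j) • fun y => ψ (f y) + V j (y, f y)) z := h1.add h2
    have hc := InnerProductSpace.laplacian_const (E := CSpace m) (c := k)
    simp only
    rw [e, h12.laplacian_add contDiffAt_const, congrFun hc z, h1.laplacian_add h2,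
      InnerProductSpace.laplacian_smul _ hψ2, InnerProductSpace.laplacian_smul _ hs]
    simp only [smul_eq_mul, Pi.zero_apply, add_zero]
    have h3 := mul_le_mul_of_nonneg_left hVL (show 0 ≤ 1 - 2 * γ j by linarith [hγ4 j])
    have h4 : 0 ≤ γ j * γ j * L := mul_nonneg (mul_nonneg (hγ j).le (hγ j).le) hψ0
    linarith

end Main

theorem mainTheorem10 {m n : ℕ} (hm : 1 ≤ m)
    {X : Type*} [TopologicalSpace X] [T2Space X] [CompactSpace X]
    [ChartedSpace (CSpace n) X] [IsManifold 𝓘(ℂ, CSpace n) ω X]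
    (η : ∀ x : X, TangentSpace 𝓘(ℝ, CSpace n) x →L[ℝ] TangentSpace 𝓘(ℝ, CSpace n) x →L[ℝ] ℝ)
    (hη : IsKahlerForm η)
    (D D' : Set (CSpace m)) (hD : IsOpen D) (hD' : IsOpen D')
    (hcompact : IsCompact (closure D')) (hsub : closure D' ⊆ D)
    (u : CSpace m × X → ℝ)
    (hbdd : ∃ C : ℝ, ∀ p ∈ D ×ˢ (univ : Set X), |u p| ≤ C)
    (husc : UpperSemicontinuousOn u (D ×ˢ (univ : Set X)))
    (hu : IsSubharmonicOnGraphs η D u) :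
    ∃ (ε : ℕ → ℝ) (v : ℕ → CSpace m × X → ℝ),
      (∀ j, 0 < ε j) ∧ StrictAnti ε ∧ Tendsto ε atTop (𝓝 0) ∧
      (∀ j, ContMDiffOn (𝓘(ℝ, CSpace m).prod 𝓘(ℝ, CSpace n)) 𝓘(ℝ, ℝ) ∞ (v j)
        (D' ×ˢ (univ : Set X))) ∧
      (∀ p ∈ D' ×ˢ (univ : Set X),
        Antitone (fun j => v j p) ∧ Tendsto (fun j => v j p) atTop (𝓝 (u p))) ∧
      (∀ (j : ℕ) (W : Set (CSpace m)) (f : CSpace m → X) (U : Set X) (ψ : X → ℝ),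
        IsOpen W → W ⊆ D' → MDifferentiableOn 𝓘(ℂ, CSpace m) 𝓘(ℂ, CSpace n) f W →
        IsLocalPotential η U ψ → MapsTo f W U →
        ∀ z ∈ W, ε j * Laplacian.laplacian (fun y => ψ (f y)) z ≤
          Laplacian.laplacian (fun y => ψ (f y) + v j (y, f y)) z) := by
  obtain ⟨C, hC⟩ := hbdd
  rcases isEmpty_or_nonempty X with hX | hX
  · refine ⟨fun j => (1 / 2) ^ j, fun _ _ => 0, fun j => by positivity,
      fun a b hab => pow_lt_pow_right_of_lt_one₀ (by norm_num) (by norm_num) hab,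
      tendsto_pow_atTop_nhds_zero_of_lt_one (by norm_num) (by norm_num),
      fun j => contMDiffOn_const, fun p _ => (hX.false p.2).elim,
      fun j W f _ _ _ _ _ _ _ z _ => (hX.false (f z)).elim⟩
  -- A compact manifold is second countable, hence metrizable; the metric serves only to measure
  -- nearness of points.
  have := ChartedSpace.secondCountable_of_sigmaCompact (CSpace n) X
  let _ : MetricSpace X := TopologicalSpace.metrizableSpaceMetric X
  -- `m ≥ 1` supplies the base coordinate, of index `0`, over which fibre discs are swept out.
  obtain ⟨ε, v, h1, h2, h3, h4, h5, h6⟩ :=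
    IsBoundedGraphSubharmonic.exists_approximation ⟨0, hm⟩ hη ⟨hD, hC, husc, hu⟩ hcompact hsub
  have hsubset : D' ×ˢ (univ : Set X) ⊆ closure D' ×ˢ univ := prod_mono subset_closure subset_rfl
  exact ⟨ε, v, h1, h2, h3, fun j p hp => (h4 j p (hsubset hp)).contMDiffWithinAt,
    fun p hp => h5 p (hsubset hp),
    fun j W f U ψ hW hWD => h6 j W f U ψ hW (hWD.trans subset_closure)⟩
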